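/- **Definitions.** A *Lorenz map* on $I=[u_0,v_0]$ with discontinuity $c\in(u_0,v_0)$ is a map $f: I\setminus\{c\}\to I$ that is continuous and strictly increasing on $[u_0,c)$ and on $(c,v_0]$, with $f(c_-)=v_0$ and $f(c_+)=u_0$ (one-sided limits). Since $f$ is not defined at $c$, an iterate $f^n$ is defined at $x$ only if $x,f(x),\dots,f^{n-1}(x)\neq c$. For $0<c<1$ put $$f_{a,b,c}(x)=ax+1-ac\quad(0\le x<c),\qquad f_{a,b,c}(x)=b(x-c)\quad(c<x\le 1),$$ and let $\mathcal L$ be the set of those $f_{a,b,c}$ that are Lorenz maps on $[0,1]$ and expand on average, i.e. $ac+b(1-c)>1$. Let $f$ be a Lorenz map on $I=[u_0,v_0]$. A *proper completely invariant closed set* of $f$ is a nonempty closed set $E\subset(u_0,v_0)\setminus\{c\}$ with $f(E)=E$ and $\{x\in(u_0,v_0)\setminus\{c\}: f(x)\in E\}=E$. The completely invariant closed sets are these sets and $I$ itself; the *minimal* one is the one contained in all of them. A *minimal-period orbit* $O$ is the orbit of a periodic point in $I\setminus\{c\}$ whose period is the smallest among the periods of all periodic points. A *renormalization* of $f$ is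 a Lorenz map $g$ on a proper subinterval $[u,v]\ni c$ of $I$, $g=f^{\ell}$ on $[u,c)$, $g=f^{r}$ on $(c,v]$, with $\ell,r>1$, that is associated with a proper completely invariant closed set $E$: $\ell$ and $r$ are the maximal integers such that $f^\ell$ is defined and continuous on $(e_-,c)$ and $f^r$ on $(c,e_+)$, where $e_-=\sup\{x\in E:x<c\}$, $e_+=\inf\{x\in E:x>c\}$. If $f$ has no renormalization it is *prime*. The renormalization $Rf=(f^\ell,f^r)$ is the *minimal* one if $\ell\le\ell'$ and $r\le r'$ for every renormalization $(f^{\ell'},f^{r'})$ of $f$. Put $R^0f=f$ and $R^{i}f=R(R^{i-1}f)$ as long as this exists; $f$ is *$m$ times renormalizable* if $R^1f,\dots,R^mf$ exist and $R^mf$ is prime. The renormalization $R^if$ is *periodic* if $R^{i-1}f$ has exactly one minimal-period orbit $O$, and $O$ is the minimal completely invariant closed set of $R^{i-1}f$. **Theorem.** Let $f\in\mathcal L$. 1. $f$ is finitely renormalizable: there is a finite $m\ge 0$ such that $f$ is $m$ times renormalizable, and the renormalization process cannot be carried out more than $m$ times. 2. Each renormalization $R^if$, $1\le i\le m$, is periodic.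 3. (Dichotomy.) $f$ has a minimal-period orbit and a minimal completely invariant closed set $D$, and for every minimal-period orbit $O$ either $D=O$ or $D=[0,1]$. If the minimal period is greater than $1$, then $D$ is the closure of $\bigcup_{n\ge0}\{x\in(0,1): f^n(x)\text{ is defined and lies in }O\}$. -/

import Mathlib

open Set Filter Topology

/-- The data of an interval map `[left, right] → [left, right]` with one exceptional point `crit`.
The value of `map` at `crit` and outside `[left, right]` carries no meaning and is never used. -/
structure LorenzData where
  left : ℝ
  right : ℝ
  crit : ℝ
  map : ℝ → ℝ

namespace LorenzData

/-- `f` is a Lorenz map on `[left, right]` with discontinuity `crit`. -/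
structure IsLorenz (f : LorenzData) : Prop where
  left_lt : f.left < f.crit
  lt_right : f.crit < f.right
  continuousOn_left : ContinuousOn f.map (Ico f.left f.crit)
  continuousOn_right : ContinuousOn f.map (Ioc f.crit f.right)
  strictMonoOn_left : StrictMonoOn f.map (Ico f.left f.crit)
  strictMonoOn_right : StrictMonoOn f.map (Ioc f.crit f.right)
  mapsTo : MapsTo f.map (Icc f.left f.right \ {f.crit}) (Icc f.left f.right)
  tendsto_left : Tendsto f.map (𝓝[<] f.crit) (𝓝 f.right)
  tendsto_right : Tendsto f.map (𝓝[>] f.crit) (𝓝 f.left)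

/-- The `n`-th iterate of `f` is defined (no point of `S` meets `crit` before time `n`) and
continuous on `S`. -/
def IterContOn (f : LorenzData) (n : ℕ) (S : Set ℝ) : Prop :=
  (∀ x ∈ S, ∀ i < n, f.map^[i] x ≠ f.crit) ∧ ContinuousOn f.map^[n] S

/-- `x` is a periodic point of `f` (its orbit never meets `crit`). -/
def IsPeriodicPoint (f : LorenzData) (x : ℝ) : Prop :=
  x ∈ Icc f.left f.right ∧ (∀ i, f.map^[i] x ≠ f.crit) ∧ x ∈ Function.periodicPts f.map

/-- `O` is a periodic orbit of `f` whose period is minimal among the periods of all periodic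
points. -/
def IsMinPeriodOrbit (f : LorenzData) (O : Set ℝ) : Prop :=
  ∃ x, f.IsPeriodicPoint x ∧ O = range (fun i : ℕ => f.map^[i] x) ∧
    ∀ y, f.IsPeriodicPoint y → Function.minimalPeriod f.map x ≤ Function.minimalPeriod f.map y

/-- The closure of the union of all the iterated preimages `f⁻ⁿ(O)`, `n ≥ 0`, the preimages being
taken in the open interval. -/
def preimageClosure (f : LorenzData) (O : Set ℝ) : Set ℝ :=
  closure {x | x ∈ Ioo f.left f.right ∧
    ∃ n : ℕ, (∀ i < n, f.map^[i] x ≠ f.crit) ∧ f.map^[n] x ∈ O}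

/-- `E` is a proper (and nonempty) completely invariant closed set: `f(E) = f⁻¹(E) = E`, where `f`
acts on the open interval without `crit`. -/
structure IsProperCompletelyInvariant (f : LorenzData) (E : Set ℝ) : Prop where
  nonempty : E.Nonempty
  isClosed : IsClosed E
  subset : E ⊆ Ioo f.left f.right \ {f.crit}
  image_eq : f.map '' E = E
  preimage_eq : {x | x ∈ Ioo f.left f.right \ {f.crit} ∧ f.map x ∈ E} = E

/-- A completely invariant closed set is a proper one or the whole interval. -/
def IsCompletelyInvariant (f : LorenzData) (E : Set ℝ) : Prop :=
  E = Icc f.left f.right ∨ f.IsProperCompletelyInvariant E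

/-- `D` is the minimal (that is, the least) completely invariant closed set of `f`. -/
def IsMinimalCompletelyInvariant (f : LorenzData) (D : Set ℝ) : Prop :=
  f.IsCompletelyInvariant D ∧ ∀ E, f.IsCompletelyInvariant E → D ⊆ E

/-- The map `(f^ℓ, f^r)` on `[u, v]`. -/
noncomputable def glue (f : LorenzData) (ℓ r : ℕ) (u v : ℝ) : LorenzData where
  left := u
  right := v
  crit := f.crit
  map := fun x => if x < f.crit then f.map^[ℓ] x else f.map^[r] x

/-- `ℓ` and `r` are the maximal integers such that `f^ℓ` and `f^r` are continuous on `(e₋, crit)`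
and `(crit, e₊)`, where `e₋ = sup {x ∈ E : x < crit}` and `e₊ = inf {x ∈ E : x > crit}`. -/
def HasReturnTimes (f : LorenzData) (E : Set ℝ) (ℓ r : ℕ) : Prop :=
  ∃ p q : ℝ, IsLUB (E ∩ Iio f.crit) p ∧ IsGLB (E ∩ Ioi f.crit) q ∧
    IsGreatest {n : ℕ | f.IterContOn n (Ioo p f.crit)} ℓ ∧
    IsGreatest {n : ℕ | f.IterContOn n (Ioo f.crit q)} r

/-- `g = (f^ℓ, f^r)` is a renormalization of `f`: `ℓ, r > 1`, `g` is a Lorenz map on a proper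
subinterval `[u, v]` around `crit`, and `g` is associated with a proper completely invariant closed
set of `f`. -/
def IsRenormalization (f : LorenzData) (ℓ r : ℕ) (g : LorenzData) : Prop :=
  1 < ℓ ∧ 1 < r ∧
  ∃ u v : ℝ, f.left ≤ u ∧ v ≤ f.right ∧ (u ≠ f.left ∨ v ≠ f.right) ∧
    f.IterContOn ℓ (Ico u f.crit) ∧ f.IterContOn r (Ioc f.crit v) ∧
    g = f.glue ℓ r u v ∧ g.IsLorenz ∧
    ∃ E, f.IsProperCompletelyInvariant E ∧ f.HasReturnTimes E ℓ r

/-- `f` is prime: it has no renormalization. -/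
def IsPrime (f : LorenzData) : Prop :=
  ¬ ∃ ℓ r g, f.IsRenormalization ℓ r g

/-- `g = R f` is the minimal renormalization of `f`. -/
def IsMinimalRenormalization (f g : LorenzData) : Prop :=
  ∃ ℓ r, f.IsRenormalization ℓ r g ∧
    ∀ ℓ' r' g', f.IsRenormalization ℓ' r' g' → ℓ ≤ ℓ' ∧ r ≤ r'

/-- `F 0 = f, F 1 = R f, …, F k = R^k f`: the renormalization process of `f` proceeds (at least)
`k` times. -/
def IsRenormalizationChain (f : LorenzData) (k : ℕ) (F : ℕ → LorenzData) : Prop :=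
  F 0 = f ∧ ∀ i < k, (F i).IsMinimalRenormalization (F (i + 1))

/-- The renormalization process of `f` proceeds exactly `m` times and then stops at a prime map. -/
def IsTimesRenormalizable (f : LorenzData) (m : ℕ) : Prop :=
  ∃ F, f.IsRenormalizationChain m F ∧ (F m).IsPrime

/-- `f` has exactly one periodic orbit `O` of minimal period, and the minimal completely invariant
closed set of `f` is `O`. The minimal renormalization of `f` is periodic when this holds. -/
def MinimalRenormalizationIsPeriodic (f : LorenzData) : Prop :=
  ∃ O, f.IsMinPeriodOrbit O ∧ (∀ O', f.IsMinPeriodOrbit O' → O' = O) ∧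
    f.IsMinimalCompletelyInvariant O

/-- The piecewise linear map `f_{a,b,c}` on `[0, 1]`. -/
noncomputable def pwLinear (a b c : ℝ) : LorenzData where
  left := 0
  right := 1
  crit := c
  map := fun x => if x < c then a * x + 1 - a * c else b * (x - c)

end LorenzData

/-! Expansion on average says exactly that f(0) < f(1): the images of the two branches overlap. The
proof works with all maps having affine branches and this overlap (`IsPL`), on arbitrary intervals.
The class is closed under reflection and under renormalization, and one of the slopes may be below
1.

The first pillar is `IsPL.isGood`: distinct points have distinct itineraries, and there is a
periodic point. If an end point is fixed, or if the discontinuity c lies strictly between f(left)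
and f(right) (which yields a repelling 2-cycle), a length weighted by the distance to the fixed
point or cycle never decreases along a pair with common itinerary, grows by a definite factor
infinitely often, and is bounded at those times. In the other cases f is replaced by its return map
to [c, right] or, symmetrically, to [left, c]. This shortens the interval but keeps f(left) and
f(right), hence the overlap, and a quantitative count of long and short cuts shows that the
procedure ends.

The second pillar concerns a proper completely invariant closed set E with gap (x, y) around c.
Since itineraries separate points, x and y are periodic, and f^ℓ, f^r act affinely on [x, c) and (c,
y] with slopes A, B > 1. The images stay inside the gap, so 1/A + 1/B ≥ 1. If min E were not on the
orbit of x, there would be either two points with the same itinerary, or two disjoint branches of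
f^ℓ and f^r onto one interval, forcing 1/A + 1/B < 1. So the orbit of x contains both min E and max
E = f(x), which by monotonicity makes its points isolated in E (`Frame.least_mem_orbit`,
`Frame.isolated`). If E is minimal under inclusion, it follows that E is this orbit
(`Frame.eq_orbit_of_minimal`).

Such an orbit (`IsCore`) is unique, hence the least completely invariant set. A periodic orbit other
than it must enter the gap, where periods exceed ℓ or r, so it is the only orbit of minimal period.
If there is no proper completely invariant set, preimages of a nontrivial orbit of minimal period
accumulate at c, hence everywhere. Finally, the first renormalization has both slopes above 1, each
later one at least squares the lower bound for the slopes, and the smaller slope never exceeds 2, so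
the process stops. -/

namespace LorenzData

/-! ### Piecewise linear maps and itineraries. -/

/-- `f` is piecewise linear on `[left, right]` with slope `a` on the left and `b` on the right of
the discontinuity, maps the interval to itself, and expands on average. -/
structure IsPL (f : LorenzData) (a b : ℝ) : Prop where
  left_lt : f.left < f.crit
  lt_right : f.crit < f.right
  a_pos : 0 < a
  b_pos : 0 < b
  map_left : ∀ x, f.left ≤ x → x < f.crit → f.map x = f.right - a * (f.crit - x)
  map_right : ∀ x, f.crit < x → x ≤ f.right → f.map x = f.left + b * (x - f.crit)
  left_le : f.left ≤ f.map f.left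
  le_right : f.map f.right ≤ f.right
  overlap : f.map f.left < f.map f.right

/-- `z` and `w` lie strictly on the same side of the discontinuity. -/
def SameSide (f : LorenzData) (z w : ℝ) : Prop :=
  (z < f.crit ∧ w < f.crit) ∨ (f.crit < z ∧ f.crit < w)

/-- The orbits of `z` and `w` are on the same side of the discontinuity for the first `n` times. -/
def SameItin (f : LorenzData) (n : ℕ) (z w : ℝ) : Prop :=
  ∀ i < n, f.SameSide (f.map^[i] z) (f.map^[i] w)

/-- The slope of a piecewise linear map. -/
noncomputable def slope (f : LorenzData) (a b x : ℝ) : ℝ :=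
  if x < f.crit then a else if f.crit < x then b else 1

/-- The slope of the `n`-th iterate of a piecewise linear map. -/
noncomputable def iterSlope (f : LorenzData) (a b : ℝ) (n : ℕ) (x : ℝ) : ℝ :=
  ∏ i ∈ Finset.range n, f.slope a b (f.map^[i] x)

/-- Conjugation by `x ↦ -x`. -/
def reflect (f : LorenzData) : LorenzData where
  left := -f.right
  right := -f.left
  crit := -f.crit
  map := fun x => -f.map (-x)

/-- Different points have different itineraries. -/
def NoHom (f : LorenzData) : Prop :=
  ∀ z ∈ Icc f.left f.right, ∀ w ∈ Icc f.left f.right, z < w → ¬ ∀ n, f.SameItin n z w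

/-- There is a periodic point in the open interval. -/
def HasInnerPeriodic (f : LorenzData) : Prop :=
  ∃ z ∈ Ioo f.left f.right, ∃ n, 0 < n ∧ f.map^[n] z = z ∧ ∀ i, f.map^[i] z ≠ f.crit

variable {f : LorenzData} {a b : ℝ}

lemma SameSide.symm {z w : ℝ} (h : f.SameSide z w) : f.SameSide w z := by
  rcases h with h | h
  · exact Or.inl ⟨h.2, h.1⟩
  · exact Or.inr ⟨h.2, h.1⟩

lemma SameSide.ne {z w : ℝ} (h : f.SameSide z w) : z ≠ f.crit := by
  rcases h with h | h
  · exact h.1.ne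
  · exact h.1.ne'

lemma SameSide.between {z u w : ℝ} (h : f.SameSide z w) (h1 : z ≤ u) (h2 : u ≤ w) :
    f.SameSide z u ∧ f.SameSide u w := by
  rcases h with h | h
  · have := h2.trans_lt h.2
    exact ⟨Or.inl ⟨h.1, this⟩, Or.inl ⟨this, h.2⟩⟩
  · have := h.1.trans_le h1
    exact ⟨Or.inr ⟨h.1, this⟩, Or.inr ⟨this, h.2⟩⟩

lemma SameSide.trans {z u w : ℝ} (h : f.SameSide z u) (h' : f.SameSide u w) : f.SameSide z w := by
  rcases h with h | h <;> rcases h' with h' | h'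
  · exact Or.inl ⟨h.1, h'.2⟩
  · exact absurd (h.2.trans h'.1) (lt_irrefl _)
  · exact absurd (h.2.trans h'.1) (lt_irrefl _)
  · exact Or.inr ⟨h.1, h'.2⟩

lemma not_sameSide {z w : ℝ} (hzw : z ≤ w) (h : ¬ f.SameSide z w) : z ≤ f.crit ∧ f.crit ≤ w := by
  constructor
  · by_contra h'
    push Not at h'
    exact h (Or.inr ⟨h', h'.trans_le hzw⟩)
  · by_contra h'
    push Not at h'
    exact h (Or.inl ⟨hzw.trans_lt h', h'⟩)

lemma SameItin.symm {n : ℕ} {z w : ℝ} (h : f.SameItin n z w) : f.SameItin n w z :=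
  fun i hi => (h i hi).symm

lemma SameItin.trans {n : ℕ} {z u w : ℝ} (h : f.SameItin n z u) (h' : f.SameItin n u w) :
    f.SameItin n z w :=
  fun i hi => (h i hi).trans (h' i hi)

lemma SameItin.mono {m n : ℕ} {z w : ℝ} (h : f.SameItin n z w) (hmn : m ≤ n) :
    f.SameItin m z w :=
  fun i hi => h i (hi.trans_le hmn)

lemma SameItin.ne {n : ℕ} {z w : ℝ} (h : f.SameItin n z w) : ∀ i < n, f.map^[i] z ≠ f.crit :=
  fun i hi => (h i hi).ne

lemma sameItin_add {m n : ℕ} {z w : ℝ} :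
    f.SameItin (m + n) z w ↔ f.SameItin m z w ∧ f.SameItin n (f.map^[m] z) (f.map^[m] w) := by
  constructor
  · intro h
    refine ⟨h.mono (by omega), fun i hi => ?_⟩
    have := h (i + m) (by omega)
    rwa [Function.iterate_add_apply, Function.iterate_add_apply] at this
  · rintro ⟨h1, h2⟩ i hi
    by_cases hm : i < m
    · exact h1 i hm
    · have := h2 (i - m) (by omega)
      rwa [← Function.iterate_add_apply, ← Function.iterate_add_apply,
        Nat.sub_add_cancel (by omega)] at this

lemma sameItin_one {z w : ℝ} : f.SameItin 1 z w ↔ f.SameSide z w := by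
  constructor
  · intro h
    exact h 0 (by omega)
  · intro h i hi
    obtain rfl : i = 0 := by omega
    exact h

lemma sameItin_zero {z w : ℝ} : f.SameItin 0 z w := fun i hi => absurd hi (by omega)

/-! ### Affine behaviour of iterates along common itineraries. -/

namespace IsPL

lemma map_left_end (hf : f.IsPL a b) : f.map f.left = f.right - a * (f.crit - f.left) :=
  hf.map_left _ le_rfl hf.left_lt

lemma map_right_end (hf : f.IsPL a b) : f.map f.right = f.left + b * (f.right - f.crit) :=
  hf.map_right _ hf.lt_right le_rfl

/-- The value 1 assigned at the discontinuity makes this unconditional. -/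
lemma slope_pos (hf : f.IsPL a b) (x : ℝ) : 0 < f.slope a b x := by
  unfold slope
  split_ifs
  exacts [hf.a_pos, hf.b_pos, one_pos]

lemma iterSlope_pos (hf : f.IsPL a b) (n : ℕ) (x : ℝ) : 0 < f.iterSlope a b n x :=
  Finset.prod_pos fun _ _ => hf.slope_pos _

lemma map_mem (hf : f.IsPL a b) {x : ℝ} (hx : x ∈ Icc f.left f.right) (hc : x ≠ f.crit) :
    f.map x ∈ Icc f.left f.right := by
  have h0 := hf.left_le
  have h1 := hf.le_right
  rw [hf.map_left_end] at h0
  rw [hf.map_right_end] at h1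
  have ha := hf.a_pos
  have hb := hf.b_pos
  rcases lt_or_gt_of_ne hc with h | h
  · rw [hf.map_left x hx.1 h]
    constructor
    · nlinarith [mul_nonneg ha.le (sub_nonneg.2 hx.1)]
    · nlinarith
  · rw [hf.map_right x h hx.2]
    constructor
    · nlinarith
    · nlinarith [mul_nonneg hb.le (sub_nonneg.2 hx.2)]

lemma map_mem_Ioo (hf : f.IsPL a b) {x : ℝ} (hx : x ∈ Ioo f.left f.right) (hc : x ≠ f.crit) :
    f.map x ∈ Ioo f.left f.right := by
  have h0 := hf.left_le
  have h1 := hf.le_right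
  rw [hf.map_left_end] at h0
  rw [hf.map_right_end] at h1
  have ha := hf.a_pos
  have hb := hf.b_pos
  rcases lt_or_gt_of_ne hc with h | h
  · rw [hf.map_left x hx.1.le h]
    constructor
    · nlinarith [mul_pos ha (sub_pos.2 hx.1)]
    · nlinarith
  · rw [hf.map_right x h hx.2.le]
    constructor
    · nlinarith
    · nlinarith [mul_pos hb (sub_pos.2 hx.2)]

lemma iter_mem (hf : f.IsPL a b) {n : ℕ} {x : ℝ} (hx : x ∈ Icc f.left f.right)
    (hc : ∀ i < n, f.map^[i] x ≠ f.crit) : f.map^[n] x ∈ Icc f.left f.right := by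
  induction n with
  | zero => exact hx
  | succ n ih =>
    rw [Function.iterate_succ_apply']
    exact hf.map_mem (ih fun i hi => hc i (by omega)) (hc n (by omega))

lemma iter_mem_Ioo (hf : f.IsPL a b) {n : ℕ} {x : ℝ} (hx : x ∈ Ioo f.left f.right)
    (hc : ∀ i < n, f.map^[i] x ≠ f.crit) : f.map^[n] x ∈ Ioo f.left f.right := by
  induction n with
  | zero => exact hx
  | succ n ih =>
    rw [Function.iterate_succ_apply']
    exact hf.map_mem_Ioo (ih fun i hi => hc i (by omega)) (hc n (by omega))

lemma map_sub (hf : f.IsPL a b) {z w : ℝ} (hz : z ∈ Icc f.left f.right)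
    (hw : w ∈ Icc f.left f.right) (h : f.SameSide z w) :
    f.map w - f.map z = f.slope a b z * (w - z) := by
  unfold slope
  rcases h with h | h
  · rw [if_pos h.1, hf.map_left z hz.1 h.1, hf.map_left w hw.1 h.2]
    ring
  · rw [if_neg h.1.le.not_gt, if_pos h.1, hf.map_right z h.1 hz.2, hf.map_right w h.2 hw.2]
    ring

lemma iter_sub (hf : f.IsPL a b) {n : ℕ} {z w : ℝ} (hz : z ∈ Icc f.left f.right)
    (hw : w ∈ Icc f.left f.right) (h : f.SameItin n z w) :
    f.map^[n] w - f.map^[n] z = f.iterSlope a b n z * (w - z) := by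
  induction n with
  | zero => simp [iterSlope]
  | succ n ih =>
    have h' := h.mono (Nat.le_succ n)
    rw [Function.iterate_succ_apply', Function.iterate_succ_apply',
      hf.map_sub (hf.iter_mem hz h'.ne) (hf.iter_mem hw h'.symm.ne) (h n (by omega)), ih h',
      iterSlope, iterSlope, Finset.prod_range_succ]
    ring

lemma iter_lt (hf : f.IsPL a b) {n : ℕ} {z w : ℝ} (hz : z ∈ Icc f.left f.right)
    (hw : w ∈ Icc f.left f.right) (h : f.SameItin n z w) :
    f.map^[n] z < f.map^[n] w ↔ z < w := by
  have h1 := hf.iter_sub hz hw h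
  have h2 := hf.iterSlope_pos n z
  rw [← sub_pos, h1, mul_pos_iff_of_pos_left h2, sub_pos]

lemma iter_le (hf : f.IsPL a b) {n : ℕ} {z w : ℝ} (hz : z ∈ Icc f.left f.right)
    (hw : w ∈ Icc f.left f.right) (h : f.SameItin n z w) :
    f.map^[n] z ≤ f.map^[n] w ↔ z ≤ w := by
  rw [← not_lt, ← not_lt, hf.iter_lt hw hz h.symm]

lemma iter_inj (hf : f.IsPL a b) {n : ℕ} {z w : ℝ} (hz : z ∈ Icc f.left f.right)
    (hw : w ∈ Icc f.left f.right) (h : f.SameItin n z w) (he : f.map^[n] z = f.map^[n] w) :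
    z = w :=
  le_antisymm ((hf.iter_le hz hw h).1 he.le) ((hf.iter_le hw hz h.symm).1 he.ge)

/-- As long as itineraries agree the iterates are increasing, so the set of points with a given
finite itinerary is an interval. -/
lemma between (hf : f.IsPL a b) {n : ℕ} {z u w : ℝ} (hz : z ∈ Icc f.left f.right)
    (hw : w ∈ Icc f.left f.right) (h1 : z ≤ u) (h2 : u ≤ w) (h : f.SameItin n z w) :
    f.SameItin n z u ∧ f.SameItin n u w := by
  have hu : u ∈ Icc f.left f.right := ⟨hz.1.trans h1, h2.trans hw.2⟩
  induction n with
  | zero => exact ⟨sameItin_zero, sameItin_zero⟩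
  | succ n ih =>
    obtain ⟨i1, i2⟩ := ih (h.mono (Nat.le_succ n))
    have := (h n (by omega)).between ((hf.iter_le hz hu i1).2 h1) ((hf.iter_le hu hw i2).2 h2)
    exact ⟨sameItin_add.2 ⟨i1, sameItin_one.2 this.1⟩, sameItin_add.2 ⟨i2, sameItin_one.2 this.2⟩⟩

/-- The difference f(x) - x is affine on the left branch, positive at `left` by assumption, and
tends to right - crit > 0 at the discontinuity. -/
lemma lt_map (hf : f.IsPL a b) (h0 : f.left < f.map f.left) {x : ℝ} (hx : f.left ≤ x)
    (hc : x < f.crit) : x < f.map x := by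
  rw [hf.map_left_end] at h0
  rw [hf.map_left x hx hc]
  have h1 := hf.lt_right
  have h2 := hf.left_lt
  by_contra hcon
  push Not at hcon
  rcases le_or_gt a 1 with ha | ha
  · nlinarith
  · nlinarith [mul_nonneg (sub_nonneg.2 hx) (sub_nonneg.2 ha.le)]

lemma lt_map' (hf : f.IsPL a b) {x : ℝ} (hx : f.left < x) (hc : x < f.crit) : x < f.map x := by
  have h0 := hf.left_le
  rw [hf.map_left_end] at h0
  rw [hf.map_left x hx.le hc]
  have h1 := hf.lt_right
  have h2 := hf.left_lt
  by_contra hcon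
  push Not at hcon
  rcases le_or_gt a 1 with ha | ha
  · nlinarith
  · nlinarith [mul_pos (sub_pos.2 hx) (sub_pos.2 ha)]

lemma exists_left_preimage (hf : f.IsPL a b) {t : ℝ} (h0 : f.map f.left < t) (h1 : t < f.right) :
    ∃ w ∈ Ioo f.left f.crit, f.map w = t := by
  have ha := hf.a_pos
  rw [hf.map_left_end] at h0
  have e : f.crit - (f.crit - (f.right - t) / a) = (f.right - t) / a := by ring
  have hl : f.left < f.crit - (f.right - t) / a := by
    have : (f.right - t) / a < f.crit - f.left := by rw [div_lt_iff₀ ha]; linarith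
    linarith
  have hc : f.crit - (f.right - t) / a < f.crit := by
    have : 0 < (f.right - t) / a := div_pos (by linarith) ha
    linarith
  refine ⟨_, ⟨hl, hc⟩, ?_⟩
  rw [hf.map_left _ hl.le hc]
  field_simp
  ring

lemma exists_right_preimage (hf : f.IsPL a b) {t : ℝ} (h0 : f.left < t)
    (h1 : t < f.map f.right) : ∃ w ∈ Ioo f.crit f.right, f.map w = t := by
  have hb := hf.b_pos
  rw [hf.map_right_end] at h1
  have hl : f.crit + (t - f.left) / b < f.right := by
    have : (t - f.left) / b < f.right - f.crit := by rw [div_lt_iff₀ hb]; linarith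
    linarith
  have hc : f.crit < f.crit + (t - f.left) / b := by
    have : 0 < (t - f.left) / b := div_pos (by linarith) hb
    linarith
  refine ⟨_, ⟨hc, hl⟩, ?_⟩
  rw [hf.map_right _ hc hl.le]
  field_simp
  ring

end IsPL

lemma iterSlope_add (m n : ℕ) (x : ℝ) :
    f.iterSlope a b (m + n) x = f.iterSlope a b m x * f.iterSlope a b n (f.map^[m] x) := by
  unfold iterSlope
  rw [Finset.prod_range_add]
  congr 1
  refine Finset.prod_congr rfl fun i _ => ?_
  rw [← Function.iterate_add_apply, Nat.add_comm]

/-! ### Reflection -/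

lemma reflect_iterate (n : ℕ) (x : ℝ) : f.reflect.map^[n] (-x) = -(f.map^[n] x) := by
  induction n with
  | zero => rfl
  | succ n ih =>
    rw [Function.iterate_succ_apply', Function.iterate_succ_apply', ih]
    simp [reflect]

lemma reflect_reflect : f.reflect.reflect = f := by
  simp [reflect]

lemma reflect_sameSide {z w : ℝ} : f.reflect.SameSide (-z) (-w) ↔ f.SameSide z w := by
  simp only [SameSide, reflect, neg_lt_neg_iff]
  tauto

lemma reflect_sameItin {n : ℕ} {z w : ℝ} :
    f.reflect.SameItin n (-z) (-w) ↔ f.SameItin n z w := by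
  simp only [SameItin, reflect_iterate, reflect_sameSide]

lemma reflect_slope (x : ℝ) : f.reflect.slope b a (-x) = f.slope a b x := by
  simp only [slope, reflect, neg_lt_neg_iff]
  split_ifs with h1 h2
  · exact absurd h1 h2.le.not_gt
  all_goals rfl

lemma reflect_iterSlope (n : ℕ) (x : ℝ) :
    f.reflect.iterSlope b a n (-x) = f.iterSlope a b n x := by
  simp only [iterSlope, reflect_iterate, reflect_slope]

lemma IsPL.reflect (hf : f.IsPL a b) : f.reflect.IsPL b a where
  left_lt := neg_lt_neg hf.lt_right
  lt_right := neg_lt_neg hf.left_lt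
  a_pos := hf.b_pos
  b_pos := hf.a_pos
  map_left x h1 h2 := by
    simp only [LorenzData.reflect] at *
    rw [hf.map_right (-x) (by linarith) (by linarith)]
    ring
  map_right x h1 h2 := by
    simp only [LorenzData.reflect] at *
    rw [hf.map_left (-x) (by linarith) (by linarith)]
    ring
  left_le := by simpa [LorenzData.reflect] using hf.le_right
  le_right := by simpa [LorenzData.reflect] using hf.left_le
  overlap := by simpa [LorenzData.reflect] using hf.overlap

lemma reflect_mem_Icc {z : ℝ} :
    -z ∈ Icc f.reflect.left f.reflect.right ↔ z ∈ Icc f.left f.right := by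
  simp only [reflect, mem_Icc, neg_le_neg_iff]
  tauto

lemma reflect_mem_Ioo {z : ℝ} :
    -z ∈ Ioo f.reflect.left f.reflect.right ↔ z ∈ Ioo f.left f.right := by
  simp only [reflect, mem_Ioo, neg_lt_neg_iff]
  tauto

lemma NoHom.of_reflect (h : f.reflect.NoHom) : f.NoHom := by
  intro z hz w hw hzw hn
  exact h _ (reflect_mem_Icc.2 hw) _ (reflect_mem_Icc.2 hz) (neg_lt_neg hzw)
    fun n => reflect_sameItin.2 (hn n).symm

lemma HasInnerPeriodic.of_reflect (h : f.reflect.HasInnerPeriodic) : f.HasInnerPeriodic := by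
  obtain ⟨z, hz, n, hn, h1, h2⟩ := h
  obtain ⟨z, rfl⟩ : ∃ w, z = -w := ⟨-z, by simp⟩
  refine ⟨z, reflect_mem_Ioo.1 hz, n, hn, ?_, fun i hi => h2 i ?_⟩
  · rw [reflect_iterate] at h1
    linarith
  · rw [reflect_iterate, hi]
    rfl

lemma IsPL.map_lt' (hf : f.IsPL a b) {x : ℝ} (hx : x < f.right)
    (hc : f.crit < x) : f.map x < x := by
  have := hf.reflect.lt_map' (x := -x)
    (by simpa [LorenzData.reflect] using hx) (by simpa [LorenzData.reflect] using hc)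
  simpa [LorenzData.reflect] using this

end LorenzData

/-! ### Pairs of points with a common itinerary. -/

namespace LorenzData

variable {f : LorenzData} {a b : ℝ}

/-- A pair of points with a common itinerary. -/
structure IsHom (f : LorenzData) (z w : ℝ) : Prop where
  mem_left : z ∈ Icc f.left f.right
  mem_right : w ∈ Icc f.left f.right
  lt : z < w
  sameItin : ∀ n, f.SameItin n z w

lemma noHom_of_forall (h : ∀ z w, ¬ f.IsHom z w) : f.NoHom :=
  fun z hz w hw hzw hn => h z w ⟨hz, hw, hzw, hn⟩

lemma IsHom.sameSide {z w : ℝ} (h : f.IsHom z w) : f.SameSide z w := h.sameItin 1 0 one_pos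

lemma IsHom.iterate (hf : f.IsPL a b) {z w : ℝ} (h : f.IsHom z w) (n : ℕ) :
    f.IsHom (f.map^[n] z) (f.map^[n] w) where
  mem_left := hf.iter_mem h.mem_left (h.sameItin n).ne
  mem_right := hf.iter_mem h.mem_right (h.sameItin n).symm.ne
  lt := (hf.iter_lt h.mem_left h.mem_right (h.sameItin n)).2 h.lt
  sameItin m := (sameItin_add.1 (h.sameItin (n + m))).2

lemma IsHom.map (hf : f.IsPL a b) {z w : ℝ} (h : f.IsHom z w) : f.IsHom (f.map z) (f.map w) :=
  h.iterate hf 1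

/-- The engine of all exclusion arguments: the bound `C` is only needed at the times of growth,
because the sequence is monotone in between. -/
lemma not_bounded_of_frequently_growing {q : ℕ → ℝ} {t C : ℝ} (h0 : 0 < q 0)
    (hmono : ∀ n, q n ≤ q (n + 1)) (ht : 1 < t)
    (hgood : ∀ N, ∃ n ≥ N, t * q n ≤ q (n + 1) ∧ q n ≤ C) : False := by
  have hm : Monotone q := monotone_nat_of_le_succ hmono
  have key : ∀ k : ℕ, ∃ N, t ^ k * q 0 ≤ q N := by
    intro k
    induction k with
    | zero => exact ⟨0, by simp⟩
    | succ k ih =>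
      obtain ⟨N, hN⟩ := ih
      obtain ⟨n, hn, h1, -⟩ := hgood N
      refine ⟨n + 1, le_trans ?_ h1⟩
      rw [pow_succ', mul_assoc]
      exact mul_le_mul_of_nonneg_left (hN.trans (hm hn)) (by linarith)
  obtain ⟨k, hk⟩ := pow_unbounded_of_one_lt (C / q 0) ht
  obtain ⟨N, hN⟩ := key k
  obtain ⟨n, hn, -, h2⟩ := hgood N
  rw [div_lt_iff₀ h0] at hk
  linarith [hm hn]

lemma not_bounded_of_growing {q : ℕ → ℝ} {t C : ℝ} (h0 : 0 < q 0) (ht : 1 < t)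
    (hgrow : ∀ n, t * q n ≤ q (n + 1)) (hC : ∀ n, q n ≤ C) : False := by
  have hpos : ∀ n, 0 < q n := by
    intro n
    induction n with
    | zero => exact h0
    | succ n ih => exact (mul_pos (by linarith) ih).trans_le (hgrow n)
  exact not_bounded_of_frequently_growing (C := C) h0
    (fun n => by nlinarith [hgrow n, hpos n]) ht (fun N => ⟨N, le_rfl, hgrow N, hC N⟩)

/-! ### Maps with a fixed end point -/

section FixedEnd

lemma IsPL.map_left_of_fixed (hf : f.IsPL a b) (h0 : f.map f.left = f.left) {x : ℝ}
    (hx : f.left ≤ x) (hc : x < f.crit) : f.map x = f.left + a * (x - f.left) := by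
  rw [hf.map_left x hx hc]
  rw [hf.map_left_end] at h0
  linarith

lemma IsPL.one_lt_of_fixed (hf : f.IsPL a b) (h0 : f.map f.left = f.left) : 1 < a := by
  rw [hf.map_left_end] at h0
  have h1 := hf.left_lt
  have h2 := hf.lt_right
  by_contra h
  push Not at h
  nlinarith

/-- Staying on the left forever is impossible: there the distance to the fixed end point is
multiplied by `a`, which exceeds 1. -/
lemma IsPL.frequently_right_of_fixed (hf : f.IsPL a b) (h0 : f.map f.left = f.left) {z w : ℝ}
    (h : f.IsHom z w) : ∃ n, f.crit < f.map^[n] z := by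
  by_contra hcon
  push Not at hcon
  have hs : ∀ n, f.map^[n] z < f.crit ∧ f.map^[n] w < f.crit := by
    intro n
    rcases (h.iterate hf n).sameSide with h1 | h1
    · exact h1
    · exact absurd h1.1 (hcon n).not_gt
  refine not_bounded_of_growing (q := fun n => f.map^[n] w - f.left) (t := a) (C := f.crit - f.left)
    (by simpa using lt_of_le_of_lt h.mem_left.1 h.lt) (hf.one_lt_of_fixed h0) (fun n => ?_)
    (fun n => by linarith [hs n])
  simp only [Function.iterate_succ_apply']
  rw [hf.map_left_of_fixed h0 (h.iterate hf n).mem_right.1 (hs n).2]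
  linarith

/-- The potential is (w - z)/(z - left). The left branch is linear about `left` and preserves it. On
the right branch z - left is replaced by b(z - crit), so the ratio gains the factor (z - left)/(z -
crit), which is at least (right - left)/(right - crit). The pair is on the right infinitely often,
and there the ratio is bounded. -/
theorem IsPL.noHom_of_fixed (hf : f.IsPL a b) (h0 : f.map f.left = f.left) : f.NoHom := by
  refine noHom_of_forall fun z w h => ?_
  have hlc := hf.left_lt
  have hcr := hf.lt_right
  obtain ⟨N, hN⟩ := hf.frequently_right_of_fixed h0 h
  -- Starting from a time on the right of the discontinuity keeps z strictly above `left` from then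
  -- on, so the quotient makes sense.
  have hM := h.iterate hf N
  set z' := f.map^[N] z
  set w' := f.map^[N] w
  have hleft : ∀ n, f.left < f.map^[n] z' := by
    intro n
    induction n with
    | zero => exact hlc.trans hN
    | succ n ih =>
      have h1 := hM.iterate hf n
      rw [Function.iterate_succ_apply']
      rcases h1.sameSide with h2 | h2
      · rw [hf.map_left_of_fixed h0 h1.mem_left.1 h2.1]
        nlinarith [hf.a_pos]
      · rw [hf.map_right _ h2.1 h1.mem_left.2]
        nlinarith [hf.b_pos]
  have key : ∀ n, f.crit < f.map^[n] z' → (f.right - f.left) / (f.right - f.crit) *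
      ((f.map^[n] w' - f.map^[n] z') / (f.map^[n] z' - f.left)) ≤
      (f.map^[n + 1] w' - f.map^[n + 1] z') / (f.map^[n + 1] z' - f.left) := by
    intro n hn
    have h1 := hM.iterate hf n
    rw [Function.iterate_succ_apply', Function.iterate_succ_apply',
      hf.map_right _ hn h1.mem_left.2, hf.map_right _ (hn.trans h1.lt) h1.mem_right.2]
    have h3 := h1.lt
    have h4 := h1.mem_left.2
    generalize f.map^[n] z' = u at *
    generalize f.map^[n] w' = v at *
    have hb := hf.b_pos
    have e : (f.left + b * (v - f.crit) - (f.left + b * (u - f.crit))) /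
        (f.left + b * (u - f.crit) - f.left) = (v - u) / (u - f.crit) := by
      have : u - f.crit ≠ 0 := by linarith
      rw [div_eq_div_iff (by rw [add_sub_cancel_left]; positivity) this]
      ring
    rw [e, div_mul_div_comm, div_le_div_iff₀ (by nlinarith) (by linarith)]
    have : 0 ≤ (v - u) * ((f.crit - f.left) * (f.right - u)) :=
      mul_nonneg (by linarith) (mul_nonneg (by linarith) (by linarith))
    nlinarith
  have ht : 1 < (f.right - f.left) / (f.right - f.crit) := by
    rw [lt_div_iff₀ (by linarith)]
    linarith
  have hpos : ∀ n, 0 < (f.map^[n] w' - f.map^[n] z') / (f.map^[n] z' - f.left) := fun n =>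
    div_pos (by linarith [(hM.iterate hf n).lt]) (by linarith [hleft n])
  refine not_bounded_of_frequently_growing
    (q := fun n => (f.map^[n] w' - f.map^[n] z') / (f.map^[n] z' - f.left))
    (t := (f.right - f.left) / (f.right - f.crit))
    (C := (f.right - f.left) / (f.crit - f.left)) (hpos 0) (fun n => ?_) ht (fun K => ?_)
  · rcases (hM.iterate hf n).sameSide with h2 | h2
    · simp only [Function.iterate_succ_apply']
      have h1 := hM.iterate hf n
      rw [hf.map_left_of_fixed h0 h1.mem_left.1 h2.1, hf.map_left_of_fixed h0 h1.mem_right.1 h2.2]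
      have h3 := hleft n
      generalize f.map^[n] z' = u at *
      generalize f.map^[n] w' = v at *
      have ha := hf.a_pos
      have : u - f.left ≠ 0 := by linarith
      rw [← sub_nonneg]
      apply le_of_eq
      field_simp
      ring
    · exact (le_mul_of_one_le_left (hpos n).le ht.le).trans (key n h2.1)
  · obtain ⟨m, hm⟩ := hf.frequently_right_of_fixed h0 (hM.iterate hf K)
    rw [← Function.iterate_add_apply] at hm
    refine ⟨m + K, by omega, key _ hm, ?_⟩
    have h1 := hM.iterate hf (m + K)
    rw [div_le_div_iff₀ (by linarith) (by linarith)]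
    have h2 := h1.lt
    have h3 := h1.mem_right.2
    nlinarith

/-- The periodic orbit makes one step on the right followed by k steps on the left. In terms of the
distance t to `left` the return is t ↦ aᵏb(t - (crit - left)). -/
theorem IsPL.hasInnerPeriodic_of_fixed (hf : f.IsPL a b) (h0 : f.map f.left = f.left) :
    f.HasInnerPeriodic := by
  have hlc := hf.left_lt
  have hcr := hf.lt_right
  have ha1 := hf.one_lt_of_fixed h0
  have hb := hf.b_pos
  have hM : f.right - f.left = a * (f.crit - f.left) := by
    rw [hf.map_left_end] at h0
    linarith
  -- With s = aᵏb, the bound s > a/(a - 1) = 1 + 1/(a - 1) is what places the fixed point t = (crit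
  -- - left)s/(s - 1) below right - left = a(crit - left).
  obtain ⟨k, hk⟩ := pow_unbounded_of_one_lt ((1 + 1 / (a - 1)) / b) ha1
  rw [div_lt_iff₀ hb] at hk
  have hq : 0 < 1 / (a - 1) := by
    have : 0 < a - 1 := by linarith
    positivity
  set s := a ^ k * b with hs
  have hs1 : 1 < s := by linarith
  set t := (f.crit - f.left) * (s / (s - 1)) with ht
  have hsm : 0 < s - 1 := by linarith
  have hst : t = s * (t - (f.crit - f.left)) := by
    rw [ht]
    field_simp
    ring
  have ht1 : f.crit - f.left < t := by
    have : 1 < s / (s - 1) := by rw [lt_div_iff₀ hsm]; linarith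
    rw [ht]
    nlinarith
  have ht2 : t < f.right - f.left := by
    have : s / (s - 1) < a := by
      rw [div_lt_iff₀ hsm]
      have h3 : 1 / (a - 1) < s - 1 := by linarith
      rw [div_lt_iff₀ (by linarith)] at h3
      linarith
    rw [hM, ht, mul_comm a]
    exact mul_lt_mul_of_pos_left this (by linarith)
  have h1 : f.map (f.left + t) = f.left + b * (t - (f.crit - f.left)) := by
    rw [hf.map_right _ (by linarith) (by linarith)]
    ring
  have hd : 0 < t - (f.crit - f.left) := by linarith
  have hlt : ∀ i < k, a ^ i * (b * (t - (f.crit - f.left))) < f.crit - f.left := by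
    intro i hi
    have h2 : a ^ (i + 1) ≤ a ^ k := pow_le_pow_right₀ ha1.le (by omega)
    have h3 : a * (a ^ i * (b * (t - (f.crit - f.left)))) ≤ t := by
      conv_rhs => rw [hst, hs]
      calc a * (a ^ i * (b * (t - (f.crit - f.left))))
          = a ^ (i + 1) * (b * (t - (f.crit - f.left))) := by rw [pow_succ]; ring
        _ ≤ a ^ k * (b * (t - (f.crit - f.left))) :=
            mul_le_mul_of_nonneg_right h2 (by positivity)
        _ = a ^ k * b * (t - (f.crit - f.left)) := by ring
    have h4 : a * (a ^ i * (b * (t - (f.crit - f.left)))) < a * (f.crit - f.left) := by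
      linarith
    exact lt_of_mul_lt_mul_left h4 (by linarith)
  have hit : ∀ i ≤ k, f.map^[i + 1] (f.left + t) =
      f.left + a ^ i * (b * (t - (f.crit - f.left))) := by
    intro i
    induction i with
    | zero => intro _; simpa using h1
    | succ i ih =>
      intro hi
      rw [Function.iterate_succ_apply', ih (by omega), hf.map_left_of_fixed h0
        (by have : 0 < a ^ i := by positivity
            have : 0 < a ^ i * (b * (t - (f.crit - f.left))) := by positivity
            linarith) (by linarith [hlt i (by omega)])]
      rw [pow_succ]
      ring
  have hper : f.map^[k + 1] (f.left + t) = f.left + t := by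
    rw [hit k le_rfl]
    have := hst
    rw [hs] at this
    linarith
  refine ⟨f.left + t, ⟨by linarith, by linarith⟩, k + 1, by omega, hper, fun i => ?_⟩
  have hP : Function.IsPeriodicPt f.map (k + 1) (f.left + t) := hper
  rw [← hP.iterate_mod_apply]
  have hm : i % (k + 1) < k + 1 := Nat.mod_lt _ (by omega)
  rcases hj : i % (k + 1) with _ | j
  · simp only [Function.iterate_zero, id]
    linarith
  · rw [hit j (by omega)]
    have := hlt j (by omega)
    linarith

end FixedEnd

/-! ### Maps with a periodic orbit of period two -/

section PeriodTwo

/-- `p < crit < q` is an orbit of period two. -/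
structure IsTwoCycle (f : LorenzData) (a b p q : ℝ) : Prop where
  left_lt : f.left < p
  lt_crit : p < f.crit
  crit_lt : f.crit < q
  lt_right : q < f.right
  one_lt : 1 < a * b
  map_left : ∀ x, f.left ≤ x → x < f.crit → f.map x = q + a * (x - p)
  map_right : ∀ x, f.crit < x → x ≤ f.right → f.map x = p + b * (x - q)

/-- The hypotheses read a(crit - left) > right - crit and b(right - crit) > crit - left; multiplying
them gives ab > 1. Then p is the repelling fixed point of right branch after left branch. -/
lemma IsPL.exists_twoCycle (hf : f.IsPL a b) (h0 : f.map f.left < f.crit)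
    (h1 : f.crit < f.map f.right) : ∃ p q, f.IsTwoCycle a b p q := by
  have hlc := hf.left_lt
  have hcr := hf.lt_right
  have ha := hf.a_pos
  have hb := hf.b_pos
  rw [hf.map_left_end] at h0
  rw [hf.map_right_end] at h1
  have hab : 1 < a * b := by
    by_contra hcon
    push Not at hcon
    have h2 : (f.right - f.crit) * (f.crit - f.left) <
        (a * (f.crit - f.left)) * (b * (f.right - f.crit)) :=
      mul_lt_mul'' (by linarith) (by linarith) (by linarith) (by linarith)
    have h3 : 0 < (f.right - f.crit) * (f.crit - f.left) :=
      mul_pos (by linarith) (by linarith)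
    nlinarith
  have hne : a * b - 1 ≠ 0 := by linarith
  have hm : 0 < a * b - 1 := by linarith
  obtain ⟨p, hp⟩ : ∃ p, p * (a * b - 1) = a * b * f.crit - b * (f.right - f.crit) - f.left :=
    ⟨(a * b * f.crit - b * (f.right - f.crit) - f.left) / (a * b - 1), div_mul_cancel₀ _ hne⟩
  have hpc : p < f.crit := by
    by_contra hcon
    push Not at hcon
    nlinarith
  have hlp : f.left < p := by
    have : 0 < (p - f.left) * (a * b - 1) := by
      have : (p - f.left) * (a * b - 1) = b * (a * (f.crit - f.left) - (f.right - f.crit)) := by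
        linarith
      rw [this]
      exact mul_pos hb (by linarith)
    have := (pos_iff_pos_of_mul_pos this).2 hm
    linarith
  have hq : b * (f.right - a * (f.crit - p) - f.crit) = p - f.left := by linarith
  refine ⟨p, f.right - a * (f.crit - p), hlp, hpc, ?_, ?_, hab, fun x hx hx' => ?_,
    fun x hx hx' => ?_⟩
  · have : 0 < b * (f.right - a * (f.crit - p) - f.crit) := by linarith
    have := (pos_iff_pos_of_mul_pos this).1 hb
    linarith
  · have := mul_pos ha (sub_pos.2 hpc)
    linarith
  · rw [hf.map_left x hx hx']
    ring
  · rw [hf.map_right x hx hx']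
    linarith

variable {p q : ℝ}

lemma IsTwoCycle.map_p (h : f.IsTwoCycle a b p q) : f.map p = q := by
  rw [h.map_left p h.left_lt.le h.lt_crit]
  ring

lemma IsTwoCycle.map_q (h : f.IsTwoCycle a b p q) : f.map q = p := by
  rw [h.map_right q h.crit_lt h.lt_right.le]
  ring

lemma IsTwoCycle.hasInnerPeriodic (h : f.IsTwoCycle a b p q) : f.HasInnerPeriodic := by
  refine ⟨p, ⟨h.left_lt, by linarith [h.lt_crit, h.crit_lt, h.lt_right]⟩, 2, by omega, ?_, ?_⟩
  · simp [Function.iterate_succ, h.map_p, h.map_q]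
  · intro i
    have : f.map^[i] p = p ∨ f.map^[i] p = q := by
      induction i with
      | zero => exact Or.inl rfl
      | succ i ih =>
        rw [Function.iterate_succ_apply']
        rcases ih with ih | ih <;> rw [ih]
        · exact Or.inr h.map_p
        · exact Or.inl h.map_q
    rcases this with e | e <;> rw [e]
    · exact h.lt_crit.ne
    · exact h.crit_lt.ne'

/-- A pair around p stays around p under f², and its length is multiplied by ab > 1 each time. -/
lemma IsTwoCycle.not_straddle_p (hf : f.IsPL a b) (h : f.IsTwoCycle a b p q) {z w : ℝ}
    (hh : f.IsHom z w) : ¬ (z ≤ p ∧ p ≤ w) := by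
  intro hzw
  have ha := hf.a_pos
  have hb := hf.b_pos
  have step : ∀ u v, f.IsHom u v → u ≤ p → p ≤ v → f.map (f.map u) ≤ p ∧ p ≤ f.map (f.map v) ∧
      f.map (f.map v) - f.map (f.map u) = a * b * (v - u) := by
    intro u v huv hu hv
    have h1 := h.lt_crit
    have huc : u < f.crit := hu.trans_lt h1
    have hvc : v < f.crit := by
      rcases huv.sameSide with h2 | h2
      · exact h2.2
      · exact absurd (h2.1.trans huc) (lt_irrefl _)
    have hM := huv.map hf
    have e1 := h.map_left u huv.mem_left.1 huc
    have e2 := h.map_left v huv.mem_right.1 hvc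
    have h3 : f.crit < f.map v := by
      rw [e2]
      have := h.crit_lt
      nlinarith
    have h4 : f.crit < f.map u := by
      rcases hM.sameSide with h2 | h2
      · exact absurd (h2.2.trans h3) (lt_irrefl _)
      · exact h2.1
    rw [h.map_right _ h4 hM.mem_left.2, h.map_right _ h3 hM.mem_right.2, e1, e2]
    refine ⟨?_, ?_, ?_⟩
    · have : b * (q + a * (u - p) - q) ≤ 0 := by
        have := mul_nonneg hb.le (mul_nonneg ha.le (sub_nonneg.2 hu))
        linarith
      linarith
    · have : 0 ≤ b * (q + a * (v - p) - q) := by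
        have := mul_nonneg hb.le (mul_nonneg ha.le (sub_nonneg.2 hv))
        linarith
      linarith
    · ring
  have key : ∀ n, f.map^[2 * n] z ≤ p ∧ p ≤ f.map^[2 * n] w := by
    intro n
    induction n with
    | zero => exact hzw
    | succ n ih =>
      have := step _ _ (hh.iterate hf (2 * n)) ih.1 ih.2
      rw [show 2 * (n + 1) = 2 * n + 1 + 1 by ring]
      simp only [Function.iterate_succ_apply']
      exact ⟨this.1, this.2.1⟩
  refine not_bounded_of_growing (q := fun n => f.map^[2 * n] w - f.map^[2 * n] z) (t := a * b)
    (C := f.right - f.left) (by simpa using hh.lt) h.one_lt (fun n => ?_) (fun n => ?_)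
  · have := step _ _ (hh.iterate hf (2 * n)) (key n).1 (key n).2
    rw [show 2 * (n + 1) = 2 * n + 1 + 1 by ring]
    simp only [Function.iterate_succ_apply']
    exact this.2.2.ge
  · have := hh.iterate hf (2 * n)
    linarith [this.mem_left.1, this.mem_right.2]

lemma IsTwoCycle.not_straddle_q (hf : f.IsPL a b) (h : f.IsTwoCycle a b p q) {z w : ℝ}
    (hh : f.IsHom z w) : ¬ (z ≤ q ∧ q ≤ w) := by
  rintro ⟨h1, h2⟩
  have hw := h.crit_lt.trans_le h2
  have hz : f.crit < z := by
    rcases hh.sameSide with h3 | h3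
    · exact absurd (h3.2.trans hw) (lt_irrefl _)
    · exact h3.1
  refine h.not_straddle_p hf (hh.map hf) ?_
  rw [h.map_right _ hz hh.mem_left.2, h.map_right _ hw hh.mem_right.2]
  have hb := hf.b_pos
  constructor <;> nlinarith

/-- The four zones cut out by the discontinuity and an orbit of period two. -/
lemma IsTwoCycle.zones (hf : f.IsPL a b) (h : f.IsTwoCycle a b p q) {z w : ℝ}
    (hh : f.IsHom z w) :
    w < p ∨ (p < z ∧ w < f.crit) ∨ (f.crit < z ∧ w < q) ∨ q < z := by
  have h1 := h.not_straddle_p hf hh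
  have h2 := h.not_straddle_q hf hh
  rcases hh.sameSide with h3 | h3
  · by_cases hz : p < z
    · exact Or.inr (Or.inl ⟨hz, h3.2⟩)
    · exact Or.inl (by by_contra hcon; exact h1 ⟨by linarith, by linarith⟩)
  · by_cases hz : q < z
    · exact Or.inr (Or.inr (Or.inr hz))
    · exact Or.inr (Or.inr (Or.inl ⟨h3.1,
        by by_contra hcon; exact h2 ⟨by linarith, by linarith⟩⟩))

/-- Weighted length of `[z, w]` relative to the distance from the orbit `p, q`. -/
noncomputable def potential (f : LorenzData) (p q z w : ℝ) : ℝ :=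
  if w < p then (q - f.crit) * ((w - z) / (p - w))
  else if w < f.crit then (f.crit - p) * ((w - z) / (z - p))
  else if w < q then (q - f.crit) * ((w - z) / (q - w))
  else (f.crit - p) * ((w - z) / (z - q))

/-- Gain when the reference point changes from one point of the cycle to the other, Q being their
distance; the factor e/(e - Q) is smallest at the largest e. -/
lemma div_sub_growth {x e Q E : ℝ} (hx : 0 ≤ x) (hQ : 0 < Q) (he : Q < e) (hE : e ≤ E) :
    E / (E - Q) * (x / e) ≤ x / (e - Q) := by
  rw [div_mul_div_comm, div_le_div_iff₀ (mul_pos (by linarith) (by linarith)) (by linarith)]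
  have : 0 ≤ x * (Q * (E - e)) := mul_nonneg hx (mul_nonneg hQ.le (by linarith))
  nlinarith

/-- Case of an image landing across the discontinuity: `x` separates the two sides, since s ≤ e
while the new distance is less than t. This is what the weights in `potential` are for. -/
lemma crossing_growth {x e Q s t : ℝ} (hx : 0 ≤ x) (hs : 0 < s) (hQ : s + t = Q)
    (h1 : s ≤ e) (h2 : e + x < Q) : s * (x / e) ≤ t * (x / (Q - (e + x))) := by
  have h3 : s * (x / e) ≤ x := by
    rw [mul_div_assoc', div_le_iff₀ (by linarith)]
    nlinarith
  have h4 : x ≤ t * (x / (Q - (e + x))) := by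
    rw [mul_div_assoc', le_div_iff₀ (by linarith)]
    nlinarith
  exact h3.trans h4

lemma mul_div_mul_cancel_left_pos {s x y : ℝ} (hs : 0 < s) : (s * x) / (s * y) = x / y :=
  mul_div_mul_left _ _ hs.ne'

/-- Each branch is linear about its point of the cycle, so the quotient is preserved if the distance
of the image is measured from the image of that point. The inner zones, and outer zones mapped just
inside, give equality; otherwise the reference point changes, which can only increase the potential,
and by a definite factor if the pair remains in the same outer zone. -/
lemma IsTwoCycle.potential_mono (hf : f.IsPL a b) (h : f.IsTwoCycle a b p q) {z w : ℝ}
    (hh : f.IsHom z w) :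
    f.potential p q z w ≤ f.potential p q (f.map z) (f.map w) ∧
    (w < p → f.map w < p → (q - f.left) / (q - f.left - (q - p)) * f.potential p q z w ≤
      f.potential p q (f.map z) (f.map w)) ∧
    (q < z → q < f.map z → (f.right - p) / (f.right - p - (q - p)) * f.potential p q z w ≤
      f.potential p q (f.map z) (f.map w)) := by
  have ha := hf.a_pos
  have hb := hf.b_pos
  have hpc := h.lt_crit
  have hcq := h.crit_lt
  have hM := hh.map hf
  have hzw := hh.lt
  have hl := h.left_lt
  have hr := h.lt_right
  have hzl := hM.mem_left.1
  have hwr := hM.mem_right.2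
  rcases h.zones hf hh with hz | hz | hz | hz
  · have e1 := h.map_left z hh.mem_left.1 (by linarith)
    have e2 := h.map_left w hh.mem_right.1 (by linarith)
    have ew : f.potential p q z w = (q - f.crit) * ((a * (w - z)) / (a * (p - w))) := by
      rw [potential, if_pos hz, mul_div_mul_cancel_left_pos ha]
    have hx : 0 ≤ a * (w - z) := mul_nonneg ha.le (by linarith)
    have hd : f.map w - f.map z = a * (w - z) := by rw [e1, e2]; ring
    have hd2 : q - f.map w = a * (p - w) := by rw [e2]; ring
    rw [ew, ← hd, ← hd2]
    rw [← hd] at hx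
    have hd3 : 0 < q - f.map w := by rw [hd2]; exact mul_pos ha (by linarith)
    rcases h.zones hf hM with hy | hy | hy | hy
    · have e : f.potential p q (f.map z) (f.map w) =
          (q - f.crit) * ((f.map w - f.map z) / (q - f.map w - (q - p))) := by
        rw [potential, if_pos hy]
        congr 2
        ring
      have key := div_sub_growth (x := f.map w - f.map z) (e := q - f.map w) (Q := q - p)
        (E := q - f.left) hx (by linarith) (by linarith) (by linarith)
      have key2 : (q - f.left) / (q - f.left - (q - p)) *
          ((q - f.crit) * ((f.map w - f.map z) / (q - f.map w))) ≤
          (q - f.crit) * ((f.map w - f.map z) / (q - f.map w - (q - p))) := by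
        have := mul_le_mul_of_nonneg_left key (by linarith : 0 ≤ q - f.crit)
        linarith
      rw [e]
      refine ⟨?_, fun _ _ => key2, fun h5 => absurd h5 (by linarith)⟩
      apply mul_le_mul_of_nonneg_left _ (by linarith)
      exact div_le_div_of_nonneg_left hx (by linarith) (by linarith)
    · refine ⟨?_, fun _ h5 => absurd h5 (by linarith), fun h5 => absurd h5 (by linarith)⟩
      rw [potential, if_neg (by linarith), if_pos hy.2]
      have := crossing_growth (x := f.map w - f.map z) (e := q - f.map w) (Q := q - p)
        (s := q - f.crit) (t := f.crit - p) hx (by linarith) (by ring)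
        (by linarith) (by linarith)
      convert this using 3
      ring
    · refine ⟨?_, fun _ h5 => absurd h5 (by linarith), fun h5 => absurd h5 (by linarith)⟩
      rw [potential, if_neg (by linarith), if_neg (by linarith), if_pos hy.2]
    · exact absurd hM.lt (by linarith)
  · have e1 := h.map_left z hh.mem_left.1 (by linarith)
    have e2 := h.map_left w hh.mem_right.1 (by linarith)
    have h6 : q < f.map z := by rw [e1]; nlinarith
    refine ⟨le_of_eq ?_, fun h5 => absurd h5 (by linarith), fun h5 => absurd h5 (by linarith)⟩
    rw [potential, if_neg (by linarith), if_pos hz.2, potential, if_neg (by linarith [hM.lt]),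
      if_neg (by linarith [hM.lt]), if_neg (by linarith [hM.lt]), e1, e2,
      ← mul_div_mul_cancel_left_pos (x := w - z) ha]
    congr 2 <;> ring
  · have e1 := h.map_right z (by linarith) hh.mem_left.2
    have e2 := h.map_right w (by linarith) hh.mem_right.2
    have h6 : f.map w < p := by rw [e2]; nlinarith
    refine ⟨le_of_eq ?_, fun h5 => absurd h5 (by linarith), fun h5 => absurd h5 (by linarith)⟩
    rw [potential, if_neg (by linarith), if_neg (by linarith), if_pos hz.2, potential,
      if_pos h6, e1, e2, ← mul_div_mul_cancel_left_pos (x := w - z) hb]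
    congr 2 <;> ring
  · have e1 := h.map_right z (by linarith) hh.mem_left.2
    have e2 := h.map_right w (by linarith) hh.mem_right.2
    have ew : f.potential p q z w = (f.crit - p) * ((b * (w - z)) / (b * (z - q))) := by
      rw [potential, if_neg (by linarith), if_neg (by linarith), if_neg (by linarith),
        mul_div_mul_cancel_left_pos hb]
    have hx : 0 ≤ b * (w - z) := mul_nonneg hb.le (by linarith)
    have hd : f.map w - f.map z = b * (w - z) := by rw [e1, e2]; ring
    have hd2 : f.map z - p = b * (z - q) := by rw [e1]; ring
    rw [ew, ← hd, ← hd2]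
    rw [← hd] at hx
    have hd3 : 0 < f.map z - p := by rw [hd2]; exact mul_pos hb (by linarith)
    rcases h.zones hf hM with hy | hy | hy | hy
    · exact absurd hM.lt (by linarith)
    · refine ⟨?_, fun h5 => absurd h5 (by linarith), fun _ h5 => absurd h5 (by linarith)⟩
      rw [potential, if_neg (by linarith), if_pos hy.2]
    · refine ⟨?_, fun h5 => absurd h5 (by linarith), fun _ h5 => absurd h5 (by linarith)⟩
      rw [potential, if_neg (by linarith), if_neg (by linarith), if_pos hy.2]
      have := crossing_growth (x := f.map w - f.map z) (e := f.map z - p) (Q := q - p)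
        (s := f.crit - p) (t := q - f.crit) hx (by linarith) (by ring)
        (by linarith) (by linarith)
      convert this using 3
      ring
    · have e : f.potential p q (f.map z) (f.map w) =
          (f.crit - p) * ((f.map w - f.map z) / (f.map z - p - (q - p))) := by
        rw [potential, if_neg (by linarith [hM.lt]), if_neg (by linarith [hM.lt]),
          if_neg (by linarith [hM.lt])]
        congr 2
        ring
      have key := div_sub_growth (x := f.map w - f.map z) (e := f.map z - p) (Q := q - p)
        (E := f.right - p) hx (by linarith) (by linarith) (by linarith [hM.lt])
      have key2 : (f.right - p) / (f.right - p - (q - p)) *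
          ((f.crit - p) * ((f.map w - f.map z) / (f.map z - p))) ≤
          (f.crit - p) * ((f.map w - f.map z) / (f.map z - p - (q - p))) := by
        have := mul_le_mul_of_nonneg_left key (by linarith : 0 ≤ f.crit - p)
        linarith
      rw [e]
      refine ⟨?_, fun h5 => absurd h5 (by linarith), fun _ _ => key2⟩
      apply mul_le_mul_of_nonneg_left _ (by linarith)
      exact div_le_div_of_nonneg_left hx (by linarith) (by linarith)

lemma IsTwoCycle.potential_pos (hf : f.IsPL a b) (h : f.IsTwoCycle a b p q) {z w : ℝ}
    (hh : f.IsHom z w) : 0 < f.potential p q z w := by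
  have hpc := h.lt_crit
  have hcq := h.crit_lt
  have hzw := hh.lt
  rcases h.zones hf hh with hz | hz | hz | hz
  · rw [potential, if_pos hz]
    exact mul_pos (by linarith) (div_pos (by linarith) (by linarith))
  · rw [potential, if_neg (by linarith), if_pos hz.2]
    exact mul_pos (by linarith) (div_pos (by linarith) (by linarith))
  · rw [potential, if_neg (by linarith), if_neg (by linarith), if_pos hz.2]
    exact mul_pos (by linarith) (div_pos (by linarith) (by linarith))
  · rw [potential, if_neg (by linarith), if_neg (by linarith), if_neg (by linarith)]
    exact mul_pos (by linarith) (div_pos (by linarith) (by linarith))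

/-- The pair stays in one of the two outer zones. -/
def StaysOut (f : LorenzData) (p q z w : ℝ) : Prop :=
  (w < p ∧ f.map w < p) ∨ (q < z ∧ q < f.map z)

lemma IsTwoCycle.potential_le (hf : f.IsPL a b) (h : f.IsTwoCycle a b p q) {z w : ℝ}
    (hh : f.IsHom z w) (hs : f.StaysOut p q z w) :
    f.potential p q z w ≤ (q - p) * ((f.right - f.left) / ((q - p) / (a + b))) := by
  have ha := hf.a_pos
  have hb := hf.b_pos
  have hpc := h.lt_crit
  have hcq := h.crit_lt
  have hzw := hh.lt
  have h1 := hh.mem_left.1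
  have h2 := hh.mem_right.2
  have hpos : 0 < (q - p) / (a + b) := div_pos (by linarith) (by linarith)
  rcases hs with ⟨hs, hs'⟩ | ⟨hs, hs'⟩
  · rw [h.map_left w hh.mem_right.1 (by linarith)] at hs'
    -- The image of w is still below p although p goes to q, so a(p - w) > q - p; using a + b treats
    -- both sides uniformly.
    have h3 : (q - p) / (a + b) ≤ p - w := by
      rw [div_le_iff₀ (by linarith)]
      nlinarith
    rw [potential, if_pos hs]
    apply mul_le_mul (by linarith) _ (div_nonneg (by linarith) (by linarith)) (by linarith)
    exact div_le_div₀ (by linarith) (by linarith) hpos h3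
  · rw [h.map_right z (by linarith) hh.mem_left.2] at hs'
    have h3 : (q - p) / (a + b) ≤ z - q := by
      rw [div_le_iff₀ (by linarith)]
      nlinarith
    rw [potential, if_neg (by linarith), if_neg (by linarith), if_neg (by linarith)]
    apply mul_le_mul (by linarith) _ (div_nonneg (by linarith) (by linarith)) (by linarith)
    exact div_le_div₀ (by linarith) (by linarith) hpos h3

/-- Otherwise the pair is within (p, q) after at most one step and is back there every second step,
while each such double step multiplies its length by ab > 1. -/
lemma IsTwoCycle.exists_staysOut (hf : f.IsPL a b) (h : f.IsTwoCycle a b p q) {z w : ℝ}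
    (hh : f.IsHom z w) : ∃ n, f.StaysOut p q (f.map^[n] z) (f.map^[n] w) := by
  by_contra hcon
  push Not at hcon
  have ha := hf.a_pos
  have hb := hf.b_pos
  have hpc := h.lt_crit
  have hcq := h.crit_lt
  have inner : ∀ n, (p < f.map^[n] z ∧ f.map^[n] w < q) →
      (p < f.map^[n + 2] z ∧ f.map^[n + 2] w < q) ∧
      f.map^[n + 2] w - f.map^[n + 2] z = a * b * (f.map^[n] w - f.map^[n] z) := by
    intro n hn
    have h0 := hh.iterate hf n
    have h1 := hh.iterate hf (n + 1)
    have h2 := hh.iterate hf (n + 2)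
    have hout := hcon (n + 1)
    rw [show n + 2 = n + 1 + 1 by ring] at *
    simp only [StaysOut] at hout
    rw [← Function.iterate_succ_apply' f.map (n + 1), ← Function.iterate_succ_apply' f.map (n + 1)]
      at hout
    push Not at hout
    rcases h.zones hf h0 with hz | hz | hz | hz
    · exact absurd h0.lt (by linarith)
    · have e1 := h.map_left _ h0.mem_left.1 (by linarith [h0.lt])
      have e2 := h.map_left _ h0.mem_right.1 hz.2
      rw [← Function.iterate_succ_apply' f.map] at e1 e2
      have h3 : q < f.map^[n + 1] z := by rw [e1]; nlinarith
      have e3 := h.map_right _ (by linarith) h1.mem_left.2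
      have e4 := h.map_right _ (by linarith [h1.lt]) h1.mem_right.2
      rw [← Function.iterate_succ_apply' f.map] at e3 e4
      refine ⟨⟨by rw [e3]; nlinarith, ?_⟩, by rw [e3, e4, e1, e2]; ring⟩
      have := hout.2 h3
      rcases h.zones hf h2 with hy | hy | hy | hy
      · linarith
      · linarith
      · linarith
      · linarith
    · have e1 := h.map_right _ (by linarith) h0.mem_left.2
      have e2 := h.map_right _ (by linarith [h0.lt]) h0.mem_right.2
      rw [← Function.iterate_succ_apply' f.map] at e1 e2
      have h3 : f.map^[n + 1] w < p := by rw [e2]; nlinarith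
      have e3 := h.map_left _ h1.mem_left.1 (by linarith [h1.lt])
      have e4 := h.map_left _ h1.mem_right.1 (by linarith)
      rw [← Function.iterate_succ_apply' f.map] at e3 e4
      refine ⟨⟨?_, by rw [e4]; nlinarith⟩, by rw [e3, e4, e1, e2]; ring⟩
      have := hout.1 h3
      rcases h.zones hf h2 with hy | hy | hy | hy
      · linarith
      · linarith
      · linarith
      · linarith
    · exact absurd h0.lt (by linarith)
  have start : ∃ N, p < f.map^[N] z ∧ f.map^[N] w < q := by
    have h0 := hcon 0
    simp only [StaysOut, Function.iterate_zero, id] at h0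
    push Not at h0
    have hM := hh.map hf
    rcases h.zones hf hh with hz | hz | hz | hz
    · refine ⟨1, ?_⟩
      have e2 := h.map_left _ hh.mem_right.1 (by linarith)
      have h5 : f.map w < q := by rw [e2]; nlinarith
      have := h0.1 hz
      simp only [Function.iterate_one]
      rcases h.zones hf hM with hy | hy | hy | hy
      · linarith
      · exact ⟨hy.1, h5⟩
      · exact ⟨by linarith, h5⟩
      · exact ⟨by linarith, h5⟩
    · exact ⟨0, hz.1, by simp only [Function.iterate_zero, id]; linarith⟩
    · exact ⟨0, by simp only [Function.iterate_zero, id]; linarith, hz.2⟩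
    · refine ⟨1, ?_⟩
      have e2 := h.map_right _ (by linarith) hh.mem_left.2
      have h5 : p < f.map z := by rw [e2]; nlinarith
      have := h0.2 hz
      simp only [Function.iterate_one]
      rcases h.zones hf hM with hy | hy | hy | hy
      · exact ⟨h5, by linarith⟩
      · exact ⟨h5, by linarith⟩
      · exact ⟨h5, by linarith⟩
      · linarith
  obtain ⟨N, hN⟩ := start
  have key : ∀ n, p < f.map^[N + 2 * n] z ∧ f.map^[N + 2 * n] w < q := by
    intro n
    induction n with
    | zero => exact hN
    | succ n ih => exact (inner _ ih).1
  refine not_bounded_of_growing (q := fun n => f.map^[N + 2 * n] w - f.map^[N + 2 * n] z)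
    (t := a * b) (C := f.right - f.left) (sub_pos.2 (hh.iterate hf _).lt) h.one_lt
    (fun n => (inner _ (key n)).2.ge) (fun n => ?_)
  have := hh.iterate hf (N + 2 * n)
  linarith [this.mem_left.1, this.mem_right.2]

theorem IsTwoCycle.noHom (hf : f.IsPL a b) (h : f.IsTwoCycle a b p q) : f.NoHom := by
  refine noHom_of_forall fun z w hh => ?_
  have hpc := h.lt_crit
  have hcq := h.crit_lt
  have hl := h.left_lt
  have hr := h.lt_right
  set t1 := (q - f.left) / (q - f.left - (q - p)) with ht1
  set t2 := (f.right - p) / (f.right - p - (q - p)) with ht2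
  have h1 : 1 < t1 := by rw [ht1, lt_div_iff₀ (by linarith)]; linarith
  have h2 : 1 < t2 := by rw [ht2, lt_div_iff₀ (by linarith)]; linarith
  refine not_bounded_of_frequently_growing
    (q := fun n => f.potential p q (f.map^[n] z) (f.map^[n] w)) (t := min t1 t2)
    (C := (q - p) * ((f.right - f.left) / ((q - p) / (a + b)))) (h.potential_pos hf hh)
    (fun n => ?_) (lt_min h1 h2) (fun N => ?_)
  · simp only [Function.iterate_succ_apply']
    exact (h.potential_mono hf (hh.iterate hf n)).1
  · obtain ⟨m, hm⟩ := h.exists_staysOut hf (hh.iterate hf N)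
    rw [← Function.iterate_add_apply, ← Function.iterate_add_apply] at hm
    have hk := hh.iterate hf (m + N)
    refine ⟨m + N, by omega, ?_, h.potential_le hf hk hm⟩
    simp only [Function.iterate_succ_apply']
    have hp := (h.potential_pos hf hk).le
    obtain ⟨-, g1, g2⟩ := h.potential_mono hf hk
    rcases hm with hm | hm
    · exact (mul_le_mul_of_nonneg_right (min_le_left _ _) hp).trans (g1 hm.1 hm.2)
    · exact (mul_le_mul_of_nonneg_right (min_le_right _ _) hp).trans (g2 hm.1 hm.2)

end PeriodTwo

end LorenzData

namespace LorenzData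

variable {f : LorenzData} {a b : ℝ}

/-! ### Inducing on a smaller interval -/

/-- The first return map to `[crit, right]` of a piecewise linear map with `crit ≤ f(left)`. -/
noncomputable def cut (f : LorenzData) (a b : ℝ) : LorenzData where
  left := f.crit
  right := f.right
  crit := f.crit + (f.crit - f.left) / b
  map := fun x => if x < f.crit + (f.crit - f.left) / b then
    f.right - a * b * (f.crit + (f.crit - f.left) / b - x) else f.map x

lemma IsPL.map_cut_crit_sub (hf : f.IsPL a b) :
    b * ((f.cut a b).crit - f.crit) = f.crit - f.left := by
  simp only [cut, add_sub_cancel_left]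
  exact mul_div_cancel₀ _ hf.b_pos.ne'

lemma IsPL.crit_lt_cut_crit (hf : f.IsPL a b) : f.crit < (f.cut a b).crit := by
  have : 0 < (f.crit - f.left) / b := div_pos (sub_pos.2 hf.left_lt) hf.b_pos
  simp only [cut]
  linarith

/-- This is where the overlap enters: f(right) > f(left) ≥ crit, so the discontinuity has a preimage
on the right branch. -/
lemma IsPL.cut_crit_lt (hf : f.IsPL a b) (h : f.crit ≤ f.map f.left) :
    (f.cut a b).crit < f.right := by
  have h1 := hf.map_cut_crit_sub
  have h2 := hf.map_right_end
  have h3 := hf.overlap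
  have : 0 < b * (f.right - (f.cut a b).crit) := by
    have : b * (f.right - (f.cut a b).crit) =
      b * (f.right - f.crit) - b * ((f.cut a b).crit - f.crit) := by ring
    linarith
  have := (pos_iff_pos_of_mul_pos this).1 hf.b_pos
  linarith

lemma IsPL.cut_map_left (hf : f.IsPL a b) {x : ℝ} (hx : x < (f.cut a b).crit) :
    (f.cut a b).map x = f.right - a * (f.crit - (f.left + b * (x - f.crit))) := by
  have h1 := hf.map_cut_crit_sub
  have e : (f.cut a b).map x = f.right - a * b * ((f.cut a b).crit - x) := by
    simp only [cut] at hx ⊢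
    rw [if_pos hx]
  rw [e]
  linear_combination (-a) * h1

lemma cut_map_right {x : ℝ} (hx : (f.cut a b).crit < x) : (f.cut a b).map x = f.map x := by
  simp only [cut] at hx ⊢
  rw [if_neg hx.le.not_gt]

lemma IsPL.cut_map_left_end (hf : f.IsPL a b) : (f.cut a b).map (f.cut a b).left =
    f.map f.left := by
  have e : (f.cut a b).left = f.crit := rfl
  rw [e, hf.cut_map_left hf.crit_lt_cut_crit, hf.map_left_end]
  ring

lemma IsPL.cut_map_right_end (hf : f.IsPL a b) (h : f.crit ≤ f.map f.left) :
    (f.cut a b).map (f.cut a b).right = f.map f.right :=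
  cut_map_right (hf.cut_crit_lt h)

/-- The images of the end points are unchanged, so the overlap is the same number for the return
map. -/
lemma IsPL.cut (hf : f.IsPL a b) (h : f.crit ≤ f.map f.left) :
    (f.cut a b).IsPL (a * b) b where
  left_lt := hf.crit_lt_cut_crit
  lt_right := hf.cut_crit_lt h
  a_pos := mul_pos hf.a_pos hf.b_pos
  b_pos := hf.b_pos
  map_left x _ h2 := by
    have h1 := hf.map_cut_crit_sub
    rw [hf.cut_map_left h2]
    have : (f.cut a b).right = f.right := rfl
    rw [this]
    linear_combination a * h1
  map_right x h1 h2 := by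
    have h3 := hf.map_cut_crit_sub
    rw [cut_map_right h1, hf.map_right x (hf.crit_lt_cut_crit.trans h1) h2]
    have : (f.cut a b).left = f.crit := rfl
    rw [this]
    linear_combination h3
  left_le := by
    rw [hf.cut_map_left_end]
    exact h
  le_right := by
    rw [hf.cut_map_right_end h]
    exact hf.le_right
  overlap := by
    rw [hf.cut_map_left_end, hf.cut_map_right_end h]
    exact hf.overlap

lemma IsPL.map_lt_crit_of_lt_cut (hf : f.IsPL a b) (h : f.crit ≤ f.map f.left) {x : ℝ}
    (h1 : f.crit < x) (h2 : x < (f.cut a b).crit) :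
    f.left ≤ f.map x ∧ f.map x < f.crit ∧ f.map (f.map x) = (f.cut a b).map x ∧
      f.crit < f.map (f.map x) := by
  have h3 := hf.cut_crit_lt h
  have e := hf.map_right x h1 (by linarith)
  have hb := hf.b_pos
  have ha := hf.a_pos
  have h4 := hf.map_cut_crit_sub
  have hx : 0 < b * (x - f.crit) := mul_pos hb (by linarith)
  have hx' : b * (x - f.crit) < b * ((f.cut a b).crit - f.crit) :=
    mul_lt_mul_of_pos_left (by linarith) hb
  have l1 : f.left ≤ f.map x := by linarith
  have l2 : f.map x < f.crit := by linarith
  refine ⟨l1, l2, ?_, ?_⟩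
  · rw [hf.map_left _ l1 l2, hf.cut_map_left h2, e]
  · rw [hf.map_left _ l1 l2, e]
    rw [hf.map_left_end] at h
    have := mul_pos ha hx
    linarith

lemma IsPL.crit_lt_map_of_cut_lt (hf : f.IsPL a b) {x : ℝ} (h1 : (f.cut a b).crit < x)
    (h2 : x ≤ f.right) : f.crit < f.map x := by
  have h4 := hf.map_cut_crit_sub
  rw [hf.map_right x (hf.crit_lt_cut_crit.trans h1) h2]
  have : b * ((f.cut a b).crit - f.crit) < b * (x - f.crit) :=
    mul_lt_mul_of_pos_left (by linarith) hf.b_pos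
  linarith

lemma IsPL.map_cut_crit (hf : f.IsPL a b) (h : f.crit ≤ f.map f.left) :
    f.map (f.cut a b).crit = f.crit := by
  rw [hf.map_right _ hf.crit_lt_cut_crit (hf.cut_crit_lt h).le, hf.map_cut_crit_sub]
  ring

/-- The new discontinuity is mapped to the old one, so the side of it on which a point lies is read
off from the next image under f. Hence a pair with common itinerary under f has one under the return
map; a pair on the left is first moved to the right by one step. -/
lemma IsPL.noHom_of_cut (hf : f.IsPL a b) (h : f.crit ≤ f.map f.left) (hg : (f.cut a b).NoHom) :
    f.NoHom := by
  have main : ∀ z w, f.IsHom z w → ¬ f.crit < z := by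
    intro z w hh hz
    have key : ∀ n, ∃ m, (f.cut a b).map^[n] z = f.map^[m] z ∧ (f.cut a b).map^[n] w = f.map^[m] w ∧
        f.crit < f.map^[m] z ∧
        (f.cut a b).SameSide ((f.cut a b).map^[n] z) ((f.cut a b).map^[n] w) := by
      have side : ∀ u v, f.IsHom u v → f.crit < u → (f.cut a b).SameSide u v := by
        intro u v huv hu
        have hM := huv.map hf
        rcases lt_trichotomy u (f.cut a b).crit with h1 | h1 | h1
        · left
          refine ⟨h1, ?_⟩
          have h2 := (hf.map_lt_crit_of_lt_cut h hu h1).2.1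
          by_contra hcon
          push Not at hcon
          rcases hcon.eq_or_lt with h3 | h3
          · have := hf.map_cut_crit h
            rw [h3] at this
            exact hM.sameSide.symm.ne this
          · have := hf.crit_lt_map_of_cut_lt h3 huv.mem_right.2
            rcases hM.sameSide with h4 | h4
            · linarith
            · linarith
        · exact absurd (h1 ▸ hf.map_cut_crit h) hM.sameSide.ne
        · exact Or.inr ⟨h1, h1.trans huv.lt⟩
      intro n
      induction n with
      | zero => exact ⟨0, rfl, rfl, hz, side z w hh hz⟩
      | succ n ih =>
        obtain ⟨m, e1, e2, h1, h2⟩ := ih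
        have hm := hh.iterate hf m
        rw [e1, e2] at h2
        simp only [Function.iterate_succ_apply']
        rw [e1, e2]
        rcases h2 with h2 | h2
        · have g1 := hf.map_lt_crit_of_lt_cut h h1 h2.1
          have g2 := hf.map_lt_crit_of_lt_cut h (h1.trans hm.lt) h2.2
          refine ⟨m + 2, ?_, ?_, ?_, ?_⟩
          · simp only [Function.iterate_succ_apply']
            exact g1.2.2.1.symm
          · simp only [Function.iterate_succ_apply']
            exact g2.2.2.1.symm
          · simp only [Function.iterate_succ_apply']
            exact g1.2.2.2
          · rw [← g1.2.2.1, ← g2.2.2.1]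
            exact side _ _ ((hm.map hf).map hf) g1.2.2.2
        · have g1 := hf.crit_lt_map_of_cut_lt h2.1 hm.mem_left.2
          rw [cut_map_right h2.1, cut_map_right h2.2]
          refine ⟨m + 1, ?_, ?_, ?_, ?_⟩
          · rw [Function.iterate_succ_apply']
          · rw [Function.iterate_succ_apply']
          · rw [Function.iterate_succ_apply']
            exact g1
          · exact side _ _ (hm.map hf) g1
    refine hg z ⟨hz.le, hh.mem_left.2⟩ w ⟨(hz.trans hh.lt).le, hh.mem_right.2⟩ hh.lt
      fun n i _ => ?_
    obtain ⟨m, -, -, -, h5⟩ := key i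
    exact h5
  refine noHom_of_forall fun z w hh => ?_
  rcases hh.sameSide with h1 | h1
  · refine main _ _ (hh.map hf) ?_
    have h2 := (hh.map hf).sameSide.ne
    have h3 : f.map f.left ≤ f.map z := by
      rw [hf.map_left_end, hf.map_left z hh.mem_left.1 h1.1]
      have := mul_nonneg hf.a_pos.le (sub_nonneg.2 hh.mem_left.1)
      linarith
    exact lt_of_le_of_ne (h.trans h3) h2.symm
  · exact main _ _ hh h1.1

lemma IsPL.hasInnerPeriodic_of_cut (hf : f.IsPL a b) (h : f.crit ≤ f.map f.left)
    (hg : (f.cut a b).HasInnerPeriodic) : f.HasInnerPeriodic := by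
  obtain ⟨z, hz, n, hn, hp, hc⟩ := hg
  have hz' : z ∈ Ioo f.left f.right := ⟨hf.left_lt.trans hz.1, hz.2⟩
  have key : ∀ i, ∃ m, i ≤ m ∧ (f.cut a b).map^[i] z = f.map^[m] z ∧ f.crit < f.map^[m] z ∧
      ∀ j ≤ m, f.map^[j] z ≠ f.crit := by
    intro i
    induction i with
    | zero =>
      refine ⟨0, le_rfl, rfl, hz.1, fun j hj => ?_⟩
      obtain rfl : j = 0 := by omega
      exact hz.1.ne'
    | succ i ih =>
      obtain ⟨m, hm, e, h1, h2⟩ := ih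
      have hmem := hf.iter_mem_Ioo hz' (n := m) fun j hj => h2 j hj.le
      rw [Function.iterate_succ_apply', e]
      have h3 := hc i
      rw [e] at h3
      rcases lt_or_gt_of_ne h3 with h4 | h4
      · have g := hf.map_lt_crit_of_lt_cut h h1 h4
        refine ⟨m + 2, by omega, ?_, ?_, fun j hj => ?_⟩
        · simp only [Function.iterate_succ_apply']
          exact g.2.2.1.symm
        · simp only [Function.iterate_succ_apply']
          exact g.2.2.2
        · rcases Nat.lt_or_ge j (m + 1) with h5 | h5
          · exact h2 j (by omega)
          · rcases h5.eq_or_lt with h6 | h6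
            · rw [← h6, Function.iterate_succ_apply']
              exact g.2.1.ne
            · obtain rfl : j = m + 2 := by omega
              simp only [Function.iterate_succ_apply']
              exact g.2.2.2.ne'
      · have g := hf.crit_lt_map_of_cut_lt h4 hmem.2.le
        rw [cut_map_right h4]
        refine ⟨m + 1, by omega, ?_, ?_, fun j hj => ?_⟩
        · rw [Function.iterate_succ_apply']
        · rw [Function.iterate_succ_apply']
          exact g
        · rcases Nat.lt_or_ge j (m + 1) with h5 | h5
          · exact h2 j (by omega)
          · obtain rfl : j = m + 1 := by omega
            rw [Function.iterate_succ_apply']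
            exact g.ne'
  obtain ⟨m, hm, e, -, -⟩ := key n
  refine ⟨z, hz', m, by omega, by rw [← e, hp], fun i => ?_⟩
  obtain ⟨m', hm', -, -, h2⟩ := key i
  exact h2 i hm'

/-- Points are separated by their itineraries, and there is a periodic point. -/
def IsGood (f : LorenzData) : Prop := f.NoHom ∧ f.HasInnerPeriodic

lemma IsGood.of_reflect (h : f.reflect.IsGood) : f.IsGood :=
  ⟨h.1.of_reflect, h.2.of_reflect⟩

lemma IsPL.isGood_of_cut (hf : f.IsPL a b) (h : f.crit ≤ f.map f.left)
    (hg : (f.cut a b).IsGood) : f.IsGood :=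
  ⟨hf.noHom_of_cut h hg.1, hf.hasInnerPeriodic_of_cut h hg.2⟩

lemma IsPL.isGood_of_fixed (hf : f.IsPL a b) (h0 : f.map f.left = f.left) : f.IsGood :=
  ⟨hf.noHom_of_fixed h0, hf.hasInnerPeriodic_of_fixed h0⟩

lemma IsPL.isGood_of_mem (hf : f.IsPL a b) (h0 : f.map f.left < f.crit)
    (h1 : f.crit < f.map f.right) : f.IsGood := by
  obtain ⟨p, q, h⟩ := hf.exists_twoCycle h0 h1
  exact ⟨h.noHom hf, h.hasInnerPeriodic⟩

lemma reflect_map_left : f.reflect.map f.reflect.left = -f.map f.right := by simp [reflect]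

lemma reflect_map_right : f.reflect.map f.reflect.right = -f.map f.left := by simp [reflect]

/-- The maps with overlap `δ` on intervals of length at most `M` and less than `t` are good. -/
def GoodBelow (δ M t : ℝ) : Prop :=
  ∀ (f : LorenzData) (a b : ℝ), f.IsPL a b → f.map f.right - f.map f.left = δ →
    f.right - f.left ≤ M → f.right - f.left < t → f.IsGood

/-! ### Cutting ends after finitely many steps. -/

section Termination

variable {δ M ε t : ℝ}

lemma GoodBelow.of_left_cut (hG : GoodBelow δ M t) (hf : f.IsPL a b)
    (hδ : f.map f.right - f.map f.left = δ) (hM : f.right - f.left ≤ M)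
    (ht : f.right - f.left < t + ε) (h : f.crit ≤ f.map f.left) (hε : ε ≤ f.crit - f.left) :
    f.IsGood := by
  refine hf.isGood_of_cut h (hG _ _ _ (hf.cut h) ?_ ?_ ?_)
  · rw [hf.cut_map_left_end, hf.cut_map_right_end h, hδ]
  · have := hf.left_lt
    simp only [LorenzData.cut]
    linarith
  · simp only [LorenzData.cut]
    linarith

lemma GoodBelow.of_right_cut (hG : GoodBelow δ M t) (hf : f.IsPL a b)
    (hδ : f.map f.right - f.map f.left = δ) (hM : f.right - f.left ≤ M)
    (ht : f.right - f.left < t + ε) (h : f.map f.right ≤ f.crit) (hε : ε ≤ f.right - f.crit) :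
    f.IsGood := by
  refine IsGood.of_reflect (hG.of_left_cut (ε := ε) hf.reflect ?_ ?_ ?_ ?_ ?_)
  · rw [reflect_map_left, reflect_map_right]
    linarith
  · simp only [reflect]
    linarith
  · simp only [reflect]
    linarith
  · rw [reflect_map_left]
    simp only [reflect]
    linarith
  · simp only [reflect]
    linarith

/-- A run of short cuts on the left. -/
lemma GoodBelow.left_run (hδ0 : 0 < δ) (hε : ε * (1 + M / δ) = δ)
    (hG : GoodBelow δ M t) {R v0 v1 η : ℝ} (hb : 0 < b) (hv : v1 - v0 = δ) (hη : 0 < η)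
    (hηR : η ≤ R - v1) (k : ℕ) : ∀ (f : LorenzData) (a : ℝ), f.IsPL a b → f.right = R →
    f.map f.left = v0 → f.map f.right = v1 → f.right - f.left ≤ M →
    f.right - f.left < t + ε → η ≤ f.crit - f.left →
    (v0 < f.crit → ε ≤ f.right - f.crit) → v0 - f.crit < k * η → f.IsGood := by
  induction k with
  | zero =>
    intro f a hf hR h0 h1 hM ht _ hc hk
    have hk' : v0 < f.crit := by simpa using hk
    rcases lt_or_ge f.crit v1 with h2 | h2
    · exact hf.isGood_of_mem (by rwa [h0]) (by rwa [h1])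
    -- The run of left cuts is over and the next cut is on the right; it has length at least ε,
    -- hence lands below t.
    · exact hG.of_right_cut hf (by rw [h0, h1, hv]) hM ht (by rwa [h1]) (hc hk')
  | succ k ih =>
    intro f a hf hR h0 h1 hM ht hl hc hk
    rcases lt_or_ge v0 f.crit with h3 | h3
    · rcases lt_or_ge f.crit v1 with h2 | h2
      · exact hf.isGood_of_mem (by rwa [h0]) (by rwa [h1])
      · exact hG.of_right_cut hf (by rw [h0, h1, hv]) hM ht (by rwa [h1]) (hc h3)
    · have hcut : f.crit ≤ f.map f.left := by rwa [h0]
      rcases le_or_gt ε (f.crit - f.left) with h4 | h4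
      · exact hG.of_left_cut hf (by rw [h0, h1, hv]) hM ht hcut h4
      have e1 := hf.map_cut_crit_sub
      have e2 := hf.map_right_end
      have e3 := hf.left_le
      have hlc := hf.left_lt
      have hcr := hf.lt_right
      -- Successive cuts do not shrink below η. The cut lengths are divided by b, which helps if b <
      -- 1; if b ≥ 1, then right - crit' ≤ v1 - crit, where crit' is the new discontinuity.
      have hl' : η ≤ (f.cut a b).crit - f.crit := by
        rcases le_or_gt 1 b with hb1 | hb1
        · have : (f.cut a b).crit - f.crit ≥ R - v1 := by
            rw [h1] at e2
            have h5 : b * (f.right - (f.cut a b).crit) = v1 - f.crit := by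
              linear_combination (-1) * e2 - e1
            have h6 := hf.cut_crit_lt hcut
            rw [← hR]
            nlinarith
          linarith
        · have h6 := hf.crit_lt_cut_crit
          nlinarith
      have hbM : δ ≤ b * M := by
        have : δ ≤ b * (f.right - f.crit) := by
          rw [h1] at e2
          rw [h0] at e3
          linarith
        have := mul_le_mul_of_nonneg_left (by linarith : f.right - f.crit ≤ M) hb.le
        linarith
      have hM0 : 0 < M := by linarith
      -- A short cut is followed by a discontinuity moved by at most εM/δ. Since right - crit ≥ δ,
      -- the room left on the right is at least δ - εM/δ = ε, which explains the choice of ε.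
      have hsmall : (f.cut a b).crit - f.crit ≤ ε * (M / δ) := by
        have h6 : 0 < (f.cut a b).crit - f.crit := sub_pos.2 hf.crit_lt_cut_crit
        rw [mul_div_assoc', le_div_iff₀ hδ0]
        calc ((f.cut a b).crit - f.crit) * δ ≤ ((f.cut a b).crit - f.crit) * (b * M) :=
              mul_le_mul_of_nonneg_left hbM h6.le
          _ = (b * ((f.cut a b).crit - f.crit)) * M := by ring
          _ ≤ ε * M := by
              rw [e1]
              exact mul_le_mul_of_nonneg_right h4.le hM0.le
      refine hf.isGood_of_cut hcut (ih (f.cut a b) (a * b) (hf.cut hcut) hR ?_ ?_ ?_ ?_ hl' ?_ ?_)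
      · rw [hf.cut_map_left_end, h0]
      · rw [hf.cut_map_right_end hcut, h1]
      · simp only [LorenzData.cut]
        linarith
      · simp only [LorenzData.cut]
        linarith
      · intro _
        have h7 : δ ≤ f.right - f.crit := by
          have := hf.le_right
          rw [h1] at this
          linarith
        have : (f.cut a b).right = f.right := rfl
        rw [this]
        linarith
      · push_cast at hk
        linarith

/-- The constant η of the run is positive unless `right` is fixed, and that case is covered directly
by the fixed end point argument. -/
lemma GoodBelow.of_crit_le (hδ0 : 0 < δ) (hε : ε * (1 + M / δ) = δ)
    (hG : GoodBelow δ M t) (hf : f.IsPL a b)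
    (hδ : f.map f.right - f.map f.left = δ) (hM : f.right - f.left ≤ M)
    (ht : f.right - f.left < t + ε) (h : f.crit ≤ f.map f.left) : f.IsGood := by
  rcases hf.le_right.eq_or_lt with h1 | h1
  · refine IsGood.of_reflect (hf.reflect.isGood_of_fixed ?_)
    rw [reflect_map_left, h1]
    rfl
  · have hη : 0 < min (f.crit - f.left) (f.right - f.map f.right) :=
      lt_min (sub_pos.2 hf.left_lt) (sub_pos.2 h1)
    obtain ⟨k, hk⟩ := exists_nat_gt ((f.map f.left - f.crit) /
      min (f.crit - f.left) (f.right - f.map f.right))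
    rw [div_lt_iff₀ hη] at hk
    exact GoodBelow.left_run hδ0 hε hG hf.b_pos hδ hη (min_le_right _ _) k f a hf rfl rfl rfl hM ht
      (min_le_left _ _) (fun h2 => absurd h2 h.not_gt) hk

lemma goodBelow_mul (hδ0 : 0 < δ) (hε : ε * (1 + M / δ) = δ) (N : ℕ) : GoodBelow δ M (N * ε) := by
  induction N with
  | zero =>
    intro f a b hf _ _ h
    have h1 := hf.left_lt
    have h2 := hf.lt_right
    simp only [Nat.cast_zero, zero_mul] at h
    linarith
  | succ N ih =>
    intro f a b hf hδ hM ht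
    have ht' : f.right - f.left < N * ε + ε := by
      push_cast at ht
      linarith
    rcases le_or_gt f.crit (f.map f.left) with h | h
    · exact ih.of_crit_le hδ0 hε hf hδ hM ht' h
    · rcases lt_or_ge f.crit (f.map f.right) with h2 | h2
      · exact hf.isGood_of_mem h h2
      · refine IsGood.of_reflect (ih.of_crit_le hδ0 hε hf.reflect ?_ ?_ ?_ ?_)
        · rw [reflect_map_left, reflect_map_right]
          linarith
        · simp only [reflect]
          linarith
        · simp only [reflect]
          linarith
        · rw [reflect_map_left]
          simp only [reflect]
          linarith

end Termination

theorem IsPL.isGood (hf : f.IsPL a b) : f.IsGood := by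
  have hδ0 : 0 < f.map f.right - f.map f.left := sub_pos.2 hf.overlap
  have hM : 0 < f.right - f.left := by linarith [hf.left_lt, hf.lt_right]
  set δ := f.map f.right - f.map f.left
  set M := f.right - f.left
  have h1 : 0 < 1 + M / δ := by positivity
  have hε : δ / (1 + M / δ) * (1 + M / δ) = δ := div_mul_cancel₀ _ h1.ne'
  have hε0 : 0 < δ / (1 + M / δ) := by positivity
  obtain ⟨N, hN⟩ := exists_nat_gt (M / (δ / (1 + M / δ)))
  rw [div_lt_iff₀ hε0] at hN
  exact goodBelow_mul hδ0 hε N f a b hf rfl le_rfl hN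

end LorenzData

namespace LorenzData

variable {f : LorenzData} {a b : ℝ} {E : Set ℝ}

/-! ### Completely invariant sets -/

namespace IsProperCompletelyInvariant

lemma mem_of_map (hE : f.IsProperCompletelyInvariant E) {x : ℝ} (hx : x ∈ Ioo f.left f.right)
    (hc : x ≠ f.crit) (h : f.map x ∈ E) : x ∈ E := by
  rw [← hE.preimage_eq]
  exact ⟨⟨hx, hc⟩, h⟩

lemma map_mem (hE : f.IsProperCompletelyInvariant E) {x : ℝ} (h : x ∈ E) : f.map x ∈ E := by
  have := mem_image_of_mem f.map h
  rwa [hE.image_eq] at this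

lemma exists_preimage (hE : f.IsProperCompletelyInvariant E) {x : ℝ} (h : x ∈ E) :
    ∃ w ∈ E, f.map w = x := by
  rwa [← hE.image_eq] at h

lemma iter_mem (hE : f.IsProperCompletelyInvariant E) {x : ℝ} (h : x ∈ E) (n : ℕ) :
    f.map^[n] x ∈ E := by
  induction n with
  | zero => exact h
  | succ n ih =>
    rw [Function.iterate_succ_apply']
    exact hE.map_mem ih

lemma mem_Ioo (hE : f.IsProperCompletelyInvariant E) {x : ℝ} (h : x ∈ E) :
    x ∈ Ioo f.left f.right := (hE.subset h).1

lemma mem_Icc (hE : f.IsProperCompletelyInvariant E) {x : ℝ} (h : x ∈ E) :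
    x ∈ Icc f.left f.right := Ioo_subset_Icc_self (hE.subset h).1

lemma ne_crit (hE : f.IsProperCompletelyInvariant E) {x : ℝ} (h : x ∈ E) : x ≠ f.crit :=
  (hE.subset h).2

lemma iter_ne (hE : f.IsProperCompletelyInvariant E) {x : ℝ} (h : x ∈ E) (n : ℕ) :
    f.map^[n] x ≠ f.crit := hE.ne_crit (hE.iter_mem h n)

lemma mem_of_iter (hE : f.IsProperCompletelyInvariant E) (hf : f.IsPL a b) {n : ℕ} {x : ℝ}
    (hx : x ∈ Ioo f.left f.right) (hc : ∀ i < n, f.map^[i] x ≠ f.crit) (h : f.map^[n] x ∈ E) :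
    x ∈ E := by
  induction n with
  | zero => exact h
  | succ n ih =>
    refine ih (fun i hi => hc i (by omega)) (hE.mem_of_map (hf.iter_mem_Ioo hx fun i hi =>
      hc i (by omega)) (hc n (by omega)) ?_)
    rwa [← Function.iterate_succ_apply' f.map]

lemma reflect (hE : f.IsProperCompletelyInvariant E) :
    f.reflect.IsProperCompletelyInvariant (Neg.neg ⁻¹' E) where
  nonempty := by
    obtain ⟨x, hx⟩ := hE.nonempty
    exact ⟨-x, by simpa using hx⟩
  isClosed := hE.isClosed.preimage continuous_neg
  subset := by
    intro x hx
    have h := hE.subset hx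
    refine ⟨?_, fun h' => h.2 ?_⟩
    · have h1 := h.1
      rwa [← reflect_mem_Ioo, neg_neg] at h1
    · rw [mem_singleton_iff.1 h']
      simp [LorenzData.reflect]
  image_eq := by
    ext x
    constructor
    · rintro ⟨w, hw, rfl⟩
      simpa [LorenzData.reflect] using hE.map_mem hw
    · intro hx
      obtain ⟨w, hw, e⟩ := hE.exists_preimage hx
      exact ⟨-w, by simpa using hw, by simp [LorenzData.reflect, e]⟩
  preimage_eq := by
    ext x
    constructor
    · rintro ⟨h1, h2⟩
      refine hE.mem_of_map ?_ ?_ (by simpa [LorenzData.reflect] using h2)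
      · rw [← reflect_mem_Ioo, neg_neg]
        exact h1.1
      · intro h
        apply h1.2
        rw [mem_singleton_iff, ← neg_neg x, h]
        rfl
    · intro hx
      refine ⟨⟨?_, ?_⟩, ?_⟩
      · have := hE.mem_Ioo hx
        rwa [← reflect_mem_Ioo, neg_neg] at this
      · intro h
        refine hE.ne_crit hx ?_
        rw [mem_singleton_iff.1 h]
        simp [LorenzData.reflect]
      · simpa [LorenzData.reflect] using hE.map_mem hx

end IsProperCompletelyInvariant

/-- The extreme points of a proper completely invariant closed set, and its points next to the
discontinuity. -/
structure Frame (f : LorenzData) (E : Set ℝ) (e₀ e₁ x y : ℝ) : Prop where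
  least : IsLeast E e₀
  greatest : IsGreatest E e₁
  left : IsGreatest (E ∩ Iio f.crit) x
  right : IsLeast (E ∩ Ioi f.crit) y
  map_x : f.map x = e₁
  map_y : f.map y = e₀

lemma neg_preimage_isGreatest {S : Set ℝ} {x : ℝ} (h : IsGreatest S x) :
    IsLeast (Neg.neg ⁻¹' S) (-x) :=
  ⟨by simpa using h.1, fun y hy => by have := h.2 hy; linarith⟩

lemma neg_preimage_isLeast {S : Set ℝ} {x : ℝ} (h : IsLeast S x) :
    IsGreatest (Neg.neg ⁻¹' S) (-x) :=
  ⟨by simpa using h.1, fun y hy => by have := h.2 hy; linarith⟩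

lemma IsProperCompletelyInvariant.isCompact (hE : f.IsProperCompletelyInvariant E) :
    IsCompact E :=
  isCompact_Icc.of_isClosed_subset hE.isClosed fun _ hx => hE.mem_Icc hx

/-- On the right branch f(w) < w, so a preimage in E of the largest point must lie on the left; by
monotonicity the largest point of E there has the same image. -/
lemma IsProperCompletelyInvariant.exists_left (hE : f.IsProperCompletelyInvariant E)
    (hf : f.IsPL a b) {e₁ : ℝ} (h : IsGreatest E e₁) :
    ∃ x, IsGreatest (E ∩ Iio f.crit) x ∧ f.map x = e₁ := by
  obtain ⟨w, hw, e⟩ := hE.exists_preimage h.1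
  have hwc : w < f.crit := by
    by_contra hcon
    have h1 : f.crit < w := lt_of_le_of_ne (not_lt.1 hcon) (hE.ne_crit hw).symm
    have h2 := hf.map_lt' (hE.mem_Ioo hw).2 h1
    linarith [h.2 hw]
  have heq : E ∩ Iio f.crit = E ∩ Iic f.crit := by
    ext z
    constructor
    · exact fun hz => ⟨hz.1, (mem_Iio.1 hz.2).le⟩
    · exact fun hz => ⟨hz.1, lt_of_le_of_ne hz.2 (hE.ne_crit hz.1)⟩
  have hcomp : IsCompact (E ∩ Iio f.crit) := heq ▸ hE.isCompact.inter_right isClosed_Iic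
  obtain ⟨x, hx⟩ := hcomp.exists_isGreatest ⟨w, hw, hwc⟩
  refine ⟨x, hx, le_antisymm (h.2 (hE.map_mem hx.1.1)) ?_⟩
  rw [← e]
  have := hf.iter_le (n := 1) (hE.mem_Icc hw) (hE.mem_Icc hx.1.1)
    (sameItin_one.2 (Or.inl ⟨hwc, hx.1.2⟩))
  exact this.2 (hx.2 ⟨hw, hwc⟩)

lemma IsProperCompletelyInvariant.exists_frame (hE : f.IsProperCompletelyInvariant E)
    (hf : f.IsPL a b) : ∃ e₀ e₁ x y, f.Frame E e₀ e₁ x y := by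
  obtain ⟨e₀, h0⟩ := hE.isCompact.exists_isLeast hE.nonempty
  obtain ⟨e₁, h1⟩ := hE.isCompact.exists_isGreatest hE.nonempty
  obtain ⟨x, hx, hx'⟩ := hE.exists_left hf h1
  obtain ⟨y, hy, hy'⟩ := hE.reflect.exists_left hf.reflect (neg_preimage_isLeast h0)
  refine ⟨e₀, e₁, x, -y, h0, h1, hx, ?_, hx', ?_⟩
  · have := neg_preimage_isGreatest hy
    convert this using 1
    ext z
    simp [LorenzData.reflect]
  · simp only [LorenzData.reflect] at hy'
    linarith

lemma Frame.reflect {e₀ e₁ x y : ℝ} (h : f.Frame E e₀ e₁ x y) :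
    f.reflect.Frame (Neg.neg ⁻¹' E) (-e₁) (-e₀) (-y) (-x) where
  least := neg_preimage_isGreatest h.greatest
  greatest := neg_preimage_isLeast h.least
  left := by
    convert neg_preimage_isLeast h.right using 1
    ext z
    simp only [LorenzData.reflect, mem_inter_iff, mem_preimage, mem_Iio, mem_Ioi]
    constructor <;> rintro ⟨h1, h2⟩ <;> exact ⟨h1, by linarith⟩
  right := by
    convert neg_preimage_isGreatest h.left using 1
    ext z
    simp only [LorenzData.reflect, mem_inter_iff, mem_preimage, mem_Iio, mem_Ioi]
    constructor <;> rintro ⟨h1, h2⟩ <;> exact ⟨h1, by linarith⟩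
  map_x := by simp [LorenzData.reflect, h.map_y]
  map_y := by simp [LorenzData.reflect, h.map_x]

/-- If the least point were above f(left), it would have a preimage on the left branch, which lies
in E and below its image. -/
lemma IsProperCompletelyInvariant.least_le (hE : f.IsProperCompletelyInvariant E)
    (hf : f.IsPL a b) {e₀ : ℝ} (h : IsLeast E e₀) : e₀ ≤ f.map f.left := by
  by_contra hcon
  push Not at hcon
  obtain ⟨w, hw, e⟩ := hf.exists_left_preimage hcon (hE.mem_Ioo h.1).2
  have hwE : w ∈ E := hE.mem_of_map ⟨hw.1, hw.2.trans hf.lt_right⟩ hw.2.ne (e ▸ h.1)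
  have := hf.lt_map' hw.1 hw.2
  linarith [h.2 hwE]

/-! ### Return times of the gap around the discontinuity. -/

/-- `ℓ` is the return time to the left of the discontinuity. -/
structure LeftReturn (f : LorenzData) (a b x : ℝ) (ℓ : ℕ) : Prop where
  pos : 0 < ℓ
  per : f.map^[ℓ] x = x
  itin : ∀ z ∈ Ico x f.crit, f.SameItin ℓ x z
  gt : f.crit < x + f.iterSlope a b ℓ x * (f.crit - x)
  ne : ∀ i, 0 < i → i < ℓ → f.map^[i] x ≠ x

/-- `r` is the return time to the right of the discontinuity. -/
structure RightReturn (f : LorenzData) (a b y : ℝ) (r : ℕ) : Prop where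
  pos : 0 < r
  per : f.map^[r] y = y
  itin : ∀ z ∈ Ioc f.crit y, f.SameItin r y z
  lt : y - f.iterSlope a b r y * (y - f.crit) < f.crit
  ne : ∀ i, 0 < i → i < r → f.map^[i] y ≠ y

lemma LeftReturn.of_reflect {y : ℝ} {r : ℕ} (h : f.reflect.LeftReturn b a (-y) r) :
    f.RightReturn a b y r where
  pos := h.pos
  per := by
    have := h.per
    rw [reflect_iterate] at this
    linarith
  itin z hz := by
    rw [← reflect_sameItin]
    exact h.itin (-z) ⟨neg_le_neg hz.2, neg_lt_neg hz.1⟩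
  lt := by
    have := h.gt
    rw [reflect_iterSlope] at this
    simp only [LorenzData.reflect] at this
    linarith
  ne i h1 h2 h3 := by
    apply h.ne i h1 h2
    rw [reflect_iterate, h3]

/-- The part of the interval between `x` and the discontinuity never meets `E`. -/
lemma Frame.not_mem_of_mem_Ioo {e₀ e₁ x y : ℝ} (h : f.Frame E e₀ e₁ x y)
    (hE : f.IsProperCompletelyInvariant E) (hf : f.IsPL a b) {i : ℕ}
    (hi : ∀ z ∈ Ico x f.crit, f.SameItin i x z) {t : ℝ}
    (ht : t ∈ Ioo (f.map^[i] x) (f.map^[i] x + f.iterSlope a b i x * (f.crit - x))) : t ∉ E := by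
  have hS := hf.iterSlope_pos i x
  have hx := h.left.1
  set z := x + (t - f.map^[i] x) / f.iterSlope a b i x with hz
  have hz1 : x < z := by
    have : 0 < (t - f.map^[i] x) / f.iterSlope a b i x := div_pos (by linarith [ht.1]) hS
    linarith
  have hz2 : z < f.crit := by
    have : (t - f.map^[i] x) / f.iterSlope a b i x < f.crit - x := by
      rw [div_lt_iff₀ hS]
      linarith [ht.2]
    linarith
  have hzI : z ∈ Ioo f.left f.right :=
    ⟨(hE.mem_Ioo hx.1).1.trans hz1, hz2.trans hf.lt_right⟩
  have hit := hi z ⟨hz1.le, hz2⟩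
  have e := hf.iter_sub (hE.mem_Icc hx.1) (Ioo_subset_Icc_self hzI) hit
  have e' : f.map^[i] z = t := by
    have : f.iterSlope a b i x * (z - x) = t - f.map^[i] x := by
      rw [hz, add_sub_cancel_left]
      exact mul_div_cancel₀ _ hS.ne'
    linarith
  intro htE
  have hzE : z ∈ E := hE.mem_of_iter hf hzI hit.symm.ne (e' ▸ htE)
  exact absurd (h.left.2 ⟨hzE, hz2⟩) (not_le.2 hz1)

/-- Let ℓ be the first time at which the image of (x, crit) contains the discontinuity; it exists
because x and a point next to it have different itineraries. The image contains no point of E and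
starts at a point of E below crit, hence at x itself. -/
theorem Frame.exists_leftReturn {e₀ e₁ x y : ℝ} (h : f.Frame E e₀ e₁ x y)
    (hE : f.IsProperCompletelyInvariant E) (hf : f.IsPL a b) : ∃ ℓ, f.LeftReturn a b x ℓ := by
  have hx := h.left.1
  have hxI := hE.mem_Icc hx.1
  have hxc : x < f.crit := hx.2
  have step : ∀ n, (∀ i < n, ¬ (f.map^[i] x < f.crit ∧
      f.crit < f.map^[i] x + f.iterSlope a b i x * (f.crit - x))) →
      ∀ z ∈ Ico x f.crit, f.SameItin n x z := by
    intro n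
    induction n with
    | zero => exact fun _ _ _ => sameItin_zero
    | succ n ih =>
      intro hn z hz
      have hit := ih (fun i hi => hn i (by omega)) z hz
      have hzI : z ∈ Icc f.left f.right := ⟨hxI.1.trans hz.1, (hz.2.trans hf.lt_right).le⟩
      refine sameItin_add.2 ⟨hit, sameItin_one.2 ?_⟩
      have e := hf.iter_sub hxI hzI hit
      have hS := hf.iterSlope_pos n x
      rcases lt_or_gt_of_ne (hE.iter_ne hx.1 n) with h1 | h1
      · have h2 := hn n (by omega)
        push Not at h2
        have h3 := h2 h1
        have h4 : f.iterSlope a b n x * (z - x) < f.iterSlope a b n x * (f.crit - x) :=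
          mul_lt_mul_of_pos_left (by linarith [hz.2]) hS
        exact Or.inl ⟨h1, by linarith⟩
      · have h4 : 0 ≤ f.iterSlope a b n x * (z - x) := mul_nonneg hS.le (by linarith [hz.1])
        exact Or.inr ⟨h1, by linarith⟩
  have hex : ∃ i, f.map^[i] x < f.crit ∧
      f.crit < f.map^[i] x + f.iterSlope a b i x * (f.crit - x) := by
    by_contra hcon
    push Not at hcon
    refine hf.isGood.1 x hxI ((x + f.crit) / 2) ?_ (by linarith) fun n =>
      step n (fun i _ h1 => absurd h1.2 (not_lt.2 (hcon i h1.1))) _ ⟨by linarith, by linarith⟩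
    exact ⟨by linarith [hxI.1], by linarith [hf.lt_right]⟩
  classical
  set ℓ := Nat.find hex
  obtain ⟨g1, g2⟩ : f.map^[ℓ] x < f.crit ∧
      f.crit < f.map^[ℓ] x + f.iterSlope a b ℓ x * (f.crit - x) := Nat.find_spec hex
  have hmin : ∀ i < ℓ, ¬ (f.map^[i] x < f.crit ∧
      f.crit < f.map^[i] x + f.iterSlope a b i x * (f.crit - x)) := fun i hi => Nat.find_min hex hi
  have hit := step ℓ hmin
  have hper : f.map^[ℓ] x = x := by
    have h1 : f.map^[ℓ] x ≤ x := h.left.2 ⟨hE.iter_mem hx.1 ℓ, g1⟩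
    rcases h1.eq_or_lt with h2 | h2
    · exact h2
    · exact absurd hx.1 (h.not_mem_of_mem_Ioo hE hf hit ⟨h2, by linarith⟩)
  have hpos : 0 < ℓ := by
    rcases Nat.eq_zero_or_pos ℓ with h0 | h0
    · rw [h0] at g2
      simp [iterSlope] at g2
    · exact h0
  -- An earlier return would not reach past crit, so its slope is at most 1. Two such returns would
  -- compose to f^ℓ, whose slope exceeds 1.
  have le_one : ∀ i, 0 < i → i < ℓ → f.map^[i] x = x → f.iterSlope a b i x ≤ 1 := by
    intro i _ h2 h3
    have h4 := hmin i h2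
    rw [h3] at h4
    push Not at h4
    have h5 := h4 hxc
    by_contra hcon
    push Not at hcon
    nlinarith
  refine ⟨ℓ, hpos, hper, hit, by rwa [hper] at g2, fun i h1 h2 h3 => ?_⟩
  have h4 : f.map^[ℓ - i] x = x := by
    have := hper
    rw [← Nat.sub_add_cancel h2.le, Function.iterate_add_apply, h3] at this
    exact this
  have h5 := le_one i h1 h2 h3
  have h6 := le_one (ℓ - i) (by omega) (by omega) h4
  have h7 := iterSlope_add (f := f) (a := a) (b := b) i (ℓ - i) x
  rw [h3, Nat.add_sub_cancel' h2.le] at h7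
  rw [hper] at g2
  have h8 : f.iterSlope a b ℓ x ≤ 1 := by
    rw [h7]
    exact mul_le_one₀ h5 (hf.iterSlope_pos _ _).le h6
  nlinarith

theorem Frame.exists_rightReturn {e₀ e₁ x y : ℝ} (h : f.Frame E e₀ e₁ x y)
    (hE : f.IsProperCompletelyInvariant E) (hf : f.IsPL a b) : ∃ r, f.RightReturn a b y r := by
  obtain ⟨r, hr⟩ := h.reflect.exists_leftReturn hE.reflect hf.reflect
  exact ⟨r, hr.of_reflect⟩

lemma RightReturn.reflect {y : ℝ} {r : ℕ} (h : f.RightReturn a b y r) :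
    f.reflect.LeftReturn b a (-y) r where
  pos := h.pos
  per := by rw [reflect_iterate, h.per]
  itin z hz := by
    obtain ⟨z, rfl⟩ : ∃ w, z = -w := ⟨-z, by simp⟩
    rw [reflect_sameItin]
    exact h.itin z ⟨neg_lt_neg_iff.1 hz.2, neg_le_neg_iff.1 hz.1⟩
  gt := by
    have := h.lt
    rw [reflect_iterSlope]
    simp only [LorenzData.reflect]
    linarith
  ne i h1 h2 h3 := by
    apply h.ne i h1 h2
    rw [reflect_iterate] at h3
    linarith

/-! ### Slopes of the return maps. -/

section Returns

variable {e₀ e₁ x y : ℝ} {ℓ r : ℕ}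

lemma Frame.left_bound (h : f.Frame E e₀ e₁ x y) (hE : f.IsProperCompletelyInvariant E)
    (hf : f.IsPL a b) (hl : f.LeftReturn a b x ℓ) :
    x + f.iterSlope a b ℓ x * (f.crit - x) ≤ y := by
  by_contra hcon
  push Not at hcon
  refine h.not_mem_of_mem_Ioo hE hf hl.itin (t := y) ⟨?_, by rwa [hl.per]⟩ h.right.1.1
  rw [hl.per]
  exact (h.left.1.2 : x < f.crit).trans h.right.1.2

lemma Frame.right_bound (h : f.Frame E e₀ e₁ x y) (hE : f.IsProperCompletelyInvariant E)
    (hf : f.IsPL a b) (hr : f.RightReturn a b y r) :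
    x ≤ y - f.iterSlope a b r y * (y - f.crit) := by
  have := h.reflect.left_bound hE.reflect hf.reflect hr.reflect
  rw [reflect_iterSlope] at this
  simp only [LorenzData.reflect] at this
  linarith

lemma LeftReturn.one_lt (hl : f.LeftReturn a b x ℓ) (hx : x < f.crit) :
    1 < f.iterSlope a b ℓ x := by
  have := hl.gt
  by_contra hcon
  push Not at hcon
  nlinarith

lemma RightReturn.one_lt (hr : f.RightReturn a b y r) (hy : f.crit < y) :
    1 < f.iterSlope a b r y := by
  have := hr.lt
  by_contra hcon
  push Not at hcon
  nlinarith

/-- Both images lie in the gap: A(crit - x) ≤ y - x and B(y - crit) ≤ y - x. Dividing by the slopes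
and adding gives the claim. -/
lemma Frame.one_le_inv_add_inv (h : f.Frame E e₀ e₁ x y)
    (hE : f.IsProperCompletelyInvariant E) (hf : f.IsPL a b) (hl : f.LeftReturn a b x ℓ)
    (hr : f.RightReturn a b y r) :
    1 ≤ 1 / f.iterSlope a b ℓ x + 1 / f.iterSlope a b r y := by
  have h1 := h.left_bound hE hf hl
  have h2 := h.right_bound hE hf hr
  have hA := hf.iterSlope_pos ℓ x
  have hB := hf.iterSlope_pos r y
  have hxc : x < f.crit := h.left.1.2
  have hyc : f.crit < y := h.right.1.2
  have h3 : f.crit - x ≤ (y - x) * (1 / f.iterSlope a b ℓ x) := by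
    rw [mul_one_div, le_div_iff₀ hA]
    linarith
  have h4 : y - f.crit ≤ (y - x) * (1 / f.iterSlope a b r y) := by
    rw [mul_one_div, le_div_iff₀ hB]
    linarith
  have h5 : (y - x) * 1 ≤ (y - x) * (1 / f.iterSlope a b ℓ x + 1 / f.iterSlope a b r y) := by
    rw [mul_add]
    linarith
  exact le_of_mul_le_mul_left h5 (by linarith)

lemma iterSlope_of_periodic (hf : f.IsPL a b) {z : ℝ} {n : ℕ} (h : f.map^[n] z = z) (k : ℕ) :
    f.iterSlope a b n (f.map^[k] z) = f.iterSlope a b n z := by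
  have h1 := iterSlope_add (f := f) (a := a) (b := b) k n z
  have h2 := iterSlope_add (f := f) (a := a) (b := b) n k z
  rw [h, Nat.add_comm, h1, mul_comm] at h2
  exact mul_right_cancel₀ (hf.iterSlope_pos k z).ne' h2

lemma iterate_periodic {z : ℝ} {n : ℕ} (h : f.map^[n] z = z) (k : ℕ) :
    f.map^[n] (f.map^[k] z) = f.map^[k] z := by
  rw [← Function.iterate_add_apply, Nat.add_comm, Function.iterate_add_apply, h]

end Returns

end LorenzData

namespace LorenzData

variable {f : LorenzData} {a b : ℝ} {E : Set ℝ} {e₀ e₁ x y : ℝ} {ℓ r : ℕ}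

/-! ### Horseshoes -/

/-- Two disjoint branches of iterates of `f`, both onto `[e, t]`. -/
lemma IsPL.inv_add_inv_lt_one (hf : f.IsPL a b) {e t s u : ℝ} (he : e ∈ Icc f.left f.right)
    (ht : t ∈ Icc f.left f.right) (hs : s ∈ Icc f.left f.right) (hu : u ∈ Icc f.left f.right)
    (hlt : e < t) (hℓ : 0 < ℓ) (hr : 0 < r) (h1 : f.SameItin ℓ s t) (h2 : f.map^[ℓ] s = e)
    (h3 : f.map^[ℓ] t = t) (h4 : f.SameItin r e u) (h5 : f.map^[r] e = e)
    (h6 : f.map^[r] u = t) : 1 / f.iterSlope a b ℓ t + 1 / f.iterSlope a b r e < 1 := by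
  have hex : ∃ n, ¬ f.SameSide (f.map^[n] e) (f.map^[n] t) := by
    by_contra hcon
    push Not at hcon
    exact hf.isGood.1 e he t ht hlt fun n i _ => hcon i
  classical
  -- At the first time n when e and t are separated, the branch [s, t] is entirely on the side of t
  -- and [e, u] entirely on the side of e: their itineraries are constant for ℓ + n and r + n steps.
  -- So u < s and the branches are disjoint.
  obtain ⟨n, hn, hmin⟩ : ∃ n, ¬ f.SameSide (f.map^[n] e) (f.map^[n] t) ∧ f.SameItin n e t :=
    ⟨Nat.find hex, Nat.find_spec hex, fun i hi => not_not.1 (Nat.find_min hex hi)⟩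
  have g1 : f.SameItin (ℓ + n) s t := sameItin_add.2 ⟨h1, by rwa [h2, h3]⟩
  have g2 : f.SameItin (r + n) e u := sameItin_add.2 ⟨h4, by rwa [h5, h6]⟩
  have g3 := g1 n (by omega)
  have g4 := g2 n (by omega)
  obtain ⟨g5, g6⟩ := not_sameSide ((hf.iter_le he ht hmin).2 hlt.le) hn
  have hus : u < s := by
    have hit : f.SameItin n u s :=
      ((g2.mono (by omega)).symm.trans hmin).trans (g1.mono (by omega)).symm
    rw [← hf.iter_lt hu hs hit]
    rcases g3 with g3 | g3 <;> rcases g4 with g4 | g4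
    · linarith [g3.2]
    · linarith [g4.1]
    · linarith [g3.1, g4.2]
    · linarith [g4.1]
  have i1 := hf.iter_sub ht hs h1.symm
  have i2 := hf.iter_sub he hu h4
  rw [h2, h3] at i1
  rw [h5, h6] at i2
  have hA := hf.iterSlope_pos ℓ t
  have hB := hf.iterSlope_pos r e
  have j1 : (t - e) * (1 / f.iterSlope a b ℓ t) = t - s := by
    rw [mul_one_div, div_eq_iff hA.ne']
    linarith
  have j2 : (t - e) * (1 / f.iterSlope a b r e) = u - e := by
    rw [mul_one_div, div_eq_iff hB.ne']
    linarith
  have j3 : (t - e) * (1 / f.iterSlope a b ℓ t + 1 / f.iterSlope a b r e) < (t - e) * 1 := by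
    rw [mul_add, j1, j2]
    linarith
  exact lt_of_mul_lt_mul_left j3 (by linarith)

/-- An interval `[e, v]` with `v` on the orbit of `x`, mapped by `f^k` to an interval ending in `x`,
which contains a branch `[s, v]` of `f^ℓ` onto `[e, v]`. -/
structure LeftBranch (f : LorenzData) (e x : ℝ) (ℓ : ℕ) (v : ℝ) (k : ℕ) (s : ℝ) : Prop where
  lt_crit : v < f.crit
  orbit : ∃ j, v = f.map^[j] x
  iter : f.map^[k] v = x
  itin : f.SameItin k e v
  mem : s ∈ Icc f.left f.right
  branch : f.SameItin ℓ s v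
  map_branch : f.map^[ℓ] s = e

/-- The mirror image of `LeftBranch`. -/
structure RightBranch (f : LorenzData) (e y : ℝ) (r : ℕ) (v : ℝ) (k : ℕ) (s : ℝ) : Prop where
  crit_lt : f.crit < v
  orbit : ∃ j, v = f.map^[j] y
  iter : f.map^[k] v = y
  itin : f.SameItin k e v
  mem : s ∈ Icc f.left f.right
  branch : f.SameItin r s v
  map_branch : f.map^[r] s = e

lemma LeftBranch.of_reflect {e v s : ℝ} {k : ℕ}
    (h : f.reflect.LeftBranch (-e) (-y) r v k s) : f.RightBranch e y r (-v) k (-s) := by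
  obtain ⟨v, rfl⟩ : ∃ w, v = -w := ⟨-v, by simp⟩
  obtain ⟨s, rfl⟩ : ∃ w, s = -w := ⟨-s, by simp⟩
  obtain ⟨h1, ⟨j, h2⟩, h3, h4, h5, h6, h7⟩ := h
  rw [reflect_iterate] at h2 h3 h7
  rw [reflect_sameItin] at h4 h6
  rw [neg_neg, neg_neg]
  exact ⟨neg_lt_neg_iff.1 h1, ⟨j, neg_injective h2⟩, neg_injective h3, h4, reflect_mem_Icc.1 h5,
    h6, neg_injective h7⟩

lemma finite_orbit {z : ℝ} {n : ℕ} (hn : 0 < n) (h : f.map^[n] z = z) :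
    (range fun i : ℕ => f.map^[i] z).Finite := by
  refine ((Finset.range n).finite_toSet.image fun i => f.map^[i] z).subset ?_
  rintro _ ⟨i, rfl⟩
  refine ⟨i % n, by simpa using Nat.mod_lt i hn, ?_⟩
  exact Function.IsPeriodicPt.iterate_mod_apply h i

lemma iterate_eq_of_periodic {z w : ℝ} {n k : ℕ} (hn : 0 < n) (hz : f.map^[n] z = z)
    (hw : f.map^[n] w = w) (h : f.map^[k] z = f.map^[k] w) : z = w := by
  have hz' : f.map^[n * k] z = z := (Function.IsPeriodicPt.mul_const (f := f.map) hz k)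
  have hw' : f.map^[n * k] w = w := (Function.IsPeriodicPt.mul_const (f := f.map) hw k)
  have hk : n * k = (n * k - k) + k := (Nat.sub_add_cancel (Nat.le_mul_of_pos_left k hn)).symm
  rw [hk, Function.iterate_add_apply] at hz' hw'
  rw [← hz', ← hw', h]

/-- Among the intervals from e₀ to an orbit point mapped monotonically onto [w, x], take one with w
maximal, and pull [w, x] back along the orbit of x. Maximality keeps the pullbacks from being
truncated by the range of the left branch, and after ℓ + k steps they return to the chosen orbit
point. -/
theorem Frame.exists_leftBranch (h : f.Frame E e₀ e₁ x y) (hE : f.IsProperCompletelyInvariant E)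
    (hf : f.IsPL a b) (hl : f.LeftReturn a b x ℓ) (hr : f.RightReturn a b y r) :
    ∃ v k s, f.LeftBranch e₀ x ℓ v k s := by
  have hx := h.left.1
  have hxc : x < f.crit := hx.2
  have he := h.least.1
  have heI := hE.mem_Icc he
  have hle : ∀ j, e₀ ≤ f.map^[j] x := fun j => h.least.2 (hE.iter_mem hx.1 j)
  have hxj : ∀ j, f.map^[j] x ∈ Icc f.left f.right := fun j => hE.mem_Icc (hE.iter_mem hx.1 j)
  set V : Set ℝ := {v | ∃ k j, f.map^[j] x < f.crit ∧ f.map^[k] (f.map^[j] x) = x ∧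
    f.SameItin k e₀ (f.map^[j] x) ∧ v = f.map^[k] e₀} with hV
  have hVfin : V.Finite := by
    refine (finite_orbit (f := f) (z := e₀) hr.pos ?_).subset ?_
    · rw [← h.map_y, ← Function.iterate_succ_apply, Function.iterate_succ_apply', hr.per]
    · rintro _ ⟨k, j, -, -, -, rfl⟩
      exact ⟨k, rfl⟩
  obtain ⟨w, ⟨k, j, c1, c2, c3, hw⟩, hmax⟩ := exists_max_image V id hVfin
    ⟨e₀, 0, 0, hxc, rfl, sameItin_zero, rfl⟩
  have hwx : w ≤ x := by
    have := (hf.iter_le heI (hxj j) c3).2 (hle j)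
    rwa [c2, ← hw] at this
  have chain : ∀ t, ∃ s i, s ∈ E ∧ f.map^[t] (f.map^[i] x) = x ∧ f.map^[t] s = w ∧
      f.SameItin t s (f.map^[i] x) := by
    intro t
    induction t with
    | zero => exact ⟨w, 0, hw ▸ hE.iter_mem he k, rfl, rfl, sameItin_zero⟩
    | succ t ih =>
      obtain ⟨s, i, hs, d1, d2, d3⟩ := ih
      have hsx : s ≤ f.map^[i] x := by
        rw [← hf.iter_le (hE.mem_Icc hs) (hxj i) d3, d1, d2]
        exact hwx
      set u := f.map^[i + (ℓ - 1)] x with hu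
      have huE : u ∈ E := hE.iter_mem hx.1 _
      have hfu : f.map u = f.map^[i] x := by
        have hp := hl.pos
        rw [hu, ← Function.iterate_succ_apply' f.map, show (i + (ℓ - 1)).succ = i + ℓ by omega,
          Function.iterate_add_apply, hl.per]
      have hfut : f.map^[t + 1] u = x := by
        rw [Function.iterate_succ_apply, hfu, d1]
      have good : ∀ s', s' ∈ E → f.map s' = s → f.SameSide s' u →
          ∃ s i, s ∈ E ∧ f.map^[t + 1] (f.map^[i] x) = x ∧ f.map^[t + 1] s = w ∧
          f.SameItin (t + 1) s (f.map^[i] x) := by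
        intro s' h1 h2 h3
        refine ⟨s', i + (ℓ - 1), h1, hfut, ?_, ?_⟩
        · rw [Function.iterate_succ_apply, h2, d2]
        · rw [Nat.add_comm t 1]
          refine sameItin_add.2 ⟨sameItin_one.2 h3, ?_⟩
          rw [Function.iterate_one, h2, ← hu, hfu]
          exact d3
      rcases lt_or_gt_of_ne (hE.ne_crit huE) with huc | huc
      · rcases lt_or_ge (f.map f.left) s with hs0 | hs0
        · obtain ⟨s', hs', es⟩ := hf.exists_left_preimage hs0 (hE.mem_Ioo hs).2
          exact good s' (hE.mem_of_map ⟨hs'.1, hs'.2.trans hf.lt_right⟩ hs'.2.ne (es ▸ hs)) es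
            (Or.inl ⟨hs'.2, huc⟩)
        -- The only obstruction: the left end s is not above f(left). Then s < f(e₀), so e₀ itself
        -- would give a later interval of the family whose left end exceeds w.
        · exfalso
          have hec : e₀ < f.crit := lt_of_le_of_lt (hle _) huc
          have q1 : s < f.map e₀ := by
            refine lt_of_le_of_lt hs0 ?_
            rw [hf.map_left_end, hf.map_left e₀ heI.1 hec]
            have := mul_pos hf.a_pos (sub_pos.2 (hE.mem_Ioo he).1)
            linarith
          have q2 : f.map e₀ ≤ f.map^[i] x := by
            rw [← hfu]
            exact (hf.iter_le (n := 1) heI (hxj _) (sameItin_one.2 (Or.inl ⟨hec, huc⟩))).2 (hle _)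
          obtain ⟨q3, q4⟩ := hf.between (hE.mem_Icc hs) (hxj i) q1.le q2 d3
          have q5 := (hf.iter_lt (hE.mem_Icc hs) (hE.mem_Icc (hE.map_mem he)) q3).2 q1
          have q6 : f.map^[t + 1] e₀ ∈ V := by
            refine ⟨t + 1, i + (ℓ - 1), huc, hfut, ?_, rfl⟩
            rw [Nat.add_comm t 1]
            refine sameItin_add.2 ⟨sameItin_one.2 (Or.inl ⟨hec, huc⟩), ?_⟩
            rw [Function.iterate_one, ← hu, hfu]
            exact q4
          have q7 := hmax _ q6
          simp only [id, Function.iterate_succ_apply] at q7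
          rw [d2] at q5
          exact absurd q5 q7.not_gt
      · have hs1 : s < f.map f.right := by
          refine lt_of_le_of_lt hsx ?_
          rw [← hfu, hf.map_right_end, hf.map_right u huc (hE.mem_Icc huE).2]
          have := mul_pos hf.b_pos (sub_pos.2 (hE.mem_Ioo huE).2)
          linarith
        obtain ⟨s', hs', es⟩ := hf.exists_right_preimage (hE.mem_Ioo hs).1 hs1
        exact good s' (hE.mem_of_map ⟨hf.left_lt.trans hs'.1, hs'.2⟩ hs'.1.ne' (es ▸ hs)) es
          (Or.inr ⟨hs'.1, huc⟩)
  obtain ⟨s, i, hs, d1, d2, d3⟩ := chain (ℓ + k)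
  have hpi := iterate_periodic hl.per i
  have hpj := iterate_periodic hl.per j
  -- Two points of the cycle with the same k-th iterate coincide; hence f^ℓ(s) and e₀, sharing the
  -- itinerary of this point for k steps and both ending in w, coincide as well.
  have hij : f.map^[i] x = f.map^[j] x := by
    refine iterate_eq_of_periodic (k := k) hl.pos hpi hpj ?_
    rw [c2]
    rw [Nat.add_comm, Function.iterate_add_apply, hpi] at d1
    exact d1
  rw [hij] at d3
  obtain ⟨d4, d5⟩ := sameItin_add.1 d3
  rw [hpj] at d5
  refine ⟨f.map^[j] x, k, s, c1, ⟨j, rfl⟩, c2, c3, hE.mem_Icc hs, d4, ?_⟩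
  refine hf.iter_inj (hE.mem_Icc (hE.iter_mem hs ℓ)) heI (d5.trans c3.symm) ?_
  rw [← Function.iterate_add_apply, Nat.add_comm, d2, hw]

theorem Frame.exists_rightBranch (h : f.Frame E e₀ e₁ x y) (hE : f.IsProperCompletelyInvariant E)
    (hf : f.IsPL a b) (hl : f.LeftReturn a b x ℓ) (hr : f.RightReturn a b y r) :
    ∃ v k s, f.RightBranch e₁ y r v k s := by
  have hl' : f.reflect.RightReturn b a (-x) ℓ := by
    apply LeftReturn.of_reflect
    rw [reflect_reflect, neg_neg]
    exact hl
  obtain ⟨v, k, s, hb⟩ := h.reflect.exists_leftBranch hE.reflect hf.reflect hr.reflect hl'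
  exact ⟨-v, k, -s, hb.of_reflect⟩

/-- The least point of a completely invariant set lies on the orbit of `x`. -/
theorem Frame.least_mem_orbit (h : f.Frame E e₀ e₁ x y) (hE : f.IsProperCompletelyInvariant E)
    (hf : f.IsPL a b) (hl : f.LeftReturn a b x ℓ) (hr : f.RightReturn a b y r) :
    ∃ j, f.map^[j] x = e₀ := by
  by_contra hcon
  push Not at hcon
  obtain ⟨v, k, s, v1, ⟨j, v2⟩, v3, v4, v5, v6, v7⟩ := h.exists_leftBranch hE hf hl hr
  obtain ⟨v', k', s', w1, ⟨j', w2⟩, w3, w4, w5, w6, w7⟩ := h.exists_rightBranch hE hf hl hr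
  have hx := h.left.1
  have hy := h.right.1
  have hxc : x < f.crit := hx.2
  have hyc : f.crit < y := hy.2
  have hvE : v ∈ E := v2 ▸ hE.iter_mem hx.1 j
  have hvE' : v' ∈ E := w2 ▸ hE.iter_mem hy.1 j'
  have he0 := h.least.1
  have he1 := h.greatest.1
  have hlt : e₀ < v := lt_of_le_of_ne (h.least.2 hvE) (v2 ▸ (hcon j).symm)
  have hle' : v' ≤ e₁ := h.greatest.2 hvE'
  have hvper : f.map^[ℓ] v = v := v2 ▸ iterate_periodic hl.per j
  have hvper' : f.map^[r] v' = v' := w2 ▸ iterate_periodic hr.per j'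
  have heper : f.map^[r] e₀ = e₀ := by
    have := iterate_periodic hr.per 1
    rwa [Function.iterate_one, h.map_y] at this
  have heper1 : f.map^[ℓ] e₁ = e₁ := by
    have := iterate_periodic hl.per 1
    rwa [Function.iterate_one, h.map_x] at this
  have hSv : f.iterSlope a b ℓ v = f.iterSlope a b ℓ x := v2 ▸ iterSlope_of_periodic hf hl.per j
  have hSv' : f.iterSlope a b r v' = f.iterSlope a b r y :=
    w2 ▸ iterSlope_of_periodic hf hr.per j'
  have hSe0 : f.iterSlope a b r e₀ = f.iterSlope a b r y := by
    have := iterSlope_of_periodic hf hr.per 1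
    rwa [Function.iterate_one, h.map_y] at this
  have hSe1 : f.iterSlope a b ℓ e₁ = f.iterSlope a b ℓ x := by
    have := iterSlope_of_periodic hf hl.per 1
    rwa [Function.iterate_one, h.map_x] at this
  have hone := h.one_le_inv_add_inv hE hf hl hr
  have hA := hf.iterSlope_pos ℓ x
  have hB := hf.iterSlope_pos r y
  have p1 : f.SameItin (k + 1) e₀ v := by
    refine sameItin_add.2 ⟨v4, sameItin_one.2 (Or.inl ⟨?_, by rwa [v3]⟩)⟩
    have := (hf.iter_le (hE.mem_Icc he0) (hE.mem_Icc hvE) v4).2 hlt.le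
    rw [v3] at this
    linarith
  have p2 : f.SameItin (k' + 1) v' e₁ := by
    refine sameItin_add.2 ⟨w4.symm, sameItin_one.2 (Or.inr ⟨by rwa [w3], ?_⟩)⟩
    have := (hf.iter_le (hE.mem_Icc hvE') (hE.mem_Icc he1) w4.symm).2 hle'
    rw [w3] at this
    linarith
  have p3 : f.map^[k + 1] v = e₁ := by rw [Function.iterate_succ_apply', v3, h.map_x]
  have p4 : f.map^[k' + 1] v' = e₀ := by rw [Function.iterate_succ_apply', w3, h.map_y]
  -- First case: transporting the right branch by f^(k'+1) yields a branch of f^r starting at e₀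
  -- whose image covers [e₀, v]. Trimmed to u, it forms a horseshoe with the branch [s, v] of f^ℓ.
  rcases le_or_gt v (f.map^[k' + 1] e₁) with c1 | c1
  · have q1 : f.SameItin (r + (k' + 1)) v' s' := sameItin_add.2 ⟨w6.symm, by rwa [hvper', w7]⟩
    rw [Nat.add_comm] at q1
    obtain ⟨q2, q3⟩ := sameItin_add.1 q1
    rw [p4] at q3
    set τ := f.map^[k' + 1] s' with hτ
    have hτI : τ ∈ Icc f.left f.right := hf.iter_mem w5 q2.symm.ne
    have e1 : f.map^[r] τ = f.map^[k' + 1] e₁ := by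
      rw [hτ, ← Function.iterate_add_apply, Nat.add_comm, Function.iterate_add_apply, w7]
    have e2 := hf.iter_sub (hE.mem_Icc he0) hτI q3
    rw [e1, heper, hSe0] at e2
    set u := e₀ + (v - e₀) / f.iterSlope a b r y with hu
    have hu1 : e₀ ≤ u := by
      have : 0 ≤ (v - e₀) / f.iterSlope a b r y := div_nonneg (by linarith) hB.le
      linarith
    have hu2 : u ≤ τ := by
      have : (v - e₀) / f.iterSlope a b r y ≤ τ - e₀ := by
        rw [div_le_iff₀ hB]
        linarith
      linarith
    have huI : u ∈ Icc f.left f.right := ⟨(hE.mem_Icc he0).1.trans hu1, hu2.trans hτI.2⟩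
    obtain ⟨q4, -⟩ := hf.between (hE.mem_Icc he0) hτI hu1 hu2 q3
    have e3 := hf.iter_sub (hE.mem_Icc he0) huI q4
    have e4 : f.iterSlope a b r y * (u - e₀) = v - e₀ := by
      rw [hu, add_sub_cancel_left]
      exact mul_div_cancel₀ _ hB.ne'
    rw [heper, hSe0, e4] at e3
    have := hf.inv_add_inv_lt_one (hE.mem_Icc he0) (hE.mem_Icc hvE) v5 huI hlt hl.pos hr.pos v6 v7
      hvper q4 heper (by linarith)
    rw [hSv, hSe0] at this
    linarith
  -- Mirror image of the first case, giving a horseshoe on [v', e₁].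
  rcases le_or_gt (f.map^[k + 1] e₀) v' with c2 | c2
  · have q1 : f.SameItin (ℓ + (k + 1)) s v := sameItin_add.2 ⟨v6, by rwa [hvper, v7]⟩
    rw [Nat.add_comm] at q1
    obtain ⟨q2, q3⟩ := sameItin_add.1 q1
    rw [p3] at q3
    set τ := f.map^[k + 1] s with hτ
    have hτI : τ ∈ Icc f.left f.right := hf.iter_mem v5 q2.ne
    have e1 : f.map^[ℓ] τ = f.map^[k + 1] e₀ := by
      rw [hτ, ← Function.iterate_add_apply, Nat.add_comm, Function.iterate_add_apply, v7]
    have e2 := hf.iter_sub (hE.mem_Icc he1) hτI q3.symm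
    rw [e1, heper1, hSe1] at e2
    have hlt' : v' < e₁ := by
      refine lt_of_le_of_ne hle' fun hcon' => ?_
      have h9 : f.map^[k' + 1] e₁ = e₀ := by rw [← hcon', p4]
      refine hcon (k' + 1 + 1) ?_
      rw [Function.iterate_succ_apply, h.map_x, h9]
    set u := e₁ - (e₁ - v') / f.iterSlope a b ℓ x with hu
    have hu1 : u ≤ e₁ := by
      have : 0 ≤ (e₁ - v') / f.iterSlope a b ℓ x := div_nonneg (by linarith) hA.le
      linarith
    have hu2 : τ ≤ u := by
      have : (e₁ - v') / f.iterSlope a b ℓ x ≤ e₁ - τ := by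
        rw [div_le_iff₀ hA]
        linarith
      linarith
    have huI : u ∈ Icc f.left f.right := ⟨hτI.1.trans hu2, hu1.trans (hE.mem_Icc he1).2⟩
    obtain ⟨-, q4⟩ := hf.between hτI (hE.mem_Icc he1) hu2 hu1 q3
    have e3 := hf.iter_sub (hE.mem_Icc he1) huI q4.symm
    have e4 : f.iterSlope a b ℓ x * (u - e₁) = -(e₁ - v') := by
      rw [hu, sub_sub_cancel_left, mul_neg]
      rw [mul_div_cancel₀ _ hA.ne']
    rw [heper1, hSe1, e4] at e3
    have := hf.inv_add_inv_lt_one (hE.mem_Icc hvE') (hE.mem_Icc he1) huI w5 hlt' hl.pos hr.pos q4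
      (by linarith) heper1 w6.symm hvper' w7
    rw [hSe1, hSv'] at this
    linarith
  -- Remaining case: [e₀, v] goes into [v', e₁] and from there back into itself without meeting the
  -- discontinuity, so e₀ and v have the same itinerary forever.
  · set N := (k + 1) + (k' + 1) with hN
    have q1 : f.map^[k + 1] e₀ ≤ e₁ := h.greatest.2 (hE.iter_mem he0 _)
    have q2 : f.SameItin N e₀ v := by
      refine sameItin_add.2 ⟨p1, ?_⟩
      rw [p3]
      exact (hf.between (hE.mem_Icc hvE') (hE.mem_Icc he1) c2.le q1 p2).2
    have q3 : f.map^[N] v ≤ v := by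
      rw [hN, Nat.add_comm, Function.iterate_add_apply, p3]
      exact c1.le
    have q4 : e₀ ≤ f.map^[N] e₀ := h.least.2 (hE.iter_mem he0 _)
    have all : ∀ m u w, e₀ ≤ u → u ≤ w → w ≤ v → f.SameItin (m * N) u w := by
      intro m
      induction m with
      | zero =>
        intro u w _ _ _
        rw [Nat.zero_mul]
        exact sameItin_zero
      | succ m ih =>
        intro u w h1 h2 h3
        have huI : u ∈ Icc f.left f.right :=
          ⟨(hE.mem_Icc he0).1.trans h1, (h2.trans h3).trans (hE.mem_Icc hvE).2⟩
        have hwI : w ∈ Icc f.left f.right :=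
          ⟨(hE.mem_Icc he0).1.trans (h1.trans h2), h3.trans (hE.mem_Icc hvE).2⟩
        obtain ⟨g1, g2⟩ := hf.between (hE.mem_Icc he0) (hE.mem_Icc hvE) h1 (h2.trans h3) q2
        obtain ⟨g3, g4⟩ := hf.between huI (hE.mem_Icc hvE) h2 h3 g2
        rw [Nat.succ_mul, Nat.add_comm]
        refine sameItin_add.2 ⟨g3, ih _ _ ?_ ?_ ?_⟩
        · exact q4.trans ((hf.iter_le (hE.mem_Icc he0) huI g1).2 h1)
        · exact (hf.iter_le huI hwI g3).2 h2
        · exact ((hf.iter_le hwI (hE.mem_Icc hvE) g4).2 h3).trans q3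
    refine hf.isGood.1 e₀ (hE.mem_Icc he0) v (hE.mem_Icc hvE) hlt fun n => ?_
    exact (all n e₀ v le_rfl hlt.le le_rfl).mono (Nat.le_mul_of_pos_right n (by omega))

end LorenzData

namespace LorenzData

variable {f : LorenzData} {a b : ℝ} {E : Set ℝ} {e₀ e₁ x y : ℝ} {ℓ r : ℕ}

/-! ### Minimal completely invariant sets -/

lemma IsPL.exists_preimage (hf : f.IsPL a b) {t : ℝ} (ht : t ∈ Ioo f.left f.right) :
    ∃ w, w ∈ Ioo f.left f.right \ {f.crit} ∧ f.map w = t := by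
  rcases lt_or_ge t (f.map f.right) with h | h
  · obtain ⟨w, hw, e⟩ := hf.exists_right_preimage ht.1 h
    exact ⟨w, ⟨⟨hf.left_lt.trans hw.1, hw.2⟩, hw.1.ne'⟩, e⟩
  · obtain ⟨w, hw, e⟩ := hf.exists_left_preimage (hf.overlap.trans_le h) ht.2
    exact ⟨w, ⟨⟨hw.1, hw.2.trans hf.lt_right⟩, hw.2.ne⟩, e⟩

/-- A nonempty closed set which is invariant in both directions is completely invariant. -/
lemma IsPL.isProperCompletelyInvariant (hf : f.IsPL a b) (h1 : E.Nonempty) (h2 : IsClosed E)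
    (h3 : E ⊆ Ioo f.left f.right \ {f.crit}) (h4 : ∀ z ∈ E, f.map z ∈ E)
    (h5 : ∀ z ∈ Ioo f.left f.right, z ≠ f.crit → f.map z ∈ E → z ∈ E) :
    f.IsProperCompletelyInvariant E where
  nonempty := h1
  isClosed := h2
  subset := h3
  image_eq := by
    ext t
    constructor
    · rintro ⟨z, hz, rfl⟩
      exact h4 z hz
    · intro ht
      obtain ⟨w, hw, e⟩ := hf.exists_preimage (h3 ht).1
      exact ⟨w, h5 w hw.1 hw.2 (e ▸ ht), e⟩
  preimage_eq := by
    ext z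
    exact ⟨fun hz => h5 z hz.1.1 hz.1.2 hz.2, fun hz => ⟨h3 hz, h4 z hz⟩⟩

/-- Nearby points share their itineraries for a while. -/
lemma IsPL.exists_sameItin (hf : f.IsPL a b) {n : ℕ} {v : ℝ} (hv : v ∈ Icc f.left f.right)
    (hc : ∀ i < n, f.map^[i] v ≠ f.crit) :
    ∃ ε > 0, ∀ z ∈ Icc f.left f.right, |z - v| < ε → f.SameItin n v z := by
  induction n with
  | zero => exact ⟨1, one_pos, fun _ _ _ => sameItin_zero⟩
  | succ n ih =>
    obtain ⟨ε, hε, h⟩ := ih fun i hi => hc i (by omega)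
    have hS := hf.iterSlope_pos n v
    have hd : 0 < |f.map^[n] v - f.crit| := abs_pos.2 (sub_ne_zero.2 (hc n (by omega)))
    refine ⟨min ε (|f.map^[n] v - f.crit| / f.iterSlope a b n v), lt_min hε (div_pos hd hS),
      fun z hz hzv => ?_⟩
    have hit := h z hz (hzv.trans_le (min_le_left _ _))
    refine sameItin_add.2 ⟨hit, sameItin_one.2 ?_⟩
    have e := hf.iter_sub hv hz hit
    have h1 : |f.map^[n] z - f.map^[n] v| < |f.map^[n] v - f.crit| := by
      rw [e, abs_mul, abs_of_pos hS]
      have := hzv.trans_le (min_le_right _ _)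
      rwa [lt_div_iff₀ hS, mul_comm] at this
    rcases lt_or_gt_of_ne (hc n (by omega)) with h2 | h2
    · rw [abs_of_neg (sub_neg.2 h2), abs_lt] at h1
      exact Or.inl ⟨h2, by linarith⟩
    · rw [abs_of_pos (sub_pos.2 h2), abs_lt] at h1
      exact Or.inr ⟨h2, by linarith⟩

lemma iterate_to_start {z : ℝ} {n : ℕ} (hn : 0 < n) (h : f.map^[n] z = z) (i : ℕ) :
    f.map^[n * i - i] (f.map^[i] z) = z := by
  rw [← Function.iterate_add_apply, Nat.sub_add_cancel (Nat.le_mul_of_pos_left i hn)]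
  exact Function.IsPeriodicPt.mul_const (f := f.map) h i

/-- The orbit of `x` consists of isolated points of `E`. -/
lemma Frame.isolated (h : f.Frame E e₀ e₁ x y) (hE : f.IsProperCompletelyInvariant E)
    (hf : f.IsPL a b) (hl : f.LeftReturn a b x ℓ) (hr : f.RightReturn a b y r) (i : ℕ) :
    ∃ ε > 0, ∀ z ∈ E, |z - f.map^[i] x| < ε → z = f.map^[i] x := by
  obtain ⟨j, hj⟩ := h.least_mem_orbit hE hf hl hr
  have hv : f.map^[i] x ∈ E := hE.iter_mem h.left.1.1 i
  have hx := iterate_to_start (f := f) hl.pos hl.per i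
  set v := f.map^[i] x
  -- One iterate takes the orbit point to min E, another to max E. Nearby points of E follow both
  -- monotonically, so they can lie neither below nor above it.
  have n0 : f.map^[j + (ℓ * i - i)] v = e₀ := by rw [Function.iterate_add_apply, hx, hj]
  have n1 : f.map^[1 + (ℓ * i - i)] v = e₁ := by
    rw [Function.iterate_add_apply, hx, Function.iterate_one, h.map_x]
  obtain ⟨ε₀, hε₀, g0⟩ := hf.exists_sameItin (n := j + (ℓ * i - i)) (hE.mem_Icc hv)
    fun i _ => hE.iter_ne hv i
  obtain ⟨ε₁, hε₁, g1⟩ := hf.exists_sameItin (n := 1 + (ℓ * i - i)) (hE.mem_Icc hv)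
    fun i _ => hE.iter_ne hv i
  refine ⟨min ε₀ ε₁, lt_min hε₀ hε₁, fun z hz hzv => ?_⟩
  have s0 := g0 z (hE.mem_Icc hz) (hzv.trans_le (min_le_left _ _))
  have s1 := g1 z (hE.mem_Icc hz) (hzv.trans_le (min_le_right _ _))
  refine le_antisymm ?_ ?_
  · rw [← hf.iter_le (hE.mem_Icc hz) (hE.mem_Icc hv) s1.symm, n1]
    exact h.greatest.2 (hE.iter_mem hz _)
  · rw [← hf.iter_le (hE.mem_Icc hv) (hE.mem_Icc hz) s0, n0]
    exact h.least.2 (hE.iter_mem hz _)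

lemma Frame.isolated_preimage (h : f.Frame E e₀ e₁ x y) (hE : f.IsProperCompletelyInvariant E)
    (hf : f.IsPL a b) (hl : f.LeftReturn a b x ℓ) (hr : f.RightReturn a b y r) {v : ℝ}
    (hv : v ∈ E) {n i : ℕ} (hvx : f.map^[n] v = f.map^[i] x) :
    ∃ ε > 0, ∀ z ∈ E, |z - v| < ε → z = v := by
  obtain ⟨ε₀, hε₀, g0⟩ := hf.exists_sameItin (n := n) (hE.mem_Icc hv) fun i _ => hE.iter_ne hv i
  obtain ⟨ε₁, hε₁, g1⟩ := h.isolated hE hf hl hr i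
  have hS := hf.iterSlope_pos n v
  refine ⟨min ε₀ (ε₁ / f.iterSlope a b n v), lt_min hε₀ (div_pos hε₁ hS), fun z hz hzv => ?_⟩
  have s0 := g0 z (hE.mem_Icc hz) (hzv.trans_le (min_le_left _ _))
  refine (hf.iter_inj (hE.mem_Icc hv) (hE.mem_Icc hz) s0 ?_).symm
  rw [hvx]
  refine (g1 _ (hE.iter_mem hz n) ?_).symm
  rw [← hvx, hf.iter_sub (hE.mem_Icc hv) (hE.mem_Icc hz) s0, abs_mul, abs_of_pos hS, mul_comm,
    ← lt_div_iff₀ hS]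
  exact hzv.trans_le (min_le_right _ _)

/-- A completely invariant set without smaller completely invariant sets is a periodic orbit. -/
theorem Frame.eq_orbit_of_minimal (h : f.Frame E e₀ e₁ x y)
    (hE : f.IsProperCompletelyInvariant E) (hf : f.IsPL a b) (hl : f.LeftReturn a b x ℓ)
    (hr : f.RightReturn a b y r)
    (hmin : ∀ E', f.IsProperCompletelyInvariant E' → E' ⊆ E → E ⊆ E') :
    E = range fun i : ℕ => f.map^[i] x := by
  have hxE := h.left.1.1
  have hall : ∀ z ∈ E, ∃ n i : ℕ, f.map^[n] z = f.map^[i] x := by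
    by_contra hcon
    push Not at hcon
    obtain ⟨z₀, hz₀, hz₀'⟩ := hcon
    -- The points of E that never land on the orbit of x. This set is closed because the preimages
    -- of that orbit are isolated in E, and it omits x, contradicting minimality.
    have hE' : f.IsProperCompletelyInvariant {z ∈ E | ∀ n i : ℕ, f.map^[n] z ≠ f.map^[i] x} := by
      refine hf.isProperCompletelyInvariant ⟨z₀, hz₀, hz₀'⟩ ?_ ?_ ?_ ?_
      · refine isClosed_of_closure_subset fun z hz => ?_
        have hzE : z ∈ E := closure_minimal (fun _ hw => hw.1) hE.isClosed hz
        refine ⟨hzE, fun n i hni => ?_⟩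
        obtain ⟨ε, hε, g⟩ := h.isolated_preimage hE hf hl hr hzE hni
        obtain ⟨w, hw, hwz⟩ := Metric.mem_closure_iff.1 hz ε hε
        rw [dist_comm, Real.dist_eq] at hwz
        obtain rfl := g w hw.1 hwz
        exact hw.2 n i hni
      · exact fun z hz => hE.subset hz.1
      · refine fun z hz => ⟨hE.map_mem hz.1, fun n i => ?_⟩
        rw [← Function.iterate_succ_apply]
        exact hz.2 _ i
      · refine fun z hz hzc hfz => ⟨hE.mem_of_map hz hzc hfz.1, fun n i hni => ?_⟩
        refine hfz.2 n (i + 1) ?_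
        rw [← Function.iterate_succ_apply, Function.iterate_succ_apply', hni,
          ← Function.iterate_succ_apply' f.map]
    exact (hmin _ hE' (fun z hz => hz.1) hxE).2 0 0 rfl
  have hfin : E.Finite := by
    refine hE.isCompact.finite (isDiscrete_iff_forall_mem_exists_isOpen.2 fun v hv => ?_)
    obtain ⟨n, i, hni⟩ := hall v hv
    obtain ⟨ε, hε, g⟩ := h.isolated_preimage hE hf hl hr hv hni
    refine ⟨Metric.ball v ε, Metric.isOpen_ball, ?_⟩
    ext z
    constructor
    · rintro ⟨h1, h2⟩
      rw [Metric.mem_ball, Real.dist_eq] at h1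
      exact g z h2 h1
    · rintro rfl
      exact ⟨Metric.mem_ball_self hε, hv⟩
  -- E is finite and f maps it onto itself; a bijection has no strictly preperiodic points.
  have hinj : InjOn f.map E := by
    refine injOn_of_ncard_image_eq ?_ hfin
    rw [hE.image_eq]
  have hinj' : ∀ n : ℕ, ∀ z ∈ E, ∀ w ∈ E, f.map^[n] z = f.map^[n] w → z = w := by
    intro n
    induction n with
    | zero => exact fun z _ w _ e => e
    | succ n ih =>
      intro z hz w hw e
      rw [Function.iterate_succ_apply', Function.iterate_succ_apply'] at e
      exact ih z hz w hw (hinj (hE.iter_mem hz n) (hE.iter_mem hw n) e)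
  ext z
  constructor
  · intro hz
    obtain ⟨n, i, hni⟩ := hall z hz
    refine ⟨(ℓ * n - n) + i, hinj' n _ (hE.iter_mem hxE _) z hz ?_⟩
    have := iterate_to_start (f := f) hl.pos hl.per n
    have e : f.map^[n] (f.map^[ℓ * n - n + i] x) = f.map^[i] (f.map^[ℓ * n - n] (f.map^[n] x)) := by
      rw [← Function.iterate_add_apply, ← Function.iterate_add_apply,
        ← Function.iterate_add_apply]
      congr 1
      ring
    rw [hni, e, this]
  · rintro ⟨i, rfl⟩
    exact hE.iter_mem hxE i

/-- A completely invariant set which is a single periodic orbit. -/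
structure IsCore (f : LorenzData) (a b : ℝ) (X : Set ℝ) (e₀ e₁ x y : ℝ) (ℓ r : ℕ) : Prop where
  inv : f.IsProperCompletelyInvariant X
  frame : f.Frame X e₀ e₁ x y
  leftReturn : f.LeftReturn a b x ℓ
  rightReturn : f.RightReturn a b y r
  eq_orbit : X = range fun i : ℕ => f.map^[i] x

/-- Zorn's lemma: intersections of chains are nonempty by compactness, and they remain completely
invariant because surjectivity on E follows from two-sided invariance. -/
lemma IsPL.exists_minimal (hf : f.IsPL a b) (hE : f.IsProperCompletelyInvariant E) :
    ∃ X ⊆ E, f.IsProperCompletelyInvariant X ∧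
      ∀ E', f.IsProperCompletelyInvariant E' → E' ⊆ X → X ⊆ E' := by
  obtain ⟨X, hXE, hX⟩ := zorn_superset_nonempty {S | f.IsProperCompletelyInvariant S} (by
    intro C hC hchain hne
    have hCi : ∀ S ∈ C, f.IsProperCompletelyInvariant S := fun S hS => hC hS
    obtain ⟨S₀, hS₀⟩ := hne
    refine ⟨⋂₀ C, hf.isProperCompletelyInvariant ?_ ?_ ?_ ?_ ?_, fun S hS => sInter_subset_of_mem hS⟩
    · have : Nonempty C := ⟨⟨S₀, hS₀⟩⟩
      refine IsCompact.nonempty_sInter_of_directed_nonempty_isCompact_isClosed ?_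
        (fun S hS => (hCi S hS).nonempty) (fun S hS => (hCi S hS).isCompact)
        fun S hS => (hCi S hS).isClosed
      intro S hS T hT
      rcases hchain.total hS hT with h | h
      · exact ⟨S, hS, subset_rfl, h⟩
      · exact ⟨T, hT, h, subset_rfl⟩
    · exact isClosed_sInter fun S hS => (hCi S hS).isClosed
    · exact fun z hz => (hCi S₀ hS₀).subset (hz S₀ hS₀)
    · exact fun z hz S hS => (hCi S hS).map_mem (hz S hS)
    · exact fun z hz hzc hfz S hS => (hCi S hS).mem_of_map hz hzc (hfz S hS)) E hE
  exact ⟨X, hXE, hX.prop, fun E' h1 h2 => hX.le_of_le h1 h2⟩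

lemma IsPL.exists_core (hf : f.IsPL a b) (hE : f.IsProperCompletelyInvariant E) :
    ∃ X e₀ e₁ x y ℓ r, X ⊆ E ∧ f.IsCore a b X e₀ e₁ x y ℓ r := by
  obtain ⟨X, hXE, hX, hmin⟩ := hf.exists_minimal hE
  obtain ⟨e₀, e₁, x, y, h⟩ := hX.exists_frame hf
  obtain ⟨ℓ, hl⟩ := h.exists_leftReturn hX hf
  obtain ⟨r, hr⟩ := h.exists_rightReturn hX hf
  exact ⟨X, e₀, e₁, x, y, ℓ, r, hXE, hX, h, hl, hr, h.eq_orbit_of_minimal hX hf hl hr hmin⟩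

/-- A point in a gap of `E` visits the gap around the discontinuity. -/
lemma Frame.exists_iterate_mem_gap (h : f.Frame E e₀ e₁ x y)
    (hE : f.IsProperCompletelyInvariant E) (hf : f.IsPL a b) {z : ℝ} (h0 : e₀ < z) (h1 : z < e₁)
    (hz : z ∉ E) : ∃ n, f.map^[n] z ∈ Ioo x y := by
  by_contra hcon
  push Not at hcon
  obtain ⟨g, hg⟩ := (hE.isCompact.inter_right (isClosed_Iic (a := z))).exists_isGreatest
    ⟨e₀, h.least.1, h0.le⟩
  obtain ⟨g', hg'⟩ := (hE.isCompact.inter_right (isClosed_Ici (a := z))).exists_isLeast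
    ⟨e₁, h.greatest.1, h1.le⟩
  have hgz : g < z := lt_of_le_of_ne hg.1.2 fun e => hz (e ▸ hg.1.1)
  have hgz' : z < g' := lt_of_le_of_ne hg'.1.2 fun e => hz (e ▸ hg'.1.1)
  have hgI := hE.mem_Icc hg.1.1
  have hgI' := hE.mem_Icc hg'.1.1
  have hzI : z ∈ Icc f.left f.right := ⟨hgI.1.trans hgz.le, hgz'.le.trans hgI'.2⟩
  have gap : ∀ w ∈ Ioo g g', w ∉ E := by
    intro w hw hwE
    rcases le_total w z with h2 | h2
    · exact absurd (hg.2 ⟨hwE, h2⟩) (not_le.2 hw.1)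
    · exact absurd (hg'.2 ⟨hwE, h2⟩) (not_le.2 hw.2)
  -- The ends g, g' of the gap containing z would never be separated: at a separating time the image
  -- of the gap would have to contain x or y, whose pullback is a point of E inside the gap.
  refine hf.isGood.1 g hgI g' hgI' (hgz.trans hgz') fun n => ?_
  induction n with
  | zero => exact sameItin_zero
  | succ n ih =>
    refine sameItin_add.2 ⟨ih, sameItin_one.2 ?_⟩
    by_contra hside
    have hlt := (hf.iter_lt hgI hgI' ih).2 (hgz.trans hgz')
    obtain ⟨k1, k2⟩ := not_sameSide hlt.le hside
    have k3 : f.map^[n] g ≤ x :=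
      h.left.2 ⟨hE.iter_mem hg.1.1 n, lt_of_le_of_ne k1 (hE.iter_ne hg.1.1 n)⟩
    have k4 : y ≤ f.map^[n] g' :=
      h.right.2 ⟨hE.iter_mem hg'.1.1 n, lt_of_le_of_ne k2 (hE.iter_ne hg'.1.1 n).symm⟩
    obtain ⟨b1, b2⟩ := hf.between hgI hgI' hgz.le hgz'.le ih
    have z1 := (hf.iter_lt hgI hzI b1).2 hgz
    have z2 := (hf.iter_lt hzI hgI' b2).2 hgz'
    have hS := hf.iterSlope_pos n g
    have pull : ∀ t ∈ E, f.map^[n] g < t → t < f.map^[n] g' → False := by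
      intro t ht t1 t2
      set w := g + (t - f.map^[n] g) / f.iterSlope a b n g with hw
      have e := hf.iter_sub hgI hgI' ih
      have w1 : g < w := by
        have : 0 < (t - f.map^[n] g) / f.iterSlope a b n g := div_pos (by linarith) hS
        linarith
      have w2 : w < g' := by
        have : (t - f.map^[n] g) / f.iterSlope a b n g < g' - g := by
          rw [div_lt_iff₀ hS]
          linarith
        linarith
      have hwI : w ∈ Ioo f.left f.right :=
        ⟨(hE.mem_Ioo hg.1.1).1.trans w1, w2.trans (hE.mem_Ioo hg'.1.1).2⟩
      obtain ⟨c1, c2⟩ := hf.between hgI hgI' w1.le w2.le ih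
      have e' := hf.iter_sub hgI (Ioo_subset_Icc_self hwI) c1
      rw [hw, add_sub_cancel_left, mul_div_cancel₀ _ hS.ne', ← hw] at e'
      have e'' : f.map^[n] w = t := by linarith
      exact gap w ⟨w1, w2⟩ (hE.mem_of_iter hf hwI c1.symm.ne (e'' ▸ ht))
    have hxc : x < f.crit := h.left.1.2
    have hyc : f.crit < y := h.right.1.2
    rcases le_or_gt (f.map^[n] z) x with h2 | h2
    · exact pull x h.left.1.1 (by linarith) (by linarith)
    · have h3 : y ≤ f.map^[n] z := by
        by_contra h4
        push Not at h4
        exact hcon n ⟨h2, h4⟩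
      exact pull y h.right.1.1 (by linarith) (by linarith)

lemma Frame.le_or_ge (h : f.Frame E e₀ e₁ x y) (hE : f.IsProperCompletelyInvariant E) {z : ℝ}
    (hz : z ∈ E) : z ≤ x ∨ y ≤ z := by
  rcases lt_or_gt_of_ne (hE.ne_crit hz) with h1 | h1
  · exact Or.inl (h.left.2 ⟨hz, h1⟩)
  · exact Or.inr (h.right.2 ⟨hz, h1⟩)

lemma range_orbit_eq {z : ℝ} {n : ℕ} (hn : 0 < n) (h : f.map^[n] z = z) (i : ℕ) :
    (range fun j : ℕ => f.map^[j] (f.map^[i] z)) = range fun j : ℕ => f.map^[j] z := by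
  ext w
  constructor
  · rintro ⟨j, rfl⟩
    exact ⟨j + i, Function.iterate_add_apply _ _ _ _⟩
  · rintro ⟨j, rfl⟩
    refine ⟨j + (n * i - i), ?_⟩
    simp only [Function.iterate_add_apply]
    rw [iterate_to_start hn h]

/-! ### Uniqueness of the core. -/

section Core

variable {X X' : Set ℝ} {e₀' e₁' x' y' : ℝ} {ℓ' r' : ℕ}

lemma IsCore.eq_range (h : f.IsCore a b X e₀ e₁ x y ℓ r) {v : ℝ} (hv : v ∈ X) :
    X = range fun i : ℕ => f.map^[i] v := by
  rw [h.eq_orbit] at hv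
  obtain ⟨i, rfl⟩ := hv
  rw [range_orbit_eq h.leftReturn.pos h.leftReturn.per]
  exact h.eq_orbit

/-- Distinct cores are disjoint orbits. If the gaps are shifted (x < x', y < y'), applying f^r' to y
pushes it away from y' to a point of X inside (x, y). If they are nested, the orbit of x enters the
gap (x', y') ⊆ (x, y) of its own orbit. Both are absurd. -/
lemma IsCore.not_lt (hf : f.IsPL a b) (h : f.IsCore a b X e₀ e₁ x y ℓ r)
    (h' : f.IsCore a b X' e₀' e₁' x' y' ℓ' r') (hne : X ≠ X') : ¬ x < x' := by
  intro hlt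
  have hdisj : ∀ v ∈ X, v ∉ X' := fun v h1 h2 =>
    hne ((h.eq_range h1).trans (h'.eq_range h2).symm)
  have hx := h.frame.left.1
  have hy := h.frame.right.1
  have hx' := h'.frame.left.1
  have hy' := h'.frame.right.1
  have hxc : x < f.crit := hx.2
  have hyc : f.crit < y := hy.2
  have hxc' : x' < f.crit := hx'.2
  have hyc' : f.crit < y' := hy'.2
  rcases lt_or_ge y y' with hyy | hyy
  · have hr := h'.rightReturn
    have hit := hr.itin y ⟨hyc, hyy.le⟩
    have e := hf.iter_sub (h'.inv.mem_Icc hy'.1) (h.inv.mem_Icc hy.1) hit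
    rw [hr.per] at e
    have hB := hr.one_lt hyc'
    have hb := h'.frame.right_bound h'.inv hf hr
    have hS : f.iterSlope a b r' y' * (y' - y) < f.iterSlope a b r' y' * (y' - f.crit) :=
      mul_lt_mul_of_pos_left (by linarith) (by linarith)
    have hS' : y' - y < f.iterSlope a b r' y' * (y' - y) := by nlinarith
    rcases h.frame.le_or_ge h.inv (h.inv.iter_mem hy.1 r') with h1 | h1
    · linarith
    · linarith
  · have hyy' : y' < y := lt_of_le_of_ne hyy fun e => hdisj y hy.1 (e ▸ hy'.1)
    have h0 : e₀' < x := by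
      have h1 : e₀' < e₀ := by
        rw [← h'.frame.map_y, ← h.frame.map_y]
        exact (hf.iter_lt (n := 1) (h'.inv.mem_Icc hy'.1) (h.inv.mem_Icc hy.1)
          (sameItin_one.2 (Or.inr ⟨hyc', hyc⟩))).2 hyy'
      exact h1.trans_le (h.frame.least.2 hx.1)
    have h1 : x < e₁' := hlt.trans_le (h'.frame.greatest.2 hx'.1)
    obtain ⟨n, hn⟩ := h'.frame.exists_iterate_mem_gap h'.inv hf h0 h1 (hdisj x hx.1)
    rcases h.frame.le_or_ge h.inv (h.inv.iter_mem hx.1 n) with h2 | h2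
    · linarith [hn.1]
    · linarith [hn.2]

theorem IsCore.unique (hf : f.IsPL a b) (h : f.IsCore a b X e₀ e₁ x y ℓ r)
    (h' : f.IsCore a b X' e₀' e₁' x' y' ℓ' r') : X = X' := by
  by_contra hne
  rcases lt_trichotomy x x' with h1 | h1 | h1
  · exact h.not_lt hf h' hne h1
  · exact hne (by rw [h.eq_orbit, h'.eq_orbit, h1])
  · exact h'.not_lt hf h (Ne.symm hne) h1

theorem IsCore.subset (hf : f.IsPL a b) (h : f.IsCore a b X e₀ e₁ x y ℓ r)
    (hE : f.IsProperCompletelyInvariant E) : X ⊆ E := by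
  obtain ⟨X', e₀', e₁', x', y', ℓ', r', hsub, h'⟩ := hf.exists_core hE
  rw [h.unique hf h']
  exact hsub

theorem IsCore.isMinimal (hf : f.IsPL a b) (h : f.IsCore a b X e₀ e₁ x y ℓ r) :
    f.IsMinimalCompletelyInvariant X := by
  refine ⟨Or.inr h.inv, ?_⟩
  rintro E (rfl | hE)
  · exact fun z hz => h.inv.mem_Icc hz
  · exact h.subset hf hE

end Core

/-! ### Orbits of minimal period -/

/-- A period equal to ℓ is excluded by expansion away from x. For n < ℓ, the iterate of x lies below
the iterate w of w and is not x, hence falls below x; then the image of (x, crit) under f^n contains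
x, a point of E. -/
lemma Frame.lt_period (h : f.Frame E e₀ e₁ x y) (hE : f.IsProperCompletelyInvariant E)
    (hf : f.IsPL a b) (hl : f.LeftReturn a b x ℓ) {w : ℝ} (hw : w ∈ Ioo x f.crit) {n : ℕ}
    (hn : 0 < n) (hper : f.map^[n] w = w) : ℓ < n := by
  have hxE := h.left.1.1
  have hwI : w ∈ Icc f.left f.right :=
    ⟨(hE.mem_Icc hxE).1.trans hw.1.le, (hw.2.trans hf.lt_right).le⟩
  have hyc : f.crit < y := h.right.1.2
  by_contra hcon
  push Not at hcon
  have hit : ∀ z ∈ Ico x f.crit, f.SameItin n x z := fun z hz => (hl.itin z hz).mono hcon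
  have e := hf.iter_sub (hE.mem_Icc hxE) hwI (hit w ⟨hw.1.le, hw.2⟩)
  rw [hper] at e
  have hS := hf.iterSlope_pos n x
  have hpos : 0 < f.iterSlope a b n x * (w - x) := mul_pos hS (by linarith [hw.1])
  rcases hcon.eq_or_lt with h1 | h1
  · subst h1
    rw [hl.per] at e
    have := hl.one_lt h.left.1.2
    nlinarith [hw.1]
  · have hne := hl.ne n hn h1
    have hlt : f.map^[n] x < w := by linarith
    have hle : f.map^[n] x < x := by
      rcases h.le_or_ge hE (hE.iter_mem hxE n) with h2 | h2
      · exact lt_of_le_of_ne h2 hne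
      · linarith [hw.2]
    refine h.not_mem_of_mem_Ioo hE hf hit (t := x) ⟨hle, ?_⟩ hxE
    have : f.iterSlope a b n x * (w - x) < f.iterSlope a b n x * (f.crit - x) :=
      mul_lt_mul_of_pos_left (by linarith [hw.2]) hS
    linarith [hw.1]

/-- The predecessor of the least point of the orbit is on the right, since f moves points up on the
left branch. Its image is below e₀ = f(y), so it lies in (crit, y). -/
lemma Frame.exists_mem_gap_of_lt (h : f.Frame E e₀ e₁ x y) (hE : f.IsProperCompletelyInvariant E)
    (hf : f.IsPL a b) {z : ℝ} (hz : z ∈ Icc f.left f.right) (hc : ∀ i, f.map^[i] z ≠ f.crit)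
    {n : ℕ} (hn : 0 < n) (hper : f.map^[n] z = z) {i : ℕ} (hi : f.map^[i] z < e₀) :
    ∃ k, f.map^[k] z ∈ Ioo x y := by
  obtain ⟨m, hm⟩ : ∃ m, ∀ k, f.map^[m] z ≤ f.map^[k] z := by
    obtain ⟨_, ⟨m, rfl⟩, hm⟩ := exists_min_image _ id (finite_orbit hn hper) ⟨z, 0, rfl⟩
    exact ⟨m, fun k => hm _ ⟨k, rfl⟩⟩
  have hme := (hm i).trans_lt hi
  set w := f.map^[m + (n - 1)] z with hw
  have hfw : f.map w = f.map^[m] z := by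
    rw [hw, ← Function.iterate_succ_apply' f.map, show (m + (n - 1)).succ = m + n by omega,
      Function.iterate_add_apply, hper]
  have hwI : w ∈ Icc f.left f.right := hf.iter_mem hz fun i _ => hc i
  have hxc : x < f.crit := h.left.1.2
  have hwc : f.crit < w := by
    by_contra hcon
    have h1 : w < f.crit := lt_of_le_of_ne (not_lt.1 hcon) (hc _)
    have h2 : f.left < f.map f.left :=
      (hE.mem_Ioo h.least.1).1.trans_le (hE.least_le hf h.least)
    have h3 := hf.lt_map h2 hwI.1 h1
    rw [hfw] at h3
    exact absurd (hm _) (not_le.2 h3)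
  refine ⟨m + (n - 1), hxc.trans hwc, ?_⟩
  rw [← hw, ← hf.iter_lt (n := 1) hwI (hE.mem_Icc h.right.1.1)
    (sameItin_one.2 (Or.inr ⟨hwc, h.right.1.2⟩)), Function.iterate_one, hfw, h.map_y]
  exact hme

section Core

variable {X : Set ℝ}

lemma IsCore.isPeriodicPoint (h : f.IsCore a b X e₀ e₁ x y ℓ r) {v : ℝ} (hv : v ∈ X) :
    f.IsPeriodicPoint v := by
  refine ⟨h.inv.mem_Icc hv, fun i => h.inv.iter_ne hv i, ?_⟩
  rw [h.eq_orbit] at hv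
  obtain ⟨i, rfl⟩ := hv
  exact ⟨ℓ, h.leftReturn.pos, iterate_periodic h.leftReturn.per i⟩

/-- The core is the only orbit of minimal period. -/
theorem IsCore.eq_of_isMinPeriodOrbit (hf : f.IsPL a b) (h : f.IsCore a b X e₀ e₁ x y ℓ r)
    {O : Set ℝ} (hO : f.IsMinPeriodOrbit O) : O = X := by
  obtain ⟨z, ⟨hzI, hzc, hzp⟩, rfl, hmin⟩ := hO
  set n := Function.minimalPeriod f.map z with hn
  have hn0 : 0 < n := Function.minimalPeriod_pos_of_mem_periodicPts hzp
  have hper : f.map^[n] z = z := Function.iterate_minimalPeriod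
  by_cases hex : ∃ i, f.map^[i] z ∈ X
  · obtain ⟨i, hi⟩ := hex
    rw [h.eq_range hi, range_orbit_eq hn0 hper]
  · exfalso
    push Not at hex
    have hgap : ∃ k, f.map^[k] z ∈ Ioo x y := by
      by_cases h1 : ∃ i, f.map^[i] z < e₀
      · obtain ⟨i, hi⟩ := h1
        exact h.frame.exists_mem_gap_of_lt h.inv hf hzI hzc hn0 hper hi
      by_cases h2 : ∃ i, e₁ < f.map^[i] z
      · obtain ⟨i, hi⟩ := h2
        obtain ⟨k, hk⟩ := h.frame.reflect.exists_mem_gap_of_lt h.inv.reflect hf.reflect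
          (z := -z) (reflect_mem_Icc.2 hzI)
          (fun i hi => hzc i (by rw [reflect_iterate] at hi; exact neg_injective hi)) hn0
          (by rw [reflect_iterate, hper]) (i := i) (by rw [reflect_iterate]; linarith)
        refine ⟨k, ?_⟩
        rw [reflect_iterate] at hk
        exact ⟨by linarith [hk.2], by linarith [hk.1]⟩
      push Not at h1 h2
      have hz0 : z ∉ X := hex 0
      exact h.frame.exists_iterate_mem_gap h.inv hf
        (lt_of_le_of_ne (h1 0) fun e => hz0 (e ▸ h.frame.least.1))
        (lt_of_le_of_ne (h2 0) fun e => hz0 (e ▸ h.frame.greatest.1)) hz0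
    obtain ⟨k, hk⟩ := hgap
    have hperk := iterate_periodic hper k
    rcases lt_or_gt_of_ne (hzc k) with h1 | h1
    · have h2 := h.frame.lt_period h.inv hf h.leftReturn ⟨hk.1, h1⟩ hn0 hperk
      have h3 := hmin x (h.isPeriodicPoint h.frame.left.1.1)
      have h4 : Function.minimalPeriod f.map x ≤ ℓ :=
        Function.IsPeriodicPt.minimalPeriod_le h.leftReturn.pos h.leftReturn.per
      omega
    · have h2 := h.frame.reflect.lt_period h.inv.reflect hf.reflect h.rightReturn.reflect
        (w := -f.map^[k] z) ⟨by linarith [hk.2], neg_lt_neg h1⟩ hn0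
        (by rw [reflect_iterate, hperk])
      have h3 := hmin y (h.isPeriodicPoint h.frame.right.1.1)
      have h4 : Function.minimalPeriod f.map y ≤ r :=
        Function.IsPeriodicPt.minimalPeriod_le h.rightReturn.pos h.rightReturn.per
      omega

end Core

end LorenzData

namespace LorenzData

variable {f : LorenzData} {a b : ℝ} {E X : Set ℝ} {e₀ e₁ x y : ℝ} {ℓ r : ℕ}

/-! ### Preimages of a periodic orbit -/

/-- The union of the iterated preimages of `O`. -/
def preimages (f : LorenzData) (O : Set ℝ) : Set ℝ :=
  {x | x ∈ Ioo f.left f.right ∧ ∃ n : ℕ, (∀ i < n, f.map^[i] x ≠ f.crit) ∧ f.map^[n] x ∈ O}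

lemma preimageClosure_eq (O : Set ℝ) : f.preimageClosure O = closure (f.preimages O) := rfl

lemma IsCore.preimageClosure_eq (hf : f.IsPL a b) (h : f.IsCore a b X e₀ e₁ x y ℓ r) :
    f.preimageClosure X = X := by
  have : f.preimages X = X := by
    ext z
    constructor
    · rintro ⟨h1, n, h2, h3⟩
      exact h.inv.mem_of_iter hf h1 h2 h3
    · exact fun hz => ⟨h.inv.mem_Ioo hz, 0, fun i hi => absurd hi (by omega), hz⟩
  rw [LorenzData.preimageClosure_eq, this, h.inv.isClosed.closure_eq]

lemma mem_preimages_of_iter {O : Set ℝ} {n : ℕ} {w : ℝ} (hw : w ∈ Ioo f.left f.right)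
    (hc : ∀ i < n, f.map^[i] w ≠ f.crit) (h : f.map^[n] w ∈ f.preimages O) :
    w ∈ f.preimages O := by
  obtain ⟨-, m, h1, h2⟩ := h
  refine ⟨hw, m + n, fun i hi => ?_, by rwa [Function.iterate_add_apply]⟩
  rcases Nat.lt_or_ge i n with h3 | h3
  · exact hc i h3
  · have := h1 (i - n) (by omega)
    rwa [← Function.iterate_add_apply, Nat.sub_add_cancel h3] at this

/-- Local inverses of iterates. -/
lemma IsPL.exists_local_inverse (hf : f.IsPL a b) {n : ℕ} {z ε : ℝ} (hz : z ∈ Ioo f.left f.right)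
    (hc : ∀ i < n, f.map^[i] z ≠ f.crit) (hε : 0 < ε) :
    ∃ η > 0, ∀ t, |t - f.map^[n] z| < η →
      ∃ w ∈ Ioo f.left f.right, |w - z| < ε ∧ f.SameItin n z w ∧ f.map^[n] w = t := by
  obtain ⟨δ, hδ, g⟩ := hf.exists_sameItin (Ioo_subset_Icc_self hz) hc
  have hS := hf.iterSlope_pos n z
  set ρ := min (min ε δ) (min (z - f.left) (f.right - z)) with hρ
  have hρ0 : 0 < ρ := lt_min (lt_min hε hδ) (lt_min (sub_pos.2 hz.1) (sub_pos.2 hz.2))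
  refine ⟨f.iterSlope a b n z * ρ, mul_pos hS hρ0, fun t ht => ?_⟩
  have hw : |(z + (t - f.map^[n] z) / f.iterSlope a b n z) - z| < ρ := by
    rw [add_sub_cancel_left, abs_div, abs_of_pos hS, div_lt_iff₀ hS, mul_comm]
    exact ht
  have e : f.iterSlope a b n z * ((z + (t - f.map^[n] z) / f.iterSlope a b n z) - z) =
      t - f.map^[n] z := by
    rw [add_sub_cancel_left]
    exact mul_div_cancel₀ _ hS.ne'
  set w := z + (t - f.map^[n] z) / f.iterSlope a b n z
  have h1 : ρ ≤ ε := (min_le_left _ _).trans (min_le_left _ _)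
  have h2 : ρ ≤ δ := (min_le_left _ _).trans (min_le_right _ _)
  have h3 : ρ ≤ z - f.left := (min_le_right _ _).trans (min_le_left _ _)
  have h4 : ρ ≤ f.right - z := (min_le_right _ _).trans (min_le_right _ _)
  have h5 := abs_lt.1 hw
  have hwI : w ∈ Ioo f.left f.right := ⟨by linarith, by linarith⟩
  have hit := g w (Ioo_subset_Icc_self hwI) (hw.trans_le h2)
  have e' := hf.iter_sub (Ioo_subset_Icc_self hz) (Ioo_subset_Icc_self hwI) hit
  exact ⟨w, hwI, hw.trans_le h1, hit, by linarith⟩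

/-- If the discontinuity stays at a positive distance from the preimages, so do the end points: a
preimage near an end point would itself have a preimage near crit. Away from these three points f is
a local homeomorphism, and invariance passes to the closure. -/
lemma IsPL.closure_preimages_inv (hf : f.IsPL a b) {O : Set ℝ} (hO : ∀ z ∈ O, f.map z ∈ O)
    (hne : (f.preimages O).Nonempty) (hc : f.crit ∉ closure (f.preimages O)) :
    f.IsProperCompletelyInvariant (closure (f.preimages O)) := by
  have hcP : ∀ z ∈ f.preimages O, z ≠ f.crit := fun z hz e => hc (subset_closure (e ▸ hz))
  have hmap : ∀ z ∈ f.preimages O, f.map z ∈ f.preimages O := by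
    intro z hz
    obtain ⟨h1, n, h2, h3⟩ := id hz
    refine ⟨hf.map_mem_Ioo h1 (hcP z hz), ?_⟩
    rcases n with _ | n
    · exact ⟨0, fun i hi => absurd hi (by omega), hO z h3⟩
    · refine ⟨n, fun i hi => ?_, h3⟩
      have := h2 (i + 1) (by omega)
      rwa [Function.iterate_succ_apply] at this
  have hpre : ∀ w ∈ Ioo f.left f.right, w ≠ f.crit → f.map w ∈ f.preimages O →
      w ∈ f.preimages O := by
    intro w hw hwc h
    refine mem_preimages_of_iter (n := 1) hw (fun i hi => ?_) h
    obtain rfl : i = 0 := by omega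
    exact hwc
  obtain ⟨ε, hε, hball⟩ : ∃ ε > 0, ∀ z ∈ f.preimages O, ε ≤ |z - f.crit| := by
    rw [Metric.mem_closure_iff] at hc
    push Not at hc
    obtain ⟨ε, hε, h⟩ := hc
    refine ⟨ε, hε, fun z hz => ?_⟩
    have := h z hz
    rwa [dist_comm, Real.dist_eq] at this
  have hIcc : closure (f.preimages O) ⊆ Icc f.left f.right :=
    closure_minimal (fun z hz => Ioo_subset_Icc_self hz.1) isClosed_Icc
  have ha := hf.a_pos
  have hb := hf.b_pos
  have h0r : f.map f.left < f.right := hf.overlap.trans_le hf.le_right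
  have h1l : f.left < f.map f.right := hf.left_le.trans_lt hf.overlap
  have hleft : f.left ∉ closure (f.preimages O) := by
    intro hcl
    obtain ⟨z, hz, hzd⟩ := Metric.mem_closure_iff.1 hcl (min (b * ε) (f.map f.right - f.left))
      (lt_min (mul_pos hb hε) (sub_pos.2 h1l))
    have hzl := hz.1.1
    rw [dist_comm, Real.dist_eq, abs_of_pos (sub_pos.2 hzl)] at hzd
    have z1 := hzd.trans_le (min_le_left _ _)
    have z2 := hzd.trans_le (min_le_right _ _)
    obtain ⟨w, hw, e⟩ := hf.exists_right_preimage hzl (by linarith)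
    have hwI : w ∈ Ioo f.left f.right := ⟨hf.left_lt.trans hw.1, hw.2⟩
    have := hball w (hpre w hwI hw.1.ne' (e ▸ hz))
    rw [abs_of_pos (sub_pos.2 hw.1)] at this
    rw [hf.map_right w hw.1 hw.2.le] at e
    have h3 : b * (w - f.crit) < b * ε := by linarith
    have := lt_of_mul_lt_mul_left h3 hb.le
    linarith
  have hright : f.right ∉ closure (f.preimages O) := by
    intro hcl
    obtain ⟨z, hz, hzd⟩ := Metric.mem_closure_iff.1 hcl (min (a * ε) (f.right - f.map f.left))
      (lt_min (mul_pos ha hε) (sub_pos.2 h0r))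
    have hzl := hz.1.2
    rw [Real.dist_eq, abs_of_pos (sub_pos.2 hzl)] at hzd
    have z1 := hzd.trans_le (min_le_left _ _)
    have z2 := hzd.trans_le (min_le_right _ _)
    obtain ⟨w, hw, e⟩ := hf.exists_left_preimage (by linarith) hzl
    have hwI : w ∈ Ioo f.left f.right := ⟨hw.1, hw.2.trans hf.lt_right⟩
    have := hball w (hpre w hwI hw.2.ne (e ▸ hz))
    rw [abs_of_neg (sub_neg.2 hw.2)] at this
    rw [hf.map_left w hw.1.le hw.2] at e
    have h3 : a * (f.crit - w) < a * ε := by linarith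
    have := lt_of_mul_lt_mul_left h3 ha.le
    linarith
  have hsub : closure (f.preimages O) ⊆ Ioo f.left f.right \ {f.crit} := by
    intro z hz
    have hzI := hIcc hz
    refine ⟨⟨lt_of_le_of_ne hzI.1 fun e => hleft (e ▸ hz),
      lt_of_le_of_ne hzI.2 fun e => hright (e ▸ hz)⟩, fun e => hc ?_⟩
    rw [mem_singleton_iff] at e
    exact e ▸ hz
  refine hf.isProperCompletelyInvariant (hne.mono subset_closure) isClosed_closure hsub ?_ ?_
  · intro z hz
    have hzI := hsub hz
    obtain ⟨δ, hδ, g⟩ := hf.exists_sameItin (n := 1) (Ioo_subset_Icc_self hzI.1) fun i hi => by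
      obtain rfl : i = 0 := by omega
      exact hzI.2
    rw [Metric.mem_closure_iff]
    intro ε' hε'
    have hS := hf.iterSlope_pos 1 z
    obtain ⟨w, hw, hwd⟩ := Metric.mem_closure_iff.1 hz (min δ (ε' / f.iterSlope a b 1 z))
      (lt_min hδ (div_pos hε' hS))
    rw [dist_comm, Real.dist_eq] at hwd
    refine ⟨f.map w, hmap w hw, ?_⟩
    have hwI := Ioo_subset_Icc_self hw.1
    have e := hf.iter_sub (Ioo_subset_Icc_self hzI.1) hwI (g w hwI (hwd.trans_le (min_le_left _ _)))
    rw [Function.iterate_one] at e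
    rw [dist_comm, Real.dist_eq, e, abs_mul, abs_of_pos hS, mul_comm, ← lt_div_iff₀ hS]
    exact hwd.trans_le (min_le_right _ _)
  · intro z hz hzc hfz
    rw [Metric.mem_closure_iff]
    intro ε' hε'
    obtain ⟨η, hη, g⟩ := hf.exists_local_inverse (n := 1) hz (fun i hi => by
      obtain rfl : i = 0 := by omega
      exact hzc) hε'
    obtain ⟨t, ht, htd⟩ := Metric.mem_closure_iff.1 hfz η hη
    rw [dist_comm, Real.dist_eq] at htd
    obtain ⟨w, hw, hwz, hit, e⟩ := g t htd
    refine ⟨w, mem_preimages_of_iter (n := 1) hw hit.symm.ne (e ▸ ht), ?_⟩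
    rwa [dist_comm, Real.dist_eq]

/-- If there is no proper completely invariant closed set, then preimages of orbits are dense. -/
theorem IsPL.preimageClosure_eq_Icc (hf : f.IsPL a b)
    (hno : ∀ E, ¬ f.IsProperCompletelyInvariant E) {O : Set ℝ} (hO : f.IsMinPeriodOrbit O)
    (hnt : O.Nontrivial) : f.preimageClosure O = Icc f.left f.right := by
  obtain ⟨z, ⟨hzI, hzc, -⟩, rfl, -⟩ := hO
  set O := range fun i : ℕ => f.map^[i] z with hOdef
  have hmap : ∀ w ∈ O, f.map w ∈ O := by
    rintro _ ⟨i, rfl⟩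
    exact ⟨i + 1, Function.iterate_succ_apply' _ _ _⟩
  -- Nontriviality of O is needed here: an orbit consisting of a fixed end point may have no
  -- preimages in the open interval, whereas a moving orbit has a point there.
  have hmoves : f.map z ≠ z := by
    intro e
    have : ∀ i : ℕ, f.map^[i] z = z := fun i => Function.iterate_fixed e i
    obtain ⟨_, ⟨i, rfl⟩, _, ⟨j, rfl⟩, hij⟩ := hnt
    exact hij (by simp only [this])
  have hne : (f.preimages O).Nonempty := by
    have key : ∀ w ∈ O, w ∈ Ioo f.left f.right → (f.preimages O).Nonempty := fun w hw hwI =>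
      ⟨w, hwI, 0, fun i hi => absurd hi (by omega), hw⟩
    rcases hzI.1.eq_or_lt with h1 | h1
    · refine key (f.map z) ⟨1, rfl⟩ ⟨lt_of_le_of_ne ?_ ?_, ?_⟩
      · rw [← h1]
        exact hf.left_le
      · rw [h1]
        exact hmoves.symm
      · rw [← h1]
        exact hf.overlap.trans_le hf.le_right
    rcases hzI.2.eq_or_lt with h2 | h2
    · refine key (f.map z) ⟨1, rfl⟩ ⟨?_, lt_of_le_of_ne ?_ ?_⟩
      · rw [h2]
        exact hf.left_le.trans_lt hf.overlap
      · rw [h2]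
        exact hf.le_right
      · rw [← h2]
        exact hmoves
    · exact key z ⟨0, rfl⟩ ⟨h1, h2⟩
  have hc : f.crit ∈ closure (f.preimages O) := by
    by_contra hcon
    exact hno _ (hf.closure_preimages_inv hmap hne hcon)
  rw [preimageClosure_eq]
  refine subset_antisymm
    (closure_minimal (fun z hz => Ioo_subset_Icc_self hz.1) isClosed_Icc) ?_
  have hlr : f.left < f.right := hf.left_lt.trans hf.lt_right
  rw [← closure_Ioo hlr.ne]
  refine closure_minimal (fun w hw => ?_) isClosed_closure
  rw [Metric.mem_closure_iff]
  intro ε hε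
  set w' := min (w + ε / 2) ((w + f.right) / 2) with hw'
  have hww' : w < w' := lt_min (by linarith) (by linarith [hw.2])
  have hwε : w' ≤ w + ε / 2 := min_le_left _ _
  have hwr : w' < f.right := (min_le_right _ _).trans_lt (by linarith [hw.2])
  have hwI := Ioo_subset_Icc_self hw
  have hwI' : w' ∈ Icc f.left f.right := ⟨hwI.1.trans hww'.le, hwr.le⟩
  have hex : ∃ n, ¬ f.SameSide (f.map^[n] w) (f.map^[n] w') := by
    by_contra hcon
    push Not at hcon
    exact hf.isGood.1 w hwI w' hwI' hww' fun n i _ => hcon i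
  classical
  obtain ⟨n, hn, hit⟩ : ∃ n, ¬ f.SameSide (f.map^[n] w) (f.map^[n] w') ∧ f.SameItin n w w' :=
    ⟨Nat.find hex, Nat.find_spec hex, fun i hi => not_not.1 (Nat.find_min hex hi)⟩
  obtain ⟨n1, n2⟩ := not_sameSide ((hf.iter_le hwI hwI' hit).2 hww'.le) hn
  have hS := hf.iterSlope_pos n w
  have e := hf.iter_sub hwI hwI' hit
  -- Points close together are eventually separated, so between w and w' there is a preimage u of
  -- crit; preimages of O near crit are pulled back to a neighbourhood of u.
  set u := w + (f.crit - f.map^[n] w) / f.iterSlope a b n w with hu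
  have u1 : w ≤ u := by
    have : 0 ≤ (f.crit - f.map^[n] w) / f.iterSlope a b n w := div_nonneg (by linarith) hS.le
    linarith
  have u2 : u ≤ w' := by
    have : (f.crit - f.map^[n] w) / f.iterSlope a b n w ≤ w' - w := by
      rw [div_le_iff₀ hS]
      linarith
    linarith
  have huI : u ∈ Ioo f.left f.right := ⟨hw.1.trans_le u1, u2.trans_lt hwr⟩
  have hit' := (hf.between hwI hwI' u1 u2 hit).1
  have e' := hf.iter_sub hwI (Ioo_subset_Icc_self huI) hit'
  rw [hu, add_sub_cancel_left, mul_div_cancel₀ _ hS.ne', ← hu] at e'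
  have hfu : f.map^[n] u = f.crit := by linarith
  obtain ⟨η, hη, g⟩ := hf.exists_local_inverse huI hit'.symm.ne (half_pos hε)
  obtain ⟨t, ht, htd⟩ := Metric.mem_closure_iff.1 hc η hη
  rw [dist_comm, Real.dist_eq] at htd
  rw [hfu] at g
  obtain ⟨p, hp, hpu, hpit, hpe⟩ := g t htd
  refine ⟨p, mem_preimages_of_iter hp hpit.symm.ne (hpe ▸ ht), ?_⟩
  rw [dist_comm, Real.dist_eq, abs_lt]
  rw [abs_lt] at hpu
  constructor <;> linarith

/-! ### Renormalization -/

lemma IsPL.isLorenz (hf : f.IsPL a b) : f.IsLorenz where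
  left_lt := hf.left_lt
  lt_right := hf.lt_right
  continuousOn_left := by
    refine ContinuousOn.congr (f := fun x => f.right - a * (f.crit - x)) (by fun_prop) ?_
    exact fun x hx => hf.map_left x hx.1 hx.2
  continuousOn_right := by
    refine ContinuousOn.congr (f := fun x => f.left + b * (x - f.crit)) (by fun_prop) ?_
    exact fun x hx => hf.map_right x hx.1 hx.2
  strictMonoOn_left := by
    intro z hz w hw h
    rw [hf.map_left z hz.1 hz.2, hf.map_left w hw.1 hw.2]
    have := mul_lt_mul_of_pos_left h hf.a_pos
    linarith
  strictMonoOn_right := by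
    intro z hz w hw h
    rw [hf.map_right z hz.1 hz.2, hf.map_right w hw.1 hw.2]
    have := mul_lt_mul_of_pos_left h hf.b_pos
    linarith
  mapsTo := fun z hz => hf.map_mem hz.1 hz.2
  tendsto_left := by
    have h1 : Tendsto (fun x => f.right - a * (f.crit - x)) (𝓝[<] f.crit) (𝓝 f.right) := by
      have : Continuous fun x => f.right - a * (f.crit - x) := by fun_prop
      have h2 := this.tendsto f.crit
      simp only [sub_self, mul_zero, sub_zero] at h2
      exact h2.mono_left nhdsWithin_le_nhds
    refine h1.congr' ?_
    filter_upwards [Ioo_mem_nhdsLT hf.left_lt] with x hx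
    exact (hf.map_left x hx.1.le hx.2).symm
  tendsto_right := by
    have h1 : Tendsto (fun x => f.left + b * (x - f.crit)) (𝓝[>] f.crit) (𝓝 f.left) := by
      have : Continuous fun x => f.left + b * (x - f.crit) := by fun_prop
      have h2 := this.tendsto f.crit
      simp only [sub_self, mul_zero, add_zero] at h2
      exact h2.mono_left nhdsWithin_le_nhds
    refine h1.congr' ?_
    filter_upwards [Ioo_mem_nhdsGT hf.lt_right] with x hx
    exact (hf.map_right x hx.1 hx.2.le).symm

lemma LeftReturn.iterate_eq (hl : f.LeftReturn a b x ℓ) (hf : f.IsPL a b)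
    (hx : x ∈ Icc f.left f.right) {z : ℝ} (hz : z ∈ Ico x f.crit) :
    f.map^[ℓ] z = x + f.iterSlope a b ℓ x * (z - x) := by
  have := hf.iter_sub hx ⟨hx.1.trans hz.1, (hz.2.trans hf.lt_right).le⟩ (hl.itin z hz)
  rw [hl.per] at this
  linarith

lemma RightReturn.iterate_eq (hr : f.RightReturn a b y r) (hf : f.IsPL a b)
    (hy : y ∈ Icc f.left f.right) {z : ℝ} (hz : z ∈ Ioc f.crit y) :
    f.map^[r] z = y + f.iterSlope a b r y * (z - y) := by
  have := hf.iter_sub hy ⟨(hf.left_lt.trans hz.1).le, hz.2.trans hy.2⟩ (hr.itin z hz)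
  rw [hr.per] at this
  linarith

lemma LeftReturn.iterContOn (hl : f.LeftReturn a b x ℓ) (hf : f.IsPL a b)
    (hx : x ∈ Icc f.left f.right) : f.IterContOn ℓ (Ico x f.crit) := by
  refine ⟨fun z hz => (hl.itin z hz).symm.ne, ?_⟩
  refine ContinuousOn.congr (f := fun z => x + f.iterSlope a b ℓ x * (z - x)) (by fun_prop) ?_
  exact fun z hz => hl.iterate_eq hf hx hz

lemma RightReturn.iterContOn (hr : f.RightReturn a b y r) (hf : f.IsPL a b)
    (hy : y ∈ Icc f.left f.right) : f.IterContOn r (Ioc f.crit y) := by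
  refine ⟨fun z hz => (hr.itin z hz).symm.ne, ?_⟩
  refine ContinuousOn.congr (f := fun z => y + f.iterSlope a b r y * (z - y)) (by fun_prop) ?_
  exact fun z hz => hr.iterate_eq hf hy hz

lemma IterContOn.mono {n : ℕ} {S T : Set ℝ} (h : f.IterContOn n T) (hST : S ⊆ T) :
    f.IterContOn n S :=
  ⟨fun z hz => h.1 z (hST hz), h.2.mono hST⟩

lemma LeftReturn.isGreatest (hl : f.LeftReturn a b x ℓ) (hf : f.IsPL a b)
    (hx : x ∈ Icc f.left f.right) (hxc : x < f.crit) :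
    IsGreatest {n : ℕ | f.IterContOn n (Ioo x f.crit)} ℓ := by
  refine ⟨(hl.iterContOn hf hx).mono Ioo_subset_Ico_self, fun n hn => ?_⟩
  by_contra hcon
  push Not at hcon
  have hA := hl.one_lt hxc
  -- The point whose image under f^ℓ is exactly crit lies in (x, crit), so no higher iterate is
  -- defined on the whole interval.
  have hA0 : 0 < f.iterSlope a b ℓ x := by linarith
  have h1 : 0 < (f.crit - x) / f.iterSlope a b ℓ x := div_pos (by linarith) hA0
  have h2 : (f.crit - x) / f.iterSlope a b ℓ x < f.crit - x := div_lt_self (by linarith) hA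
  have hz : x + (f.crit - x) / f.iterSlope a b ℓ x ∈ Ioo x f.crit := ⟨by linarith, by linarith⟩
  refine hn.1 _ hz ℓ hcon ?_
  rw [hl.iterate_eq hf hx (Ioo_subset_Ico_self hz), add_sub_cancel_left,
    mul_div_cancel₀ _ hA0.ne']
  ring

lemma RightReturn.isGreatest (hr : f.RightReturn a b y r) (hf : f.IsPL a b)
    (hy : y ∈ Icc f.left f.right) (hyc : f.crit < y) :
    IsGreatest {n : ℕ | f.IterContOn n (Ioo f.crit y)} r := by
  refine ⟨(hr.iterContOn hf hy).mono Ioo_subset_Ioc_self, fun n hn => ?_⟩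
  by_contra hcon
  push Not at hcon
  have hA := hr.one_lt hyc
  have hA0 : 0 < f.iterSlope a b r y := by linarith
  have h1 : 0 < (y - f.crit) / f.iterSlope a b r y := div_pos (by linarith) hA0
  have h2 : (y - f.crit) / f.iterSlope a b r y < y - f.crit := div_lt_self (by linarith) hA
  have hz : y - (y - f.crit) / f.iterSlope a b r y ∈ Ioo f.crit y := ⟨by linarith, by linarith⟩
  refine hn.1 _ hz r hcon ?_
  rw [hr.iterate_eq hf hy (Ioo_subset_Ioc_self hz), sub_sub_cancel_left, mul_neg,
    mul_div_cancel₀ _ hA0.ne']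
  ring

/-- The Lorenz map associated with a completely invariant set. -/
lemma Frame.glue_isPL (h : f.Frame E e₀ e₁ x y) (hE : f.IsProperCompletelyInvariant E)
    (hf : f.IsPL a b) (hl : f.LeftReturn a b x ℓ) (hr : f.RightReturn a b y r) :
    (f.glue ℓ r (y - f.iterSlope a b r y * (y - f.crit))
      (x + f.iterSlope a b ℓ x * (f.crit - x))).IsPL
      (f.iterSlope a b ℓ x) (f.iterSlope a b r y) := by
  have hxc : x < f.crit := h.left.1.2
  have hyc : f.crit < y := h.right.1.2
  have hA := hl.one_lt hxc
  have hB := hr.one_lt hyc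
  have hu := h.right_bound hE hf hr
  have hv := h.left_bound hE hf hl
  have hxI := hE.mem_Icc h.left.1.1
  have hyI := hE.mem_Icc h.right.1.1
  have hul := hr.lt
  have hvr := hl.gt
  have hL : ∀ z, x ≤ z → z < f.crit → (if z < f.crit then f.map^[ℓ] z else f.map^[r] z) =
      x + f.iterSlope a b ℓ x * (z - x) := by
    intro z h1 h2
    rw [if_pos h2, hl.iterate_eq hf hxI ⟨h1, h2⟩]
  have hR : ∀ z, f.crit < z → z ≤ y → (if z < f.crit then f.map^[ℓ] z else f.map^[r] z) =
      y + f.iterSlope a b r y * (z - y) := by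
    intro z h1 h2
    rw [if_neg h1.le.not_gt, hr.iterate_eq hf hyI ⟨h1, h2⟩]
  have hgL := hL _ hu hul
  have hgR := hR _ hvr hv
  set A := f.iterSlope a b ℓ x
  set B := f.iterSlope a b r y
  set u := y - B * (y - f.crit) with hu'
  set v := x + A * (f.crit - x) with hv'
  refine ⟨hul, hvr, by linarith, by linarith, ?_, ?_, ?_, ?_, ?_⟩
  · intro z h1 h2
    simp only [glue] at h1 h2 ⊢
    rw [hL z (hu.trans h1) h2, hv']
    ring
  · intro z h1 h2
    simp only [glue] at h1 h2 ⊢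
    rw [hR z h1 (h2.trans hv), hu']
    ring
  · simp only [glue]
    rw [hgL]
    nlinarith
  · simp only [glue]
    rw [hgR]
    nlinarith
  · simp only [glue]
    rw [hgL, hgR]
    -- Overlap is automatic: as A, B > 1, the branch images have total length A(crit - u) + B(v -
    -- crit) > v - u.
    have e1 : x + A * (u - x) = v - A * (f.crit - u) := by rw [hv']; ring
    have e2 : y + B * (v - y) = u + B * (v - f.crit) := by rw [hu']; ring
    rw [e1, e2]
    nlinarith

/-- What a renormalization of a piecewise linear map looks like. -/
lemma IsPL.exists_of_isRenormalization (hf : f.IsPL a b) {g : LorenzData}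
    (hg : f.IsRenormalization ℓ r g) :
    ∃ E e₀ e₁ x y, f.IsProperCompletelyInvariant E ∧ f.Frame E e₀ e₁ x y ∧
      f.LeftReturn a b x ℓ ∧ f.RightReturn a b y r ∧
      g.IsPL (f.iterSlope a b ℓ x) (f.iterSlope a b r y) := by
  obtain ⟨-, -, u, v, -, -, -, -, -, rfl, hLor, E, hE, p, q, hp, hq, hpl, hqr⟩ := hg
  obtain ⟨e₀, e₁, x, y, h⟩ := hE.exists_frame hf
  obtain ⟨ℓ', hl⟩ := h.exists_leftReturn hE hf
  obtain ⟨r', hr⟩ := h.exists_rightReturn hE hf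
  obtain rfl := hp.unique h.left.isLUB
  obtain rfl := hq.unique h.right.isGLB
  obtain rfl := hpl.unique (hl.isGreatest hf (hE.mem_Icc h.left.1.1) h.left.1.2)
  obtain rfl := hqr.unique (hr.isGreatest hf (hE.mem_Icc h.right.1.1) h.right.1.2)
  have hPL := h.glue_isPL hE hf hl hr
  have hLor' := hPL.isLorenz
  -- The interval of a renormalization is not free: its ends are the one-sided limits of the
  -- iterates at the discontinuity.
  have hv : v = p + f.iterSlope a b ℓ p * (f.crit - p) :=
    tendsto_nhds_unique hLor.tendsto_left hLor'.tendsto_left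
  have hu : u = q - f.iterSlope a b r q * (q - f.crit) :=
    tendsto_nhds_unique hLor.tendsto_right hLor'.tendsto_right
  rw [hu, hv]
  exact ⟨E, e₀, e₁, p, q, hE, h, hl, hr, hPL⟩

/-- The core yields the minimal renormalization. -/
theorem IsCore.isMinimalRenormalization (hf : f.IsPL a b) (h : f.IsCore a b X e₀ e₁ x y ℓ r) :
    ∃ g, f.IsMinimalRenormalization g := by
  have hxc : x < f.crit := h.frame.left.1.2
  have hyc : f.crit < y := h.frame.right.1.2
  have hxI := h.inv.mem_Ioo h.frame.left.1.1
  have hyI := h.inv.mem_Ioo h.frame.right.1.1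
  have hu := h.frame.right_bound h.inv hf h.rightReturn
  have hv := h.frame.left_bound h.inv hf h.leftReturn
  have hPL := h.frame.glue_isPL h.inv hf h.leftReturn h.rightReturn
  have hgl := h.leftReturn.isGreatest hf (Ioo_subset_Icc_self hxI) hxc
  have hgr := h.rightReturn.isGreatest hf (Ioo_subset_Icc_self hyI) hyc
  refine ⟨_, ℓ, r, ⟨?_, ?_, _, _, ?_, ?_, Or.inl ?_, ?_, ?_, rfl, hPL.isLorenz, X, h.inv, x, y,
    h.frame.left.isLUB, h.frame.right.isGLB, hgl, hgr⟩, ?_⟩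
  · have h0 := h.leftReturn.pos
    rcases Nat.lt_or_ge 1 ℓ with h1 | h1
    · exact h1
    · have h2 := h.leftReturn.per
      rw [show ℓ = 1 by omega, Function.iterate_one, h.frame.map_x] at h2
      linarith [h.frame.greatest.2 h.frame.right.1.1]
  · have h0 := h.rightReturn.pos
    rcases Nat.lt_or_ge 1 r with h1 | h1
    · exact h1
    · have h2 := h.rightReturn.per
      rw [show r = 1 by omega, Function.iterate_one, h.frame.map_y] at h2
      linarith [h.frame.least.2 h.frame.left.1.1]
  · linarith [hxI.1]
  · linarith [hyI.2]
  · linarith [hxI.1]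
  · exact (h.leftReturn.iterContOn hf (Ioo_subset_Icc_self hxI)).mono (Ico_subset_Ico_left hu)
  · exact (h.rightReturn.iterContOn hf (Ioo_subset_Icc_self hyI)).mono (Ioc_subset_Ioc_right hv)
  · rintro ℓ' r' g' ⟨-, -, u', v', -, -, -, -, -, -, -, E', hE', p, q, hp, hq, hpl, hqr⟩
    -- The core lies in every competing set, so its gap is the widest, and iterates continuous on a
    -- wider gap are continuous on a narrower one.
    have hsub := h.subset hf hE'
    have hxp : x ≤ p := hp.1 ⟨hsub h.frame.left.1.1, hxc⟩
    have hqy : q ≤ y := hq.1 ⟨hsub h.frame.right.1.1, hyc⟩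
    exact ⟨hpl.2 (hgl.1.mono (Ioo_subset_Ioo_left hxp)),
      hqr.2 (hgr.1.mono (Ioo_subset_Ioo_right hqy))⟩

lemma IsMinimalRenormalization.unique {g g' : LorenzData} (h : f.IsMinimalRenormalization g)
    (h' : f.IsMinimalRenormalization g') : g = g' := by
  obtain ⟨ℓ, r, hg, hmin⟩ := h
  obtain ⟨ℓ', r', hg', hmin'⟩ := h'
  obtain rfl : ℓ = ℓ' := le_antisymm (hmin _ _ _ hg').1 (hmin' _ _ _ hg).1
  obtain rfl : r = r' := le_antisymm (hmin _ _ _ hg').2 (hmin' _ _ _ hg).2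
  obtain ⟨-, -, u, v, -, -, -, -, -, rfl, hL, -⟩ := hg
  obtain ⟨-, -, u', v', -, -, -, -, -, rfl, hL', -⟩ := hg'
  have hv : v = v' := tendsto_nhds_unique hL.tendsto_left hL'.tendsto_left
  have hu : u = u' := tendsto_nhds_unique hL.tendsto_right hL'.tendsto_right
  rw [hu, hv]

/-! ### Finiteness of the renormalization process. -/

lemma pow_le_iterSlope {s z : ℝ} {n : ℕ} (hs : 0 ≤ s) (ha : s ≤ a) (hb : s ≤ b)
    (hc : ∀ i < n, f.map^[i] z ≠ f.crit) : s ^ n ≤ f.iterSlope a b n z := by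
  rw [← Finset.card_range n, ← Finset.prod_const, Finset.card_range]
  refine Finset.prod_le_prod (fun _ _ => hs) fun i hi => ?_
  rcases lt_or_gt_of_ne (hc i (Finset.mem_range.1 hi)) with h | h
  · rwa [slope, if_pos h]
  · rwa [slope, if_neg h.le.not_gt, if_pos h]

/-- A renormalization of a piecewise linear map is piecewise linear and expanding, and it squares
lower bounds of the slopes. -/
lemma IsPL.renormalization (hf : f.IsPL a b) {g : LorenzData} (hg : f.IsMinimalRenormalization g) :
    ∃ a' b', g.IsPL a' b' ∧ 1 < a' ∧ 1 < b' ∧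
      ∀ s, 1 ≤ s → s ≤ a → s ≤ b → s ^ 2 ≤ a' ∧ s ^ 2 ≤ b' := by
  obtain ⟨ℓ, r, hg, -⟩ := hg
  obtain ⟨E, e₀, e₁, x, y, hE, h, hl, hr, hPL⟩ := hf.exists_of_isRenormalization hg
  refine ⟨_, _, hPL, hl.one_lt h.left.1.2, hr.one_lt h.right.1.2, fun s hs ha hb => ⟨?_, ?_⟩⟩
  · exact (pow_le_pow_right₀ hs hg.1).trans
      (pow_le_iterSlope (by linarith) ha hb fun i _ => hE.iter_ne h.left.1.1 i)
  · exact (pow_le_pow_right₀ hs hg.2.1).trans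
      (pow_le_iterSlope (by linarith) ha hb fun i _ => hE.iter_ne h.right.1.1 i)

lemma IsRenormalizationChain.isPL (hf : f.IsPL a b) {k : ℕ} {F : ℕ → LorenzData}
    (hF : f.IsRenormalizationChain k F) : ∀ i ≤ k, ∃ a' b', (F i).IsPL a' b' := by
  intro i
  induction i with
  | zero => exact fun _ => ⟨a, b, hF.1 ▸ hf⟩
  | succ i ih =>
    intro hi
    obtain ⟨a', b', h⟩ := ih (by omega)
    obtain ⟨a'', b'', h', -⟩ := h.renormalization (hF.2 i (by omega))
    exact ⟨a'', b'', h'⟩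

lemma IsRenormalizationChain.slopes (hf : f.IsPL a b) {s : ℝ} (hs : 1 ≤ s) (ha : s ≤ a)
    (hb : s ≤ b) {k : ℕ} {F : ℕ → LorenzData} (hF : f.IsRenormalizationChain k F) :
    ∀ i ≤ k, ∃ a' b', (F i).IsPL a' b' ∧ s ^ (i + 1) ≤ a' ∧ s ^ (i + 1) ≤ b' := by
  intro i
  induction i with
  | zero => exact fun _ => ⟨a, b, hF.1 ▸ hf, by simpa using ha, by simpa using hb⟩
  | succ i ih =>
    intro hi
    obtain ⟨a', b', h, h1, h2⟩ := ih (by omega)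
    obtain ⟨a'', b'', h', -, -, h3⟩ := h.renormalization (hF.2 i (by omega))
    obtain ⟨h4, h5⟩ := h3 _ (one_le_pow₀ hs) h1 h2
    have h6 : s ^ (i + 1 + 1) ≤ (s ^ (i + 1)) ^ 2 := by
      rw [← pow_mul]
      exact pow_le_pow_right₀ hs (by omega)
    exact ⟨a'', b'', h', h6.trans h4, h6.trans h5⟩

/-- The two branch images have lengths a(crit - left) and b(right - crit), each at most right -
left; add them. -/
lemma IsPL.slope_le_two (hf : f.IsPL a b) {s : ℝ} (ha : s ≤ a) (hb : s ≤ b) : s ≤ 2 := by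
  have h0 := hf.left_le
  have h1 := hf.le_right
  rw [hf.map_left_end] at h0
  rw [hf.map_right_end] at h1
  have hlc := hf.left_lt
  have hcr := hf.lt_right
  by_contra hcon
  push Not at hcon
  nlinarith

/-- The renormalization process stops after finitely many steps. -/
theorem IsPL.chain_bounded (hf : f.IsPL a b) :
    ∃ N, ∀ k F, f.IsRenormalizationChain k F → k ≤ N := by
  -- The first step is treated separately because one slope of f itself may be at most 1; powers are
  -- counted from the first renormalization.
  by_cases hex : ∃ g, f.IsMinimalRenormalization g
  · obtain ⟨g, hg⟩ := hex
    obtain ⟨a', b', hgPL, ha', hb', -⟩ := hf.renormalization hg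
    have hs : 1 < min a' b' := lt_min ha' hb'
    obtain ⟨N, hN⟩ := pow_unbounded_of_one_lt 2 hs
    refine ⟨N, fun k F hF => ?_⟩
    rcases k with _ | k
    · omega
    have hF1 : F 1 = g := by
      have := hF.2 0 (by omega)
      rw [hF.1] at this
      exact this.unique hg
    have hchain : g.IsRenormalizationChain k fun i => F (i + 1) :=
      ⟨hF1, fun i hi => hF.2 (i + 1) (by omega)⟩
    obtain ⟨a'', b'', hPL, h1, h2⟩ :=
      hchain.slopes hgPL hs.le (min_le_left _ _) (min_le_right _ _) k le_rfl
    have h3 := hPL.slope_le_two h1 h2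
    by_contra hcon
    have := pow_le_pow_right₀ hs.le (show N ≤ k + 1 by omega)
    linarith
  · refine ⟨0, fun k F hF => ?_⟩
    by_contra hcon
    have := hF.2 0 (by omega)
    rw [hF.1] at this
    exact hex ⟨_, this⟩

theorem IsPL.exists_isTimesRenormalizable (hf : f.IsPL a b) :
    ∃ m, f.IsTimesRenormalizable m ∧ ∀ k F, f.IsRenormalizationChain k F → k ≤ m := by
  classical
  obtain ⟨N, hN⟩ := hf.chain_bounded
  set P : ℕ → Prop := fun k => ∃ F, f.IsRenormalizationChain k F with hP
  have hP0 : P 0 := ⟨fun _ => f, rfl, fun i hi => absurd hi (by omega)⟩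
  have hmax : ∀ k F, f.IsRenormalizationChain k F → k ≤ Nat.findGreatest P N := fun k F hF =>
    Nat.le_findGreatest (hN k F hF) ⟨F, hF⟩
  obtain ⟨F, hF⟩ : P (Nat.findGreatest P N) := Nat.findGreatest_spec (Nat.zero_le N) hP0
  set m := Nat.findGreatest P N
  refine ⟨m, ⟨F, hF, ?_⟩, hmax⟩
  -- Any renormalization comes from a proper completely invariant set, which contains a core, so a
  -- minimal renormalization exists and the longest chain could be extended.
  rintro ⟨ℓ, r, g, hg⟩
  obtain ⟨a', b', hPL⟩ := hF.isPL hf m le_rfl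
  obtain ⟨E, -, -, -, -, hE, -⟩ := hPL.exists_of_isRenormalization hg
  obtain ⟨X, e₀, e₁, x, y, ℓ', r', -, hX⟩ := hPL.exists_core hE
  obtain ⟨g', hg'⟩ := hX.isMinimalRenormalization hPL
  have := hmax (m + 1) (Function.update F (m + 1) g') ⟨?_, fun i hi => ?_⟩
  · omega
  · rw [Function.update_of_ne (by omega), hF.1]
  · rw [Function.update_of_ne (by omega)]
    rcases Nat.lt_or_ge i m with h | h
    · rw [Function.update_of_ne (by omega)]
      exact hF.2 i h
    · obtain rfl : i = m := by omega
      rw [Function.update_self]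
      exact hg'

/-! ### The dichotomy -/

lemma IsPL.exists_isMinPeriodOrbit (hf : f.IsPL a b) : ∃ O, f.IsMinPeriodOrbit O := by
  classical
  have hex : ∃ n z, f.IsPeriodicPoint z ∧ Function.minimalPeriod f.map z = n := by
    obtain ⟨z, hz, n, hn, h1, h2⟩ := hf.isGood.2
    exact ⟨_, z, ⟨Ioo_subset_Icc_self hz, h2, n, hn, h1⟩, rfl⟩
  obtain ⟨z, hz, e⟩ := Nat.find_spec hex
  exact ⟨_, z, hz, rfl, fun w hw => e ▸ Nat.find_min' hex ⟨w, hw, rfl⟩⟩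

lemma IsCore.minimalRenormalizationIsPeriodic (hf : f.IsPL a b)
    (h : f.IsCore a b X e₀ e₁ x y ℓ r) : f.MinimalRenormalizationIsPeriodic := by
  obtain ⟨O, hO⟩ := hf.exists_isMinPeriodOrbit
  obtain rfl := h.eq_of_isMinPeriodOrbit hf hO
  exact ⟨O, hO, fun O' hO' => h.eq_of_isMinPeriodOrbit hf hO', h.isMinimal hf⟩

theorem IsPL.minimalRenormalizationIsPeriodic (hf : f.IsPL a b) {g : LorenzData}
    (hg : f.IsMinimalRenormalization g) : f.MinimalRenormalizationIsPeriodic := by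
  obtain ⟨ℓ, r, hg, -⟩ := hg
  obtain ⟨E, -, -, -, -, hE, -⟩ := hf.exists_of_isRenormalization hg
  obtain ⟨X, e₀, e₁, x, y, ℓ', r', -, hX⟩ := hf.exists_core hE
  exact hX.minimalRenormalizationIsPeriodic hf

theorem IsPL.dichotomy (hf : f.IsPL a b) :
    ∃ D, f.IsMinimalCompletelyInvariant D ∧ ∀ O, f.IsMinPeriodOrbit O →
      (O.Nontrivial → D = f.preimageClosure O) ∧ (D = O ∨ D = Icc f.left f.right) := by
  by_cases hex : ∃ E, f.IsProperCompletelyInvariant E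
  · obtain ⟨E, hE⟩ := hex
    obtain ⟨X, e₀, e₁, x, y, ℓ, r, -, hX⟩ := hf.exists_core hE
    refine ⟨X, hX.isMinimal hf, fun O hO => ?_⟩
    obtain rfl := hX.eq_of_isMinPeriodOrbit hf hO
    exact ⟨fun _ => (hX.preimageClosure_eq hf).symm, Or.inl rfl⟩
  · push Not at hex
    refine ⟨Icc f.left f.right, ⟨Or.inl rfl, ?_⟩, fun O hO =>
      ⟨fun hnt => (hf.preimageClosure_eq_Icc hex hO hnt).symm, Or.inr rfl⟩⟩
    rintro E (rfl | hE)
    · exact subset_rfl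
    · exact absurd hE (hex E)

lemma isPL_pwLinear {a b c : ℝ} (hf : (pwLinear a b c).IsLorenz)
    (havg : 1 < a * c + b * (1 - c)) : (pwLinear a b c).IsPL a b := by
  have h0 : 0 < c := hf.left_lt
  have h1 : c < 1 := hf.lt_right
  have e0 : (pwLinear a b c).map 0 = 1 - a * c := by simp [pwLinear, h0]
  have e1 : (pwLinear a b c).map 1 = b * (1 - c) := by simp [pwLinear, h1.le.not_gt]
  have m0 := hf.mapsTo (show (0 : ℝ) ∈ Icc (0 : ℝ) 1 \ {c} from ⟨⟨le_rfl, zero_le_one⟩, h0.ne⟩)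
  have m1 := hf.mapsTo (show (1 : ℝ) ∈ Icc (0 : ℝ) 1 \ {c} from ⟨⟨zero_le_one, le_rfl⟩, h1.ne'⟩)
  refine ⟨h0, h1, ?_, ?_, ?_, ?_, m0.1, m1.2, ?_⟩
  · have := hf.strictMonoOn_left (show (0 : ℝ) ∈ Ico (0 : ℝ) c from ⟨le_rfl, h0⟩)
      (show c / 2 ∈ Ico (0 : ℝ) c from ⟨by linarith, by linarith⟩) (by linarith)
    rw [e0] at this
    simp only [pwLinear, if_pos (show c / 2 < c by linarith)] at this
    by_contra hcon
    push Not at hcon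
    nlinarith
  · have := hf.strictMonoOn_right (show (c + 1) / 2 ∈ Ioc c 1 from ⟨by linarith, by linarith⟩)
      (show (1 : ℝ) ∈ Ioc c 1 from ⟨h1, le_rfl⟩) (by linarith)
    rw [e1] at this
    simp only [pwLinear, if_neg (show ¬ (c + 1) / 2 < c by linarith)] at this
    by_contra hcon
    push Not at hcon
    nlinarith
  · intro x _ hx
    simp only [pwLinear] at hx ⊢
    rw [if_pos hx]
    ring
  · intro x hx _
    simp only [pwLinear] at hx ⊢
    rw [if_neg hx.le.not_gt]
    ring
  -- Overlap, 1 - ac < b(1 - c), is a restatement of expansion on average.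
  · change (pwLinear a b c).map 0 < (pwLinear a b c).map 1
    rw [e0, e1]
    linarith

end LorenzData

/-- Periodicity of the renormalization R^(i+1) f is a property of `F i`, whence the index range i <
k. Minimal period greater than 1 is expressed by `O.Nontrivial`. -/
theorem mainTheorem2 (a b c : ℝ) (hf : (LorenzData.pwLinear a b c).IsLorenz)
    (havg : 1 < a * c + b * (1 - c)) :
    (∃ m, (LorenzData.pwLinear a b c).IsTimesRenormalizable m ∧
      ∀ k F, (LorenzData.pwLinear a b c).IsRenormalizationChain k F → k ≤ m) ∧
    (∀ k F, (LorenzData.pwLinear a b c).IsRenormalizationChain k F →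
      ∀ i < k, (F i).MinimalRenormalizationIsPeriodic) ∧
    (∃ O, (LorenzData.pwLinear a b c).IsMinPeriodOrbit O) ∧
    ∃ D, (LorenzData.pwLinear a b c).IsMinimalCompletelyInvariant D ∧
      ∀ O, (LorenzData.pwLinear a b c).IsMinPeriodOrbit O →
        (O.Nontrivial → D = (LorenzData.pwLinear a b c).preimageClosure O) ∧
        (D = O ∨ D = Icc 0 1) := by
  have hPL := LorenzData.isPL_pwLinear hf havg
  refine ⟨hPL.exists_isTimesRenormalizable, fun k F hF i hi => ?_,
    hPL.exists_isMinPeriodOrbit, hPL.dichotomy⟩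
  obtain ⟨a', b', h⟩ := hF.isPL hPL i hi.le
  exact h.minimalRenormalizationIsPeriodic (hF.2 i hi)
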